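/- Let $(M,g)$ be a smooth Riemannian manifold of dimension $n\ge 4$ with Levi-Civita connection $\nabla$, curvature tensor $R(X,Y,Z,T)=g(\nabla_X\nabla_YZ-\nabla_Y\nabla_XZ-\nabla_{[X,Y]}Z,T)$, Ricci tensor $\mathrm{Ric}(X,Y)=\mathrm{tr}(V\mapsto R_{V,X}Y)$, scalar curvature $S$, Schouten tensor $\mathfrak k=\frac1{n-2}\bigl(\mathrm{Ric}-\frac{S}{2(n-1)}g\bigr)$ and Weyl tensor $$W(X,Y,Z,T)=R(X,Y,Z,T)-g(X,T)\mathfrak k(Y,Z)-g(Y,Z)\mathfrak k(X,T)+g(X,Z)\mathfrak k(Y,T)+g(Y,T)\mathfrak k(X,Z).$$ Let $e_1,\dots,e_n$ denote a $g$-orthonormal basis of $T_pM$ and write $v^*=g(v,\cdot)$. * $\mathcal E_p=\{v\in T_pM : W(v,\cdot,\cdot,\cdot)=0\}$, and $M_{\mathcal E}$ is the set of points of $M$ at which $\operatorname{rank}(\mathcal E)=\dim\mathcal E_p$ is locally constant. * $\mathcal W$ is the endomorphism of $(0,2)$ tensors determined by $\mathcal W(X^*\otimes Y^*)(Z,T)=W(Y,Z,T,X)$;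 $\delta W(X,Y,Z)=\sum_j(\nabla_{e_j}W)(X,Y,Z,e_j)$ and $\delta W_Z(X,Y)=\delta W(X,Y,Z)$. * $\mathfrak w:T^*_pM\to T^*_pM$, $\mathfrak w(\theta)=\sum_i e_i\llcorner\mathcal W^2(e_i^*\wedge\theta)$, where $\alpha\wedge\theta=\alpha\otimes\theta-\theta\otimes\alpha$, and $\mathfrak w^\#$ is its Moore–Penrose inverse with respect to $g$. * $\mathbb T$ is the vector field with $g(\mathbb T,\cdot)=\frac1{n-3}\,\mathfrak w^\#\bigl(\sum_i e_i\llcorner\mathcal W(\delta W_{e_i})\bigr)$. * For a vector field $V$, the conformal Ricci tensor is $$E_V=\mathrm{Ric}-\tfrac Sn g+(n-2)\Bigl(\nabla V^*+V^*\otimes V^*-\tfrac1n\bigl[\operatorname{div}V+g(V,V)\bigr]g\Bigr).$$ Let $U\subseteq M$ be open (for instance $U=M$), let $\varphi$ be a smooth function on $U$, let $\bar g=e^{-2\varphi}g$ on $U$, and let bars denote the objects formed with $\bar g$. Then: 0. $M_{\mathcal E}$ is open, $M_{\bar{\mathcal E}}\cap U=M_{\mathcal E}\cap U$, $\mathbb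 T$ is smooth on $M_{\mathcal E}$ and $\bar{\mathbb T}$ is smooth on $M_{\mathcal E}\cap U$ (so that the tensors below are defined there). 1. If $\nabla^g\varphi(p)$ lies in the $g$-orthogonal complement $\mathcal E_p^\perp$ for every $p\in M_{\mathcal E}\cap U$, then $\bar E_{\bar{\mathbb T}}=E_{\mathbb T}$ on $M_{\mathcal E}\cap U$. 2. Without any condition on $\varphi$, $\bar E_{\bar{\mathbb T}}=E_{\mathbb T}$ holds at every $p\in M_{\mathcal E}\cap U$ with $\dim\mathcal E_p=0$. In particular, if $\operatorname{rank}(\mathcal E)=0$ on $M_{\mathcal E}$, then $E_{\mathbb T}$ is a conformal invariant (of weight zero) on $M_{\mathcal E}$. 3. If $n=4$, every $p\in U$ with $W_p\ne0$ lies in $M_{\mathcal E}$ and satisfies $\dim\mathcal E_p=0$, and $\bar E_{\bar{\mathbb T}}=E_{\mathbb T}$ holds there. Thus $E_{\mathbb T}$ is a conformal invariant on $\{p\in M : W(p)\neq0\}$. -/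

import Mathlib

open scoped Manifold ContDiff Topology

noncomputable section

namespace ConformalRicci

/-- Vector fields on an `n`-dimensional manifold `M` (no regularity imposed). -/
abbrev VField (n : ℕ) (M : Type*) [TopologicalSpace M]
    [ChartedSpace (EuclideanSpace ℝ (Fin n)) M] : Type _ :=
  (p : M) → TangentSpace (𝓡 n) p

/-- The cotangent space `T*_p M`. -/
abbrev Cotangent (n : ℕ) {M : Type*} [TopologicalSpace M]
    [ChartedSpace (EuclideanSpace ℝ (Fin n)) M] (p : M) : Type _ :=
  TangentSpace (𝓡 n) p →L[ℝ] ℝ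

/-- Fields of bilinear forms on the tangent spaces. Metrics are of this type; the geometric
objects below only depend on the germ of such a field at the point under consideration, and they
have their usual meaning at every point near which the field is a smooth Riemannian metric. -/
abbrev BilinField (n : ℕ) (M : Type*) [TopologicalSpace M]
    [ChartedSpace (EuclideanSpace ℝ (Fin n)) M] : Type _ :=
  (p : M) → TangentSpace (𝓡 n) p →L[ℝ] TangentSpace (𝓡 n) p →L[ℝ] ℝ

variable {n : ℕ} {M : Type*} [TopologicalSpace M] [ChartedSpace (EuclideanSpace ℝ (Fin n)) M]
  [IsManifold (𝓡 n) ∞ M]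

/-! ### Levi-Civita connection -/

/-- A `g`-orthonormal basis `e_1, …, e_n` of `T_p M`. -/
def frame (g : BilinField n M) (p : M) : Fin n → TangentSpace (𝓡 n) p :=
  Classical.epsilon fun e => ∀ i j, g p (e i) (e j) = if i = j then 1 else 0

/-- A vector field, smooth near `p`, whose value at `p` is `v` (it is constant near `p` in the
preferred chart at `p`). -/
def extendVec {p : M} (v : TangentSpace (𝓡 n) p) : VField n M :=
  FiberBundle.extend (EuclideanSpace ℝ (Fin n)) v

/-- The Koszul expression, i.e. `g(∇_X Y, Z)` at `p`. -/
def koszul (g : BilinField n M) (X Y Z : VField n M) (p : M) : ℝ :=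
  (1 / 2 : ℝ) *
    (mvfderiv (𝓡 n) (fun q => g q (Y q) (Z q)) p (X p)
      + mvfderiv (𝓡 n) (fun q => g q (X q) (Z q)) p (Y p)
      - mvfderiv (𝓡 n) (fun q => g q (X q) (Y q)) p (Z p)
      + g p (VectorField.mlieBracket (𝓡 n) X Y p) (Z p)
      - g p (VectorField.mlieBracket (𝓡 n) X Z p) (Y p)
      - g p (VectorField.mlieBracket (𝓡 n) Y Z p) (X p))

/-- The Levi-Civita connection: `nabla g p v Y = (∇_v Y)(p)` for `v ∈ T_p M`. -/
def nabla (g : BilinField n M) (p : M) (v : TangentSpace (𝓡 n) p) (Y : VField n M) :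
    TangentSpace (𝓡 n) p :=
  ∑ i, koszul g (extendVec v) Y (extendVec (frame g p i)) p • frame g p i

/-- The vector field `∇^g φ` dual to `dφ`. -/
def gradient (g : BilinField n M) (φ : M → ℝ) : VField n M := fun p =>
  ∑ i, mvfderiv (𝓡 n) φ p (frame g p i) • frame g p i

/-- The divergence of a vector field. -/
def divergence (g : BilinField n M) (V : VField n M) (p : M) : ℝ :=
  ∑ i, g p (nabla g p (frame g p i) V) (frame g p i)

/-! ### Curvature -/

/-- The curvature endomorphism `R_{x,y} z = ∇_x ∇_Y Z - ∇_y ∇_X Z - ∇_{[X,Y]} Z`. -/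
def curvEndo (g : BilinField n M) (p : M) (x y z : TangentSpace (𝓡 n) p) :
    TangentSpace (𝓡 n) p :=
  nabla g p x (fun q => nabla g q (extendVec y q) (extendVec z))
    - nabla g p y (fun q => nabla g q (extendVec x q) (extendVec z))
    - nabla g p (VectorField.mlieBracket (𝓡 n) (extendVec x) (extendVec y) p) (extendVec z)

/-- The Riemann tensor `R(x,y,z,t) = g(R_{x,y} z, t)`. -/
def riem (g : BilinField n M) (p : M) (x y z t : TangentSpace (𝓡 n) p) : ℝ :=
  g p (curvEndo g p x y z) t

/-- The Ricci tensor `Ric(x,y) = trace (v ↦ R_{v,x} y)`. -/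
def ric (g : BilinField n M) (p : M) (x y : TangentSpace (𝓡 n) p) : ℝ :=
  ∑ i, riem g p (frame g p i) x y (frame g p i)

/-- The scalar curvature. -/
def scal (g : BilinField n M) (p : M) : ℝ :=
  ∑ i, ric g p (frame g p i) (frame g p i)

/-- The Schouten tensor. -/
def schouten (g : BilinField n M) (p : M) (x y : TangentSpace (𝓡 n) p) : ℝ :=
  1 / ((n : ℝ) - 2) * (ric g p x y - 1 / (2 * ((n : ℝ) - 1)) * scal g p * g p x y)

/-- The Weyl tensor: the Riemann tensor minus the Kulkarni-Nomizu product of `g` and the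
Schouten tensor. -/
def weyl (g : BilinField n M) (p : M) (x y z t : TangentSpace (𝓡 n) p) : ℝ :=
  riem g p x y z t -
    (g p x t * schouten g p y z + g p y z * schouten g p x t
      - g p x z * schouten g p y t - g p y t * schouten g p x z)

/-- The covariant derivative `(∇_v W)(x,y,z,t)` of the Weyl tensor. -/
def nablaWeyl (g : BilinField n M) (p : M) (v x y z t : TangentSpace (𝓡 n) p) : ℝ :=
  mvfderiv (𝓡 n) (fun q => weyl g q (extendVec x q) (extendVec y q) (extendVec z q) (extendVec t q)) p v
    - weyl g p (nabla g p v (extendVec x)) y z t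
    - weyl g p x (nabla g p v (extendVec y)) z t
    - weyl g p x y (nabla g p v (extendVec z)) t
    - weyl g p x y z (nabla g p v (extendVec t))

/-- The divergence `δW(x,y,z) = ∑ⱼ (∇_{eⱼ} W)(x,y,z,eⱼ)` of the Weyl tensor. -/
def divWeyl (g : BilinField n M) (p : M) (x y z : TangentSpace (𝓡 n) p) : ℝ :=
  ∑ j, nablaWeyl g p (frame g p j) x y z (frame g p j)

/-! ### The null spaces of the Weyl tensor -/

/-- The subspace `𝓔_p = {v ∈ T_p M | W(v,·,·,·) = 0}`. (The set on the right is a subspace because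
`W` is linear in `v`, so that taking the span adds nothing.) -/
def weylNull (g : BilinField n M) (p : M) : Submodule ℝ (TangentSpace (𝓡 n) p) :=
  Submodule.span ℝ {v | ∀ y z t, weyl g p v y z t = 0}

/-- The rank of `𝓔` at `p`. -/
def rankE (g : BilinField n M) (p : M) : ℕ := Module.finrank ℝ (weylNull g p)

/-- The set `M_𝓔` of all points at which the rank of `𝓔` is locally constant. -/
def regularSet (g : BilinField n M) : Set M :=
  {p | ∀ᶠ q in 𝓝 p, rankE g q = rankE g p}

/-! ### The vector field `𝕋` -/

/-- The endomorphism of `(0,2)` tensors induced by the Weyl tensor: it is the linear map with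
`x* ⊗ y* ↦ ((z,t) ↦ W(y,z,t,x))`. -/
def weylOp (g : BilinField n M) (p : M) :
    (TangentSpace (𝓡 n) p → TangentSpace (𝓡 n) p → ℝ) →ₗ[ℝ]
      (TangentSpace (𝓡 n) p → TangentSpace (𝓡 n) p → ℝ) where
  toFun b := fun z t =>
    ∑ i, ∑ j, b (frame g p i) (frame g p j) * weyl g p (frame g p j) z t (frame g p i)
  map_add' b c := by
    funext z t
    simp [add_mul, Finset.sum_add_distrib]
  map_smul' a b := by
    funext z t
    simp [Finset.mul_sum, mul_assoc]

/-- The wedge product `α ∧ θ = α ⊗ θ - θ ⊗ α` of covectors, as a linear map in `θ`. -/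
def wedge {p : M} (α : Cotangent n p) :
    Cotangent n p →ₗ[ℝ] (TangentSpace (𝓡 n) p → TangentSpace (𝓡 n) p → ℝ) where
  toFun θ := fun x y => α x * θ y - θ x * α y
  map_add' θ η := by
    funext x y
    simp only [add_apply, Pi.add_apply]
    ring
  map_smul' a θ := by
    funext x y
    simp only [smul_apply, Pi.smul_apply, smul_eq_mul, RingHom.id_apply]
    ring

/-- For `(0,2)` tensors `b_1, …, b_n` at `p`, the covector `∑ᵢ eᵢ ⌟ bᵢ`, i.e. the covector with
value `∑ᵢ bᵢ(eᵢ, eⱼ)` on `eⱼ` for each `j` (the covectors `g(eⱼ,·)` are the cobase of `e`). -/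
def contract (g : BilinField n M) (p : M) :
    (Fin n → TangentSpace (𝓡 n) p → TangentSpace (𝓡 n) p → ℝ) →ₗ[ℝ] Cotangent n p where
  toFun b := ∑ j, (∑ i, b i (frame g p i) (frame g p j)) • g p (frame g p j)
  map_add' b c := by
    simp [add_smul, Finset.sum_add_distrib]
  map_smul' a b := by
    simp [Finset.smul_sum, smul_smul, ← Finset.mul_sum]

/-- The negative Ricci contraction `θ ↦ ∑ᵢ eᵢ ⌟ 𝒲²(eᵢ* ∧ θ)` of the square of the Weyl
operator. -/
def frakW (g : BilinField n M) (p : M) : Cotangent n p →ₗ[ℝ] Cotangent n p :=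
  contract g p ∘ₗ LinearMap.pi fun i =>
    weylOp g p ∘ₗ weylOp g p ∘ₗ wedge (g p (frame g p i))

/-- The inner product on `T*_p M` induced by `g`. -/
def coInner (g : BilinField n M) (p : M) (α β : Cotangent n p) : ℝ :=
  ∑ i, α (frame g p i) * β (frame g p i)

/-- `B` is the Moore-Penrose inverse of `A` with respect to the inner product `h`. -/
structure IsMoorePenrose {V : Type*} [AddCommGroup V] [Module ℝ V] (h : V → V → ℝ)
    (A B : V →ₗ[ℝ] V) : Prop where
  aba : A ∘ₗ B ∘ₗ A = A
  bab : B ∘ₗ A ∘ₗ B = B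
  symm_ab : ∀ v w, h (A (B v)) w = h v (A (B w))
  symm_ba : ∀ v w, h (B (A v)) w = h v (B (A w))

/-- The Moore-Penrose inverse of `A` with respect to the inner product `h`. -/
def moorePenrose {V : Type*} [AddCommGroup V] [Module ℝ V] (h : V → V → ℝ)
    (A : V →ₗ[ℝ] V) : V →ₗ[ℝ] V :=
  Classical.epsilon fun B => IsMoorePenrose h A B

/-- The one-form dual to `𝕋`, namely `1/(n-3) 𝔴^#(∑ᵢ eᵢ ⌟ 𝒲(δW_{eᵢ}))`, where
`δW_z(x,y) = δW(x,y,z)`. -/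
def fieldTDual (g : BilinField n M) (p : M) : Cotangent n p :=
  (1 / ((n : ℝ) - 3)) • moorePenrose (coInner g p) (frakW g p)
    (contract g p fun i => weylOp g p fun x y => divWeyl g p x y (frame g p i))

/-- The vector field `𝕋`. -/
def fieldT (g : BilinField n M) : VField n M := fun p =>
  ∑ j, fieldTDual g p (frame g p j) • frame g p j

/-! ### The conformal Ricci tensor -/

/-- The conformal Ricci tensor `E_V` with respect to the vector field `V`. -/
def confRicci (g : BilinField n M) (V : VField n M) (p : M) (x y : TangentSpace (𝓡 n) p) : ℝ :=
  ric g p x y - scal g p / n * g p x y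
    + ((n : ℝ) - 2) * (g p (nabla g p x V) y + g p (V p) x * g p (V p) y
      - 1 / (n : ℝ) * (divergence g V p + g p (V p) (V p)) * g p x y)

/-- The conformally changed metric `e^{-2φ} g`. -/
def conformalChange (φ : M → ℝ) (g : BilinField n M) : BilinField n M := fun p =>
  Real.exp (-2 * φ p) • g p

/-- The vector field `V` is smooth on the set `s`. -/
def SmoothFieldOn (V : VField n M) (s : Set M) : Prop :=
  ContMDiffOn (𝓡 n) ((𝓡 n).prod 𝓘(ℝ, EuclideanSpace ℝ (Fin n))) ∞
    (fun p => (Bundle.TotalSpace.mk' (EuclideanSpace ℝ (Fin n)) p (V p) :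
      TangentBundle (𝓡 n) M)) s

end ConformalRicci

end

/-! The heart of the matter is a transformation law: where `∇φ` is orthogonal to `𝓔`, the one-form
dual to `𝕋` changes by `-dφ` (`fieldTDual_conformal`). Any vector field obeying this law near a
point has an invariant conformal Ricci tensor there. Indeed the Schouten tensor changes by `P = Hess
φ + dφ ⊗ dφ - ½ |dφ|² g`, while `∇V* + V* ⊗ V*` changes by `-P` up to a multiple of `g`. So `Ric +
(n-2)(∇V* + V* ⊗ V*)` changes only by a multiple of `g`, and `E_V` is its trace-free part
(`confRicci_conformal`).

The law for `𝕋` comes from the Weyl tensor. As a `(0,4)` tensor it is multiplied by `e^{-2φ}`, and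
its divergence becomes `δW - (n-3) W(·,·,·,∇φ)` (`weyl_conformal`, `divWeyl_conformal`). The Bianchi
identity gives `𝔴(θ)(v) = ½ ∑ W(a,b,c,θ^♯) W(a,b,c,v)`, summed over a frame (`frakW_apply`). The
same computation turns the correction of `δW` into `𝔴(dφ)`: the covector under `𝔴^#` is multiplied
by `e^{4φ}` after subtraction of `(n-3) 𝔴(dφ)`, and `𝔴` itself is multiplied by `e^{4φ}`. Being a
Gram operator, `𝔴` is self-adjoint with kernel dual to `𝓔`, so `𝔴^# 𝔴` fixes the covectors
orthogonal to `𝓔`.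

Differentiating `𝕋` requires its smoothness. Up to the factor `1/(n-3)`, `𝕋` is the only solution in
the range of `A` of `A A z = A Y`, where `A` is the endomorphism `𝔴` in coordinates, and where the
rank of `A` is constant this solution is smooth (`contDiffAt_of_const_rank`).

In dimension four, a unit null vector of `W` would leave a trace-free curvature tensor on its
three-dimensional complement, and such a tensor is zero (`eq_zero_of_null`). So `W ≠ 0` forces `𝓔 =
0`, at the point and near it.

The analysis is done in a vector space and carried over by inverse charts. The orthonormal frames
are chosen pointwise without any continuity, so traces are rewritten in frame-independent form
(`contraction`, `contraction_eq_sum`). -/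

noncomputable section

set_option maxSynthPendingDepth 3
set_option linter.unusedSectionVars false

namespace ConformalRicci

/-! ### Levi-Civita connection of a metric on an open subset of a vector space -/

section Flat

variable {E : Type*} [NormedAddCommGroup E] [NormedSpace ℝ E]

/-- A smooth Riemannian metric on an open subset of a vector space. -/
structure IsFlatMetric (G : E → E →L[ℝ] E →L[ℝ] ℝ) (O : Set E) : Prop where
  isOpen : IsOpen O
  symm : ∀ x ∈ O, ∀ u v, G x u v = G x v u
  pos : ∀ x ∈ O, ∀ v, v ≠ 0 → 0 < G x v v
  smooth : ∀ x ∈ O, ContDiffAt ℝ ∞ G x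

/-- Raising the index of a covector. -/
def sharp (G : E → E →L[ℝ] E →L[ℝ] ℝ) (x : E) : (E →L[ℝ] ℝ) →L[ℝ] E := (G x).inverse

/-- The Christoffel symbols of the first kind. -/
def christoffelLower (G : E → E →L[ℝ] E →L[ℝ] ℝ) (x : E) : E →L[ℝ] E →L[ℝ] E →L[ℝ] ℝ :=
  (1 / 2 : ℝ) • (fderiv ℝ G x + (fderiv ℝ G x).flip -
    ((ContinuousLinearMap.flipₗᵢ ℝ E E ℝ).toContinuousLinearEquiv :
      (E →L[ℝ] E →L[ℝ] ℝ) →L[ℝ] (E →L[ℝ] E →L[ℝ] ℝ)) ∘L (fderiv ℝ G x).flip)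

/-- The Christoffel symbols as a bilinear map. -/
def christoffel (G : E → E →L[ℝ] E →L[ℝ] ℝ) (x : E) : E →L[ℝ] E →L[ℝ] E :=
  (ContinuousLinearMap.compL ℝ E (E →L[ℝ] ℝ) E (sharp G x)) ∘L christoffelLower G x

/-- The covariant derivative of a vector field in coordinates. -/
def flatNabla (G : E → E →L[ℝ] E →L[ℝ] ℝ) (x u : E) (Y : E → E) : E :=
  fderiv ℝ Y x u + christoffel G x u (Y x)

/-- The curvature endomorphism in coordinates. -/
def flatCurv (G : E → E →L[ℝ] E →L[ℝ] ℝ) (x u v w : E) : E :=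
  fderiv ℝ (christoffel G) x u v w - fderiv ℝ (christoffel G) x v u w
    + christoffel G x u (christoffel G x v w) - christoffel G x v (christoffel G x u w)

lemma christoffelLower_apply (G : E → E →L[ℝ] E →L[ℝ] ℝ) (x u v w : E) :
    christoffelLower G x u v w =
      1 / 2 * (fderiv ℝ G x u v w + fderiv ℝ G x v u w - fderiv ℝ G x w u v) := by
  simp [christoffelLower]

variable {G : E → E →L[ℝ] E →L[ℝ] ℝ} {O : Set E} {x : E}

namespace IsFlatMetric

variable (hG : IsFlatMetric G O) (hx : x ∈ O)
include hG hx

lemma mem_nhds : O ∈ 𝓝 x := hG.isOpen.mem_nhds hx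

lemma hasFDerivAt : HasFDerivAt G (fderiv ℝ G x) x :=
  ((hG.smooth x hx).differentiableAt (by simp)).hasFDerivAt

lemma fderiv_symm (u v w : E) : fderiv ℝ G x u v w = fderiv ℝ G x u w v := by
  have h := hG.hasFDerivAt hx
  have h1 : HasFDerivAt (fun y => G y v w) _ x :=
    (h.clm_apply (hasFDerivAt_const v x)).clm_apply (hasFDerivAt_const w x)
  have h2 : HasFDerivAt (fun y => G y w v) _ x :=
    (h.clm_apply (hasFDerivAt_const w x)).clm_apply (hasFDerivAt_const v x)
  have h3 := h1.congr_of_eventuallyEq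
    (Filter.eventuallyEq_of_mem (hG.mem_nhds hx) fun y hy => hG.symm y hy w v)
  simpa using congrArg (fun L => L u) (h3.unique h2)

variable [FiniteDimensional ℝ E]

lemma isInvertible : (G x).IsInvertible := by
  have hinj : Function.Injective (G x) := by
    rw [injective_iff_map_eq_zero]
    intro v hv
    by_contra hne
    have := hG.pos x hx v hne
    simp [hv] at this
  have hd : Module.finrank ℝ E = Module.finrank ℝ (E →L[ℝ] ℝ) := by
    rw [← (LinearMap.toContinuousLinearMap (𝕜 := ℝ) (E := E) (F' := ℝ)).finrank_eq]
    exact (Subspace.dual_finrank_eq).symm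
  exact ⟨(LinearEquiv.ofInjectiveOfFinrankEq (G x).toLinearMap hinj hd).toContinuousLinearEquiv,
    by ext; rfl⟩

lemma apply_sharp (α : E →L[ℝ] ℝ) : G x (sharp G x α) = α := by
  have := (hG.isInvertible hx).self_comp_inverse
  exact congrArg (fun L => L α) this

lemma sharp_apply (v : E) : sharp G x (G x v) = v := by
  have := (hG.isInvertible hx).inverse_comp_self
  exact congrArg (fun L => L v) this

lemma ext_inner {v w : E} (h : ∀ t, G x v t = G x w t) : v = w := by
  rw [← hG.sharp_apply hx v, ← hG.sharp_apply hx w]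
  congr 1
  ext t
  exact h t

lemma smooth_sharp : ContDiffAt ℝ ∞ (sharp G) x := by
  obtain ⟨e, he⟩ := hG.isInvertible hx
  have := FiniteDimensional.complete ℝ E
  have h1 : ContDiffAt ℝ ∞ (ContinuousLinearMap.inverse (M := E) (M₂ := E →L[ℝ] ℝ) (R := ℝ)) (G x) :=
    he ▸ contDiffAt_map_inverse e
  exact h1.comp x (hG.smooth x hx)

omit [FiniteDimensional ℝ E] in
lemma smooth_fderiv : ContDiffAt ℝ ∞ (fderiv ℝ G) x :=
  (hG.smooth x hx).fderiv_right (by simp)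

lemma smooth_christoffel : ContDiffAt ℝ ∞ (christoffel G) x := by
  have h1 := hG.smooth_fderiv hx
  have h2 := hG.smooth_sharp hx
  have h3 : ContDiffAt ℝ ∞ (fun y => (fderiv ℝ G y).flip) x :=
    (ContinuousLinearMap.flipₗᵢ ℝ E E (E →L[ℝ] ℝ)).contDiff.contDiffAt.comp x h1
  have h4 : ContDiffAt ℝ ∞ (christoffelLower G) x :=
    ((h1.add h3).sub (contDiffAt_const.clm_comp h3)).const_smul _
  have h5 : ContDiffAt ℝ ∞
      (fun y => ContinuousLinearMap.compL ℝ E (E →L[ℝ] ℝ) E (sharp G y)) x :=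
    (ContinuousLinearMap.contDiff _).contDiffAt.comp x h2
  exact h5.clm_comp h4

omit [FiniteDimensional ℝ E] in
lemma christoffelLower_symm (u v : E) : christoffelLower G x u v = christoffelLower G x v u := by
  ext w
  rw [christoffelLower_apply, christoffelLower_apply, hG.fderiv_symm hx w u v]
  ring

omit [FiniteDimensional ℝ E] in
lemma christoffel_symm (u v : E) : christoffel G x u v = christoffel G x v u := by
  simp [christoffel, hG.christoffelLower_symm hx u v]

lemma apply_christoffel (u v w : E) : G x (christoffel G x u v) w =
    1 / 2 * (fderiv ℝ G x u v w + fderiv ℝ G x v u w - fderiv ℝ G x w u v) := by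
  simp only [christoffel, ContinuousLinearMap.comp_apply, ContinuousLinearMap.compL_apply]
  rw [hG.apply_sharp hx, christoffelLower_apply]

/-- This is metric compatibility, `∇G = 0`; it is used to eliminate derivatives of the metric from
the computations below. -/
lemma fderiv_apply (u v w : E) :
    fderiv ℝ G x u v w = G x (christoffel G x u v) w + G x v (christoffel G x u w) := by
  rw [hG.symm x hx v, hG.apply_christoffel hx, hG.apply_christoffel hx,
    hG.fderiv_symm hx u w v]
  ring

omit [FiniteDimensional ℝ E] in
lemma hasFDerivAt_apply {Y Z : E → E} {Y' Z' : E →L[ℝ] E}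
    (hY : HasFDerivAt Y Y' x) (hZ : HasFDerivAt Z Z' x) (u : E) :
    fderiv ℝ (fun y => G y (Y y) (Z y)) x u =
      fderiv ℝ G x u (Y x) (Z x) + G x (Y' u) (Z x) + G x (Y x) (Z' u) := by
  have := ((hG.hasFDerivAt hx).clm_apply hY).clm_apply hZ
  rw [this.fderiv]
  simp
  ring

/-- The derivatives of the metric combine to the Christoffel term. The derivatives of the fields
cancel against the brackets, except for two halves of `∂_X Y`. -/
lemma koszul_eq {X Y Z : E → E} (hX : DifferentiableAt ℝ X x) (hY : DifferentiableAt ℝ Y x)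
    (hZ : DifferentiableAt ℝ Z x) :
    (1 / 2 : ℝ) * (fderiv ℝ (fun y => G y (Y y) (Z y)) x (X x)
      + fderiv ℝ (fun y => G y (X y) (Z y)) x (Y x)
      - fderiv ℝ (fun y => G y (X y) (Y y)) x (Z x)
      + G x (VectorField.lieBracket ℝ X Y x) (Z x)
      - G x (VectorField.lieBracket ℝ X Z x) (Y x)
      - G x (VectorField.lieBracket ℝ Y Z x) (X x)) = G x (flatNabla G x (X x) Y) (Z x) := by
  rw [hG.hasFDerivAt_apply hx hY.hasFDerivAt hZ.hasFDerivAt,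
    hG.hasFDerivAt_apply hx hX.hasFDerivAt hZ.hasFDerivAt,
    hG.hasFDerivAt_apply hx hX.hasFDerivAt hY.hasFDerivAt, flatNabla]
  simp only [VectorField.lieBracket, map_add, map_sub, add_apply,
    sub_apply]
  rw [hG.apply_christoffel hx, hG.symm x hx (Y x), hG.symm x hx (X x) (fderiv ℝ Z x (Y x)),
    hG.symm x hx (X x) (fderiv ℝ Y x (Z x))]
  ring

end IsFlatMetric
end Flat

/-! ### Curvature in coordinates and its change under a conformal factor -/

section FlatCurvature

variable {E : Type*} [NormedAddCommGroup E] [NormedSpace ℝ E]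
variable {G : E → E →L[ℝ] E →L[ℝ] ℝ} {O : Set E} {x : E}

lemma second_fderiv_symm {F : Type*} [NormedAddCommGroup F] [NormedSpace ℝ F] {f : E → F}
    (hf : ContDiffAt ℝ ∞ f x) (u v : E) :
    fderiv ℝ (fderiv ℝ f) x u v = fderiv ℝ (fderiv ℝ f) x v u :=
  (hf.isSymmSndFDerivAt (by simp only [minSmoothness_of_isRCLikeNormedField]; exact WithTop.coe_le_coe.2 le_top)).eq u v

lemma hasFDerivAt_fderiv {F : Type*} [NormedAddCommGroup F] [NormedSpace ℝ F] {f : E → F}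
    (hf : ContDiffAt ℝ ∞ f x) : HasFDerivAt (fderiv ℝ f) (fderiv ℝ (fderiv ℝ f) x) x :=
  ((hf.fderiv_right (m := ∞) (by simp)).differentiableAt (by simp)).hasFDerivAt

lemma ContDiffAt.hasFDerivAt_top {F : Type*} [NormedAddCommGroup F] [NormedSpace ℝ F] {f : E → F}
    (hf : ContDiffAt ℝ ∞ f x) : HasFDerivAt f (fderiv ℝ f x) x :=
  (hf.differentiableAt (by simp)).hasFDerivAt

/-- The conformal factor `e^{-2φ}` applied to a metric. -/
def flatConformal (φ : E → ℝ) (G : E → E →L[ℝ] E →L[ℝ] ℝ) (x : E) : E →L[ℝ] E →L[ℝ] ℝ :=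
  Real.exp (-2 * φ x) • G x

/-- The Hessian of a function. -/
def flatHess (G : E → E →L[ℝ] E →L[ℝ] ℝ) (φ : E → ℝ) (x u v : E) : ℝ :=
  fderiv ℝ (fderiv ℝ φ) x u v - fderiv ℝ φ x (christoffel G x u v)

/-- The difference tensor of the Levi-Civita connections of `e^{-2φ} G` and `G`. -/
def flatDiff (G : E → E →L[ℝ] E →L[ℝ] ℝ) (φ : E → ℝ) (x u v : E) : E :=
  G x u v • sharp G x (fderiv ℝ φ x) - fderiv ℝ φ x u • v - fderiv ℝ φ x v • u

/-- The change of the Schouten tensor under a conformal change. -/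
def flatSchoutenChange (G : E → E →L[ℝ] E →L[ℝ] ℝ) (φ : E → ℝ) (x u v : E) : ℝ :=
  flatHess G φ x u v + fderiv ℝ φ x u * fderiv ℝ φ x v
    - 1 / 2 * fderiv ℝ φ x (sharp G x (fderiv ℝ φ x)) * G x u v

namespace IsFlatMetric

variable (hG : IsFlatMetric G O) (hx : x ∈ O) [FiniteDimensional ℝ E]
include hG hx

lemma hasFDerivAt_christoffel :
    HasFDerivAt (christoffel G) (fderiv ℝ (christoffel G) x) x :=
  ((hG.smooth_christoffel hx).differentiableAt (by simp)).hasFDerivAt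

lemma hasFDerivAt_christoffel_apply (v w : E) :
    HasFDerivAt (fun y => christoffel G y v w)
      (((fderiv ℝ (christoffel G) x).flip v).flip w) x := by
  have := ((hG.hasFDerivAt_christoffel hx).clm_apply (hasFDerivAt_const v x)).clm_apply
    (hasFDerivAt_const w x)
  convert this using 1
  ext u
  simp

lemma fderiv_christoffel_symm (u v w : E) :
    fderiv ℝ (christoffel G) x u v w = fderiv ℝ (christoffel G) x u w v := by
  have h := (hG.hasFDerivAt_christoffel_apply hx v w).congr_of_eventuallyEq
    (Filter.eventuallyEq_of_mem (hG.mem_nhds hx) fun y hy => hG.christoffel_symm hy w v)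
  simpa using congrArg (fun L => L u) (h.unique (hG.hasFDerivAt_christoffel_apply hx w v))

lemma smooth_flatNabla {Y Z : E → E} (hY : ContDiffAt ℝ ∞ Y x) (hZ : ContDiffAt ℝ ∞ Z x) :
    ContDiffAt ℝ ∞ (fun y => flatNabla G y (Y y) Z) x := by
  have h1 : ContDiffAt ℝ ∞ (fderiv ℝ Z) x := hZ.fderiv_right (by simp)
  exact (h1.clm_apply hY).add (((hG.smooth_christoffel hx).clm_apply hY).clm_apply hZ)

lemma fderiv_flatNabla {Y Z : E → E} (hY : ContDiffAt ℝ ∞ Y x) (hZ : ContDiffAt ℝ ∞ Z x) (u : E) :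
    fderiv ℝ (fun y => flatNabla G y (Y y) Z) x u =
      fderiv ℝ (fderiv ℝ Z) x u (Y x) + fderiv ℝ Z x (fderiv ℝ Y x u)
      + fderiv ℝ (christoffel G) x u (Y x) (Z x) + christoffel G x (fderiv ℝ Y x u) (Z x)
      + christoffel G x (Y x) (fderiv ℝ Z x u) := by
  have h1 := ((hasFDerivAt_fderiv hZ).clm_apply (ContDiffAt.hasFDerivAt_top hY)).add
    (((hG.hasFDerivAt_christoffel hx).clm_apply (ContDiffAt.hasFDerivAt_top hY)).clm_apply
      (ContDiffAt.hasFDerivAt_top hZ))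
  have h2 : HasFDerivAt (fun y => flatNabla G y (Y y) Z) _ x := h1
  rw [h2.fderiv]
  simp
  abel

/-- The second derivatives of `Z` cancel by symmetry and the first derivatives of `X` and `Y` are
those of the bracket, so what remains depends only on the values of the three fields at `x`. -/
lemma commutator_eq_flatCurv {X Y Z : E → E} (hX : ContDiffAt ℝ ∞ X x) (hY : ContDiffAt ℝ ∞ Y x)
    (hZ : ContDiffAt ℝ ∞ Z x) :
    flatNabla G x (X x) (fun y => flatNabla G y (Y y) Z)
      - flatNabla G x (Y x) (fun y => flatNabla G y (X y) Z)
      - flatNabla G x (VectorField.lieBracket ℝ X Y x) Z = flatCurv G x (X x) (Y x) (Z x) := by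
  rw [flatNabla.eq_1 G x (X x) (fun y => flatNabla G y (Y y) Z),
    flatNabla.eq_1 G x (Y x) (fun y => flatNabla G y (X y) Z), hG.fderiv_flatNabla hx hY hZ, hG.fderiv_flatNabla hx hX hZ,
    second_fderiv_symm hZ (X x) (Y x)]
  simp only [flatNabla, flatCurv, VectorField.lieBracket, map_sub, map_add, sub_apply]
  abel

omit hG hx [FiniteDimensional ℝ E] in
lemma flatCurv_swap (u v w : E) : flatCurv G x u v w = - flatCurv G x v u w := by
  simp only [flatCurv]; abel

lemma flatCurv_bianchi (u v w : E) :
    flatCurv G x u v w + flatCurv G x v w u + flatCurv G x w u v = 0 := by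
  simp only [flatCurv]
  rw [hG.fderiv_christoffel_symm hx u v w, hG.fderiv_christoffel_symm hx v w u,
    hG.fderiv_christoffel_symm hx w u v, hG.christoffel_symm hx v w,
    hG.christoffel_symm hx u w, hG.christoffel_symm hx u v]
  abel

/-- The function `G(w,w)` has a symmetric second derivative. Its first derivative along `v` is `2
G(Γ(v,w),w)`; antisymmetrizing one more derivative in `u, v` cancels the products `G(Γ(v,w),Γ(u,w))`
and leaves the curvature. -/
lemma flatCurv_self (u v w : E) : G x (flatCurv G x u v w) w = 0 := by
  have key : ∀ v, fderiv ℝ (fun y => fderiv ℝ (fun z => G z w w) y v) x =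
      fderiv ℝ (fun y => 2 * G y (christoffel G y v w) w) x := by
    intro v
    refine Filter.EventuallyEq.fderiv_eq (Filter.eventuallyEq_of_mem (hG.mem_nhds hx) ?_)
    intro y hy
    have := hG.hasFDerivAt_apply hy (hasFDerivAt_const w y) (hasFDerivAt_const w y) v
    dsimp only
    rw [this, hG.fderiv_apply hy, hG.symm y hy w]
    simp
    ring
  have hs : ContDiffAt ℝ ∞ (fun z => G z w w) x :=
    ((hG.smooth x hx).clm_apply contDiffAt_const).clm_apply contDiffAt_const
  have h2 : ∀ u v, fderiv ℝ (fun y => fderiv ℝ (fun z => G z w w) y v) x u =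
      fderiv ℝ (fderiv ℝ (fun z => G z w w)) x u v := by
    intro u v
    rw [((hasFDerivAt_fderiv hs).clm_apply (hasFDerivAt_const v x)).fderiv]
    simp
  have h3 : ∀ u v, fderiv ℝ (fun y => 2 * G y (christoffel G y v w) w) x u =
      2 * (G x (christoffel G x u (christoffel G x v w)) w
        + G x (christoffel G x v w) (christoffel G x u w)
        + G x (fderiv ℝ (christoffel G) x u v w) w) := by
    intro u v
    have h4 := hG.hasFDerivAt_apply hx (hG.hasFDerivAt_christoffel_apply hx v w)
      (hasFDerivAt_const w x) u
    have h5 : DifferentiableAt ℝ (fun y => G y (christoffel G y v w) w) x :=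
      (((hG.hasFDerivAt hx).clm_apply (hG.hasFDerivAt_christoffel_apply hx v w)).clm_apply
        (hasFDerivAt_const w x)).differentiableAt
    rw [fderiv_const_mul h5, smul_apply, h4, hG.fderiv_apply hx]
    simp
  have h6 := second_fderiv_symm hs u v
  rw [← h2, ← h2, key, key, h3, h3, hG.symm x hx (christoffel G x u w)] at h6
  simp only [flatCurv, map_add, map_sub, add_apply, sub_apply]
  linarith

variable {φ : E → ℝ}

omit [FiniteDimensional ℝ E] hx in
lemma flatConformal (hφ : ∀ x ∈ O, ContDiffAt ℝ ∞ φ x) : IsFlatMetric (flatConformal φ G) O where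
  isOpen := hG.isOpen
  symm x hx u v := by simp [ConformalRicci.flatConformal, hG.symm x hx u v]
  pos x hx v hv := by
    simpa [ConformalRicci.flatConformal] using mul_pos (Real.exp_pos _) (hG.pos x hx v hv)
  smooth x hx := ((contDiffAt_const.mul (hφ x hx)).exp).smul (hG.smooth x hx)

/-- Since the derivative of `e^{-2φ} G` is `e^{-2φ}(dG - 2 dφ ⊗ G)`, the three terms of the
Christoffel formula produce the three terms of `flatDiff`. -/
lemma christoffel_flatConformal (hφ : ∀ x ∈ O, ContDiffAt ℝ ∞ φ x) (u v : E) :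
    christoffel (ConformalRicci.flatConformal φ G) x u v
      = christoffel G x u v + flatDiff G φ x u v := by
  have hG' := hG.flatConformal hφ
  have hd : ∀ u, fderiv ℝ (ConformalRicci.flatConformal φ G) x u =
      Real.exp (-2 * φ x) • (fderiv ℝ G x u - (2 * fderiv ℝ φ x u) • G x) := by
    intro u
    have h1 := (((ContDiffAt.hasFDerivAt_top (hφ x hx)).const_mul (-2)).exp).smul
      (hG.hasFDerivAt hx)
    have h2 : HasFDerivAt (ConformalRicci.flatConformal φ G) _ x := h1
    rw [h2.fderiv]
    ext a b
    simp
    ring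
  refine hG'.ext_inner hx fun t => ?_
  rw [hG'.apply_christoffel hx, hd, hd, hd]
  simp only [ConformalRicci.flatConformal, flatDiff, map_add, map_sub, add_apply, sub_apply,
    smul_apply, smul_eq_mul, map_smul, hG.apply_sharp hx, hG.apply_christoffel hx]
  ring

/-- Differentiating `G(sharp dφ, t) = dφ(t)` yields the derivative of the gradient without a formula
for the derivative of the inverse of `G`. -/
lemma fderiv_sharp_fderiv (hφ : ContDiffAt ℝ ∞ φ x) (u t : E) :
    G x (fderiv ℝ (fun y => sharp G y (fderiv ℝ φ y)) x u) t =
      flatHess G φ x u t - G x (christoffel G x u (sharp G x (fderiv ℝ φ x))) t := by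
  have hF : HasFDerivAt (fun y => sharp G y (fderiv ℝ φ y)) _ x :=
    ContDiffAt.hasFDerivAt_top ((hG.smooth_sharp hx).clm_apply (hφ.fderiv_right (by simp)))
  have h1 := hG.hasFDerivAt_apply hx hF (hasFDerivAt_const t x) u
  have h2 : fderiv ℝ (fun y => G y (sharp G y (fderiv ℝ φ y)) t) x =
      fderiv ℝ (fun y => fderiv ℝ φ y t) x :=
    Filter.EventuallyEq.fderiv_eq (Filter.eventuallyEq_of_mem (hG.mem_nhds hx)
      fun y hy => by rw [hG.apply_sharp hy])
  rw [h2, ((hasFDerivAt_fderiv hφ).clm_apply (hasFDerivAt_const t x)).fderiv,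
    hG.fderiv_apply hx] at h1
  simp [hG.apply_sharp hx] at h1
  rw [flatHess, h1]
  ring

lemma apply_sharp' (α : E →L[ℝ] ℝ) (v : E) : G x v (sharp G x α) = α v := by
  rw [hG.symm x hx, hG.apply_sharp hx]

lemma hasFDerivAt_flatDiff (hφ : ContDiffAt ℝ ∞ φ x) (u v w t : E) :
    G x (fderiv ℝ (fun y => flatDiff G φ y v w) x u) t =
      (G x (christoffel G x u v) w + G x v (christoffel G x u w)) * fderiv ℝ φ x t
      + G x v w * (flatHess G φ x u t - G x (christoffel G x u (sharp G x (fderiv ℝ φ x))) t)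
      - fderiv ℝ (fderiv ℝ φ) x u v * G x w t - fderiv ℝ (fderiv ℝ φ) x u w * G x v t := by
  have hF : HasFDerivAt (fun y => sharp G y (fderiv ℝ φ y)) _ x :=
    ContDiffAt.hasFDerivAt_top ((hG.smooth_sharp hx).clm_apply (hφ.fderiv_right (by simp)))
  have h1 := (((((hG.hasFDerivAt hx).clm_apply (hasFDerivAt_const v x)).clm_apply
    (hasFDerivAt_const w x)).smul hF).sub
    (((hasFDerivAt_fderiv hφ).clm_apply (hasFDerivAt_const v x)).smul_const w)).sub
    (((hasFDerivAt_fderiv hφ).clm_apply (hasFDerivAt_const w x)).smul_const v)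
  have h2 : HasFDerivAt (fun y => flatDiff G φ y v w) _ x := h1
  rw [h2.fderiv, ← hG.fderiv_sharp_fderiv hx hφ]
  simp [hG.apply_sharp hx, hG.fderiv_apply hx]
  ring

/-- With `Γ + flatDiff` inserted in the curvature formula, the derivative of `flatDiff` contributes
the Hessian of `φ`, and the terms quadratic in `flatDiff` contribute the terms quadratic in `dφ`. -/
lemma flatCurv_flatConformal (hφ : ∀ x ∈ O, ContDiffAt ℝ ∞ φ x) (u v w t : E) :
    G x (flatCurv (ConformalRicci.flatConformal φ G) x u v w) t =
      G x (flatCurv G x u v w) t +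
      (G x u t * flatSchoutenChange G φ x v w + G x v w * flatSchoutenChange G φ x u t
        - G x u w * flatSchoutenChange G φ x v t - G x v t * flatSchoutenChange G φ x u w) := by
  have hG' := hG.flatConformal hφ
  have hdA : ∀ v w, DifferentiableAt ℝ (fun y => flatDiff G φ y v w) x := by
    intro v w
    have h0 := (hφ x hx).fderiv_right (m := ∞) (by simp)
    have h1 : ContDiffAt ℝ ∞ (fun y => flatDiff G φ y v w) x :=
      (((((hG.smooth x hx).clm_apply contDiffAt_const).clm_apply contDiffAt_const).smul
      ((hG.smooth_sharp hx).clm_apply h0)).sub ((h0.clm_apply contDiffAt_const).smul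
      contDiffAt_const)).sub ((h0.clm_apply contDiffAt_const).smul contDiffAt_const)
    exact h1.differentiableAt (by simp)
  have hd : ∀ u v w, fderiv ℝ (christoffel (ConformalRicci.flatConformal φ G)) x u v w =
      fderiv ℝ (christoffel G) x u v w + fderiv ℝ (fun y => flatDiff G φ y v w) x u := by
    intro u v w
    have h1 := hG'.hasFDerivAt_christoffel_apply hx v w
    have h2 := ((hG.hasFDerivAt_christoffel_apply hx v w).add (hdA v w).hasFDerivAt)
    have h3 := h2.congr_of_eventuallyEq (Filter.eventuallyEq_of_mem (hG.mem_nhds hx)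
      fun y hy => hG.christoffel_flatConformal hy hφ v w)
    simpa using congrArg (fun L => L u) (h1.unique h3)
  simp only [flatCurv, hd, hG.christoffel_flatConformal hx hφ, map_add, map_sub, add_apply,
    sub_apply, hG.hasFDerivAt_flatDiff hx (hφ x hx)]
  simp only [flatDiff, flatSchoutenChange, flatHess, map_add, map_sub, add_apply,
    sub_apply, map_smul, smul_apply, smul_eq_mul, hG.apply_sharp hx]
  rw [second_fderiv_symm (hφ x hx) v u, hG.christoffel_symm hx v u]
  simp only [hG.symm x hx v u, hG.apply_sharp' hx]
  ring

end IsFlatMetric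
end FlatCurvature

/-! ### Transfer of functions, vector fields and brackets through the inverse chart -/

section Chart

variable {n : ℕ} {M : Type*} [TopologicalSpace M] [ChartedSpace (EuclideanSpace ℝ (Fin n)) M]
  [IsManifold (𝓡 n) ∞ M]

/-- The inverse of the preferred chart at `p₀`. -/
def chartInv (p₀ : M) : EuclideanSpace ℝ (Fin n) → M := (extChartAt (𝓡 n) p₀).symm

/-- The domain of `chartInv`. -/
def chartDom (p₀ : M) : Set (EuclideanSpace ℝ (Fin n)) := (extChartAt (𝓡 n) p₀).target

/-- The derivative of `chartInv`. -/
def chartD (p₀ : M) (x : EuclideanSpace ℝ (Fin n)) :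
    EuclideanSpace ℝ (Fin n) →L[ℝ] TangentSpace (𝓡 n) (chartInv p₀ x) :=
  mfderiv (𝓘(ℝ, EuclideanSpace ℝ (Fin n))) (𝓡 n) (chartInv p₀) x

/-- A vector field in coordinates. -/
def pullField (p₀ : M) (V : VField n M) (x : EuclideanSpace ℝ (Fin n)) :
    EuclideanSpace ℝ (Fin n) :=
  (chartD p₀ x).inverse (V (chartInv p₀ x))

/-- A field of bilinear forms in coordinates. -/
def pullMetric (p₀ : M) (g : BilinField n M) (x : EuclideanSpace ℝ (Fin n)) :
    EuclideanSpace ℝ (Fin n) →L[ℝ] EuclideanSpace ℝ (Fin n) →L[ℝ] ℝ :=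
  (ContinuousLinearMap.precomp ℝ (chartD p₀ x)) ∘L (g (chartInv p₀ x)) ∘L (chartD p₀ x)

/-- Smoothness of a vector field at a point. -/
def SmoothFieldAt (V : VField n M) (p : M) : Prop :=
  ContMDiffAt (𝓡 n) ((𝓡 n).prod 𝓘(ℝ, EuclideanSpace ℝ (Fin n))) ∞
    (fun p => (Bundle.TotalSpace.mk' (EuclideanSpace ℝ (Fin n)) p (V p) :
      TangentBundle (𝓡 n) M)) p

lemma pullMetric_apply (p₀ : M) (g : BilinField n M) (x u v : EuclideanSpace ℝ (Fin n)) :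
    pullMetric p₀ g x u v = g (chartInv p₀ x) (chartD p₀ x u) (chartD p₀ x v) := rfl

lemma isOpen_chartDom (p₀ : M) : IsOpen (chartDom p₀ : Set (EuclideanSpace ℝ (Fin n))) :=
  isOpen_extChartAt_target p₀

lemma continuousOn_chartInv (p₀ : M) :
    ContinuousOn (chartInv p₀ : EuclideanSpace ℝ (Fin n) → M) (chartDom p₀) :=
  continuousOn_extChartAt_symm p₀

variable {p₀ : M} {x : EuclideanSpace ℝ (Fin n)} (hx : x ∈ chartDom p₀)
include hx

lemma continuousAt_chartInv : ContinuousAt (chartInv p₀) x :=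
  (continuousOn_chartInv p₀).continuousAt ((isOpen_chartDom p₀).mem_nhds hx)

lemma contMDiffAt_chartInv : ContMDiffAt 𝓘(ℝ, EuclideanSpace ℝ (Fin n)) (𝓡 n) ∞ (chartInv p₀) x :=
  (contMDiffOn_extChartAt_symm p₀).contMDiffAt ((isOpen_chartDom p₀).mem_nhds hx)

lemma chartInv_mem_source : chartInv p₀ x ∈ (extChartAt (𝓡 n) p₀).source :=
  (extChartAt (𝓡 n) p₀).map_target hx

lemma chart_chartInv : extChartAt (𝓡 n) p₀ (chartInv p₀ x) = x :=
  (extChartAt (𝓡 n) p₀).right_inv hx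

lemma contMDiffAt_chart :
    ContMDiffAt (𝓡 n) 𝓘(ℝ, EuclideanSpace ℝ (Fin n)) ∞ (extChartAt (𝓡 n) p₀) (chartInv p₀ x) := by
  have := chartInv_mem_source hx
  rw [extChartAt_source] at this
  exact contMDiffAt_extChartAt' this

lemma isInvertible_chartD : (chartD p₀ x).IsInvertible := by
  have := isInvertible_mfderivWithin_extChartAt_symm (I := 𝓡 n) (x := p₀) hx
  rw [ModelWithCorners.range_eq_univ, mfderivWithin_univ] at this
  exact this

lemma chartD_pullField (V : VField n M) : chartD p₀ x (pullField p₀ V x) = V (chartInv p₀ x) :=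
  congrArg (fun L => L (V (chartInv p₀ x))) (isInvertible_chartD hx).self_comp_inverse

lemma chartD_inverse (u : EuclideanSpace ℝ (Fin n)) :
    (chartD p₀ x).inverse (chartD p₀ x u) = u :=
  congrArg (fun L => L u) (isInvertible_chartD hx).inverse_comp_self

lemma chartD_inverse' (v : TangentSpace (𝓡 n) (chartInv p₀ x)) :
    chartD p₀ x ((chartD p₀ x).inverse v) = v :=
  congrArg (fun L => L v) (isInvertible_chartD hx).self_comp_inverse

lemma chartD_injective {u v : EuclideanSpace ℝ (Fin n)} (h : chartD p₀ x u = chartD p₀ x v) :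
    u = v := by
  rw [← chartD_inverse hx u, h, chartD_inverse hx]

lemma chartD_surjective (v : TangentSpace (𝓡 n) (chartInv p₀ x)) : ∃ u, chartD p₀ x u = v :=
  ⟨_, chartD_inverse' hx v⟩

lemma chartInv_chart_eventually :
    ∀ᶠ q in 𝓝 (chartInv p₀ x), chartInv p₀ (extChartAt (𝓡 n) p₀ q) = q ∧
      extChartAt (𝓡 n) p₀ q ∈ chartDom p₀ := by
  filter_upwards [extChartAt_source_mem_nhds' (I := 𝓡 n) (chartInv_mem_source hx)] with q hq
  exact ⟨(extChartAt (𝓡 n) p₀).left_inv hq, (extChartAt (𝓡 n) p₀).map_source hq⟩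

lemma eventually_chart_iff {P : M → Prop} :
    (∀ᶠ q in 𝓝 (chartInv p₀ x), P q) ↔ ∀ᶠ y in 𝓝 x, P (chartInv p₀ y) := by
  constructor
  · exact fun h => (continuousAt_chartInv hx).eventually h
  · intro h
    have hc : Filter.Tendsto (extChartAt (𝓡 n) p₀) (𝓝 (chartInv p₀ x)) (𝓝 x) := by
      have := (contMDiffAt_chart hx).continuousAt
      rw [ContinuousAt, chart_chartInv hx] at this
      exact this
    filter_upwards [hc.eventually h, chartInv_chart_eventually hx] with q h1 h2
    rwa [h2.1] at h1

lemma contMDiffAt_iff_contDiffAt {h : M → ℝ} :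
    ContMDiffAt (𝓡 n) 𝓘(ℝ, ℝ) ∞ h (chartInv p₀ x) ↔
      ContDiffAt ℝ ∞ (fun y => h (chartInv p₀ y)) x := by
  constructor
  · intro hh
    exact (ContMDiffAt.comp x hh (contMDiffAt_chartInv hx)).contDiffAt
  · intro hh
    have h1 : ContMDiffAt (𝓡 n) 𝓘(ℝ, ℝ) ∞
        ((fun y => h (chartInv p₀ y)) ∘ extChartAt (𝓡 n) p₀) (chartInv p₀ x) := by
      refine ContMDiffAt.comp _ ?_ (contMDiffAt_chart hx)
      rw [chart_chartInv hx]
      exact hh.contMDiffAt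
    refine h1.congr_of_eventuallyEq ?_
    filter_upwards [chartInv_chart_eventually hx] with q hq
    exact congrArg h hq.1.symm

lemma mvfderiv_chartD {h : M → ℝ} (hh : ContMDiffAt (𝓡 n) 𝓘(ℝ, ℝ) ∞ h (chartInv p₀ x))
    (u : EuclideanSpace ℝ (Fin n)) :
    mvfderiv (𝓡 n) h (chartInv p₀ x) (chartD p₀ x u) =
      fderiv ℝ (fun y => h (chartInv p₀ y)) x u := by
  have h1 := mvfderiv_comp_apply (I := 𝓘(ℝ, EuclideanSpace ℝ (Fin n))) x
    (hh.mdifferentiableAt (by simp))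
    ((contMDiffAt_chartInv hx).mdifferentiableAt (by simp)) u
  rw [chartD]
  refine h1.symm.trans ?_
  rw [mvfderiv, mfderiv_eq_fderiv]
  rfl

/-- One direction pulls the field back along the inverse chart. The other pulls the coordinate
expression back along the chart; as the two derivatives are mutually inverse, this recovers the
field near the point. -/
lemma smoothFieldAt_iff {V : VField n M} :
    SmoothFieldAt V (chartInv p₀ x) ↔ ContDiffAt ℝ ∞ (pullField p₀ V) x := by
  have : IsManifold (𝓡 n) (∞ + 1) M := by simpa
  constructor
  · intro hV
    have := ContMDiffAt.mpullback_vectorField_preimage (m := ∞) (n := ∞)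
      (I := 𝓘(ℝ, EuclideanSpace ℝ (Fin n))) hV
      (contMDiffAt_chartInv hx) (isInvertible_chartD hx) (by simp)
    exact contMDiffAt_vectorSpace_iff_contDiffAt.1 this
  · intro hV
    have hinv : (mfderiv (𝓡 n) 𝓘(ℝ, EuclideanSpace ℝ (Fin n)) (extChartAt (𝓡 n) p₀)
      (chartInv p₀ x)).IsInvertible := isInvertible_mfderiv_extChartAt (chartInv_mem_source hx)
    have h1 := contMDiffAt_vectorSpace_iff_contDiffAt.2 hV
    rw [← chart_chartInv hx] at h1
    have h2 := ContMDiffAt.mpullback_vectorField_preimage (m := ∞) (n := ∞)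
      (I' := 𝓘(ℝ, EuclideanSpace ℝ (Fin n))) h1 (contMDiffAt_chart hx) hinv (by simp)
    refine ContMDiffAt.congr_of_eventuallyEq h2 ?_
    filter_upwards [extChartAt_source_mem_nhds' (I := 𝓡 n) (chartInv_mem_source hx)] with q hq
    obtain ⟨y, hy, rfl⟩ : ∃ y ∈ chartDom p₀, chartInv p₀ y = q :=
      ⟨_, (extChartAt (𝓡 n) p₀).map_source hq, (extChartAt (𝓡 n) p₀).left_inv hq⟩
    have h3 : (mfderiv (𝓡 n) 𝓘(ℝ, EuclideanSpace ℝ (Fin n)) (extChartAt (𝓡 n) p₀)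
        (chartInv p₀ y)).inverse (pullField p₀ V y) = V (chartInv p₀ y) := by
      have h4 := mfderiv_extChartAt_comp_mfderivWithin_extChartAt_symm (I := 𝓡 n) (x := p₀) hy
      rw [ModelWithCorners.range_eq_univ, mfderivWithin_univ] at h4
      have h5 := congrArg (fun L => L (pullField p₀ V y)) h4
      have h6 : (mfderiv (𝓡 n) 𝓘(ℝ, EuclideanSpace ℝ (Fin n)) (extChartAt (𝓡 n) p₀)
        (chartInv p₀ y)) (chartD p₀ y (pullField p₀ V y)) = pullField p₀ V y := h5
      rw [chartD_pullField hy] at h6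
      rw [← h6]
      exact congrArg (fun L => L (V (chartInv p₀ y)))
        (isInvertible_mfderiv_extChartAt (I := 𝓡 n) (x := p₀) hq).inverse_comp_self
    have h7 : pullField p₀ V (extChartAt (𝓡 n) p₀ (chartInv p₀ y)) = pullField p₀ V y := by
      rw [chart_chartInv hy]
    rw [← h7] at h3
    exact congrArg (Bundle.TotalSpace.mk' (EuclideanSpace ℝ (Fin n)) (chartInv p₀ y)) h3.symm

omit hx in
lemma smoothFieldAt_extendVec (p : M) (v : TangentSpace (𝓡 n) p) :
    SmoothFieldAt (extendVec v) p :=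
  FiberBundle.contMDiffAt_extend (𝓡 n) _ v

lemma pullField_mlieBracket {V W : VField n M} (hV : SmoothFieldAt V (chartInv p₀ x))
    (hW : SmoothFieldAt W (chartInv p₀ x)) :
    pullField p₀ (VectorField.mlieBracket (𝓡 n) V W) x =
      VectorField.lieBracket ℝ (pullField p₀ V) (pullField p₀ W) x := by
  have h2 : minSmoothness ℝ 2 ≤ (∞ : WithTop ℕ∞) := by
    rw [minSmoothness_of_isRCLikeNormedField]
    exact WithTop.coe_le_coe.2 le_top
  have : IsManifold (𝓡 n) (minSmoothness ℝ 2) M := .of_le h2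
  have := VectorField.mpullback_mlieBracket (I := 𝓘(ℝ, EuclideanSpace ℝ (Fin n)))
    (hV.mdifferentiableAt (by simp)) (hW.mdifferentiableAt (by simp))
    (contMDiffAt_chartInv hx) h2
  rw [← VectorField.mlieBracketWithin_univ (I := 𝓡 n) (V := VectorField.mpullback _ _ _ V),
    VectorField.mlieBracketWithin_eq_lieBracketWithin] at this
  exact this.trans (congrFun (VectorField.lieBracketWithin_univ (V := pullField p₀ V)
    (W := pullField p₀ W)) x)

end Chart

/-! ### Orthonormal frames -/

section Frames

variable {n : ℕ} {V : Type*} [AddCommGroup V] [Module ℝ V]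

/-- An orthonormal basis `e` of a vector space with symmetric bilinear form `b`. -/
structure IsFrame (b : V → V → ℝ) (e : Fin n → V) : Prop where
  symm : ∀ v w, b v w = b w v
  orth : ∀ i j, b (e i) (e j) = if i = j then 1 else 0
  expand : ∀ v, ∑ i, b (e i) v • e i = v

lemma IsFrame.of_orth {b : V → V → ℝ} (B : V →ₗ[ℝ] V →ₗ[ℝ] ℝ) (hB : ∀ v w, b v w = B v w)
    (hn : Module.finrank ℝ V = n) [FiniteDimensional ℝ V]
    (hs : ∀ v w, b v w = b w v) {e : Fin n → V}
    (he : ∀ i j, b (e i) (e j) = if i = j then 1 else 0) : IsFrame b e where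
  symm := hs
  orth := he
  expand v := by
    have hli : LinearIndependent ℝ e := by
      rw [Fintype.linearIndependent_iff]
      intro c hc i
      have := congrArg (fun v => B v (e i)) hc
      simpa [← hB, he] using this
    have hspan : Submodule.span ℝ (Set.range e) = ⊤ :=
      hli.span_eq_top_of_card_eq_finrank' (by simp [hn])
    have hv : v ∈ Submodule.span ℝ (Set.range e) := hspan ▸ Submodule.mem_top
    obtain ⟨c, rfl⟩ := (Submodule.mem_span_range_iff_exists_fun ℝ).1 hv
    refine Finset.sum_congr rfl fun i _ => ?_
    have : b (e i) (∑ j, c j • e j) = c i := by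
      simp only [hB] at he ⊢
      simp [he]
    rw [this]

lemma exists_orthonormal (B : V →ₗ[ℝ] V →ₗ[ℝ] ℝ) (hn : Module.finrank ℝ V = n)
    [FiniteDimensional ℝ V]
    (hs : ∀ v w, B v w = B w v) (hpos : ∀ v, v ≠ 0 → 0 < B v v) :
    ∃ e : Fin n → V, ∀ i j, B (e i) (e j) = if i = j then 1 else 0 := by
  subst hn
  obtain ⟨v, hv⟩ := LinearMap.BilinForm.exists_orthogonal_basis (B := B) ⟨fun x y => hs x y⟩
  refine ⟨fun i => (Real.sqrt (B (v i) (v i)))⁻¹ • v i, fun i j => ?_⟩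
  have hp := hpos (v i) (v.ne_zero i)
  split_ifs with h
  · subst h
    simp only [map_smul, LinearMap.smul_apply, smul_eq_mul]
    rw [← mul_assoc, ← mul_inv, Real.mul_self_sqrt hp.le, inv_mul_cancel₀ hp.ne']
  · have : B (v i) (v j) = 0 := hv h
    simp [this]

end Frames

/-! ### Connection and curvature on the manifold in terms of coordinates -/

section Bridge

variable {n : ℕ} {M : Type*} [TopologicalSpace M] [ChartedSpace (EuclideanSpace ℝ (Fin n)) M]
  [IsManifold (𝓡 n) ∞ M]

/-- `g` is a smooth Riemannian metric on the open set `U`. -/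
structure IsMetricOn (g : BilinField n M) (U : Set M) : Prop where
  isOpen : IsOpen U
  symm : ∀ p ∈ U, ∀ v w, g p v w = g p w v
  pos : ∀ p ∈ U, ∀ v, v ≠ 0 → 0 < g p v v
  smooth : ∀ p₀ x, x ∈ chartDom p₀ → chartInv p₀ x ∈ U → ContDiffAt ℝ ∞ (pullMetric p₀ g) x

instance (p : M) : FiniteDimensional ℝ (TangentSpace (𝓡 n) p) :=
  inferInstanceAs (FiniteDimensional ℝ (EuclideanSpace ℝ (Fin n)))

lemma finrank_tangentSpace (p : M) : Module.finrank ℝ (TangentSpace (𝓡 n) p) = n :=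
  (finrank_euclideanSpace_fin : Module.finrank ℝ (EuclideanSpace ℝ (Fin n)) = n)

/-- The metric at a point as an algebraic bilinear form. -/
def bilinAt (g : BilinField n M) (p : M) :
    TangentSpace (𝓡 n) p →ₗ[ℝ] TangentSpace (𝓡 n) p →ₗ[ℝ] ℝ :=
  LinearMap.mk₂ ℝ (fun v w => g p v w) (by simp) (by simp) (by simp) (by simp)

lemma IsFrame.of_orth_metric {g : BilinField n M} {U : Set M} (hg : IsMetricOn g U) {p : M}
    (hp : p ∈ U) {e : Fin n → TangentSpace (𝓡 n) p}
    (he : ∀ i j, g p (e i) (e j) = if i = j then 1 else 0) : IsFrame (fun v w => g p v w) e :=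
  IsFrame.of_orth (bilinAt g p) (fun _ _ => rfl) (finrank_tangentSpace p) (hg.symm p hp) he

lemma flatNabla_congr {E : Type*} [NormedAddCommGroup E] [NormedSpace ℝ E]
    {G : E → E →L[ℝ] E →L[ℝ] ℝ} {x : E} {Y Z : E → E} (h : Y =ᶠ[𝓝 x] Z) (u : E) :
    flatNabla G x u Y = flatNabla G x u Z := by
  rw [flatNabla, flatNabla, h.fderiv_eq, h.eq_of_nhds]

lemma eventually_smooth_extendVec (p : M) (v : TangentSpace (𝓡 n) p) :
    ∀ᶠ q in 𝓝 p, SmoothFieldAt (extendVec v) q := by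
  obtain ⟨s, hs, h⟩ := FiberBundle.exists_contMDiffOn_extend (k := ∞) (𝓡 n)
    (EuclideanSpace ℝ (Fin n)) v
  filter_upwards [eventually_mem_nhds_iff.2 hs] with q hq
  exact h.contMDiffAt hq

namespace IsMetricOn

variable {g : BilinField n M} {U : Set M} (hg : IsMetricOn g U)
include hg

/-- The arbitrary choice behind `frame` is meaningful because positivity of `g` provides an
orthonormal basis. -/
lemma isFrame {p : M} (hp : p ∈ U) : IsFrame (fun v w => g p v w) (frame g p) :=
  .of_orth_metric hg hp <| Classical.epsilon_spec
    (exists_orthonormal (bilinAt g p) (finrank_tangentSpace p) (hg.symm p hp) (hg.pos p hp))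

variable {p₀ : M} {x : EuclideanSpace ℝ (Fin n)}

lemma isFlatMetric (p₀ : M) :
    IsFlatMetric (pullMetric p₀ g) (chartDom p₀ ∩ chartInv p₀ ⁻¹' U) where
  isOpen := (continuousOn_chartInv p₀).isOpen_inter_preimage (isOpen_chartDom p₀) hg.isOpen
  symm _ hx _ _ := hg.symm _ hx.2 _ _
  pos _ hx _ hv := hg.pos _ hx.2 _ fun h => hv (chartD_injective hx.1 (h.trans (map_zero _).symm))
  smooth x hx := hg.smooth p₀ x hx.1 hx.2

variable (hx : x ∈ chartDom p₀ ∩ chartInv p₀ ⁻¹' U)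
include hx

omit hg in
lemma pullMetric_pullField (Y Z : VField n M) :
    pullMetric p₀ g x (pullField p₀ Y x) (pullField p₀ Z x) =
      g (chartInv p₀ x) (Y (chartInv p₀ x)) (Z (chartInv p₀ x)) := by
  rw [pullMetric_apply, chartD_pullField hx.1, chartD_pullField hx.1]

lemma apply_eventuallyEq (Y Z : VField n M) :
    (fun y => g (chartInv p₀ y) (Y (chartInv p₀ y)) (Z (chartInv p₀ y))) =ᶠ[𝓝 x]
      fun y => pullMetric p₀ g y (pullField p₀ Y y) (pullField p₀ Z y) :=
  Filter.eventuallyEq_of_mem ((hg.isFlatMetric p₀).mem_nhds hx) fun _ hy =>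
    (pullMetric_pullField hy Y Z).symm

lemma mvfderiv_apply {Y Z : VField n M} (hY : SmoothFieldAt Y (chartInv p₀ x))
    (hZ : SmoothFieldAt Z (chartInv p₀ x)) (u : EuclideanSpace ℝ (Fin n)) :
    mvfderiv (𝓡 n) (fun q => g q (Y q) (Z q)) (chartInv p₀ x) (chartD p₀ x u) =
      fderiv ℝ (fun y => pullMetric p₀ g y (pullField p₀ Y y) (pullField p₀ Z y)) x u := by
  have h1 := hg.apply_eventuallyEq hx Y Z
  have h2 : ContDiffAt ℝ ∞
      (fun y => pullMetric p₀ g y (pullField p₀ Y y) (pullField p₀ Z y)) x :=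
    ((hg.smooth p₀ x hx.1 hx.2).clm_apply ((smoothFieldAt_iff hx.1).1 hY)).clm_apply
      ((smoothFieldAt_iff hx.1).1 hZ)
  rw [mvfderiv_chartD hx.1 ((contMDiffAt_iff_contDiffAt hx.1).2 (h2.congr_of_eventuallyEq h1)),
    h1.fderiv_eq]

lemma koszul_eq {X Y Z : VField n M} (hX : SmoothFieldAt X (chartInv p₀ x))
    (hY : SmoothFieldAt Y (chartInv p₀ x)) (hZ : SmoothFieldAt Z (chartInv p₀ x)) :
    koszul g X Y Z (chartInv p₀ x) = g (chartInv p₀ x)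
      (chartD p₀ x (flatNabla (pullMetric p₀ g) x (pullField p₀ X x) (pullField p₀ Y)))
      (Z (chartInv p₀ x)) := by
  have hd : ∀ {V : VField n M}, SmoothFieldAt V (chartInv p₀ x) →
      DifferentiableAt ℝ (pullField p₀ V) x := fun h =>
    ((smoothFieldAt_iff hx.1).1 h).differentiableAt (by simp)
  rw [← chartD_pullField hx.1 Z, ← pullMetric_apply, ← (hg.isFlatMetric p₀).koszul_eq hx (hd hX)
    (hd hY) (hd hZ), koszul, ← hg.mvfderiv_apply hx hY hZ, ← hg.mvfderiv_apply hx hX hZ,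
    ← hg.mvfderiv_apply hx hX hY, chartD_pullField hx.1, chartD_pullField hx.1,
    chartD_pullField hx.1, ← pullField_mlieBracket hx.1 hX hY, ← pullField_mlieBracket hx.1 hX hZ,
    ← pullField_mlieBracket hx.1 hY hZ, pullMetric_pullField hx, pullMetric_pullField hx,
    pullMetric_pullField hx]

/-- The Koszul expressions are the coefficients of the coordinate derivative in the frame. In
particular, the auxiliary extensions of tangent vectors used by `nabla` do not influence the result.
-/
lemma nabla_eq {Y : VField n M} (hY : SmoothFieldAt Y (chartInv p₀ x))
    (u : EuclideanSpace ℝ (Fin n)) :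
    nabla g (chartInv p₀ x) (chartD p₀ x u) Y =
      chartD p₀ x (flatNabla (pullMetric p₀ g) x u (pullField p₀ Y)) := by
  have hF := hg.isFrame hx.2
  rw [nabla, ← hF.expand (chartD p₀ x (flatNabla (pullMetric p₀ g) x u (pullField p₀ Y)))]
  refine Finset.sum_congr rfl fun i _ => ?_
  rw [hg.koszul_eq hx (smoothFieldAt_extendVec _ _) hY (smoothFieldAt_extendVec _ _)]
  simp only [extendVec, FiberBundle.extend_apply_self]
  have : pullField p₀ (FiberBundle.extend (EuclideanSpace ℝ (Fin n)) (chartD p₀ x u)) x = u := by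
    rw [pullField, FiberBundle.extend_apply_self, chartD_inverse hx.1]
  rw [this, hg.symm _ hx.2]

lemma eventually_mem : ∀ᶠ y in 𝓝 x, y ∈ chartDom p₀ ∩ chartInv p₀ ⁻¹' U :=
  (hg.isFlatMetric p₀).mem_nhds hx

omit hg hx in
lemma eventually_pull (hx : x ∈ chartDom p₀) {P : M → Prop}
    (h : ∀ᶠ q in 𝓝 (chartInv p₀ x), P q) : ∀ᶠ y in 𝓝 x, P (chartInv p₀ y) :=
  (continuousAt_chartInv hx).eventually h

/-- Equality in a neighbourhood of `x`, and not only at `x`, is what the second covariant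
derivatives in the curvature require. -/
lemma pullField_nabla {Y Z : VField n M}
    (hZ : ∀ᶠ q in 𝓝 (chartInv p₀ x), SmoothFieldAt Z q) :
    pullField p₀ (fun q => nabla g q (Y q) Z) =ᶠ[𝓝 x]
      fun y => flatNabla (pullMetric p₀ g) y (pullField p₀ Y y) (pullField p₀ Z) := by
  filter_upwards [eventually_pull hx.1 hZ, hg.eventually_mem hx] with y h1 h2
  refine chartD_injective h2.1 ?_
  rw [chartD_pullField h2.1, ← hg.nabla_eq h2 h1, chartD_pullField h2.1]

lemma smooth_nabla {Y Z : VField n M} (hY : SmoothFieldAt Y (chartInv p₀ x))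
    (hZ : ∀ᶠ q in 𝓝 (chartInv p₀ x), SmoothFieldAt Z q) :
    SmoothFieldAt (fun q => nabla g q (Y q) Z) (chartInv p₀ x) :=
  (smoothFieldAt_iff hx.1).2 (((hg.isFlatMetric p₀).smooth_flatNabla hx
    ((smoothFieldAt_iff hx.1).1 hY)
    ((smoothFieldAt_iff hx.1).1 hZ.self_of_nhds)).congr_of_eventuallyEq
    (hg.pullField_nabla hx hZ))

lemma curvEndo_eq (u v w : EuclideanSpace ℝ (Fin n)) :
    curvEndo g (chartInv p₀ x) (chartD p₀ x u) (chartD p₀ x v) (chartD p₀ x w) =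
      chartD p₀ x (flatCurv (pullMetric p₀ g) x u v w) := by
  have he : ∀ u, pullField p₀ (extendVec (chartD p₀ x u)) x = u := fun u => by
    rw [pullField, extendVec, FiberBundle.extend_apply_self, chartD_inverse hx.1]
  have hs : ∀ u, SmoothFieldAt (extendVec (chartD p₀ x u)) (chartInv p₀ x) := fun u =>
    smoothFieldAt_extendVec _ (chartD p₀ x u)
  have hse : ∀ u, ∀ᶠ q in 𝓝 (chartInv p₀ x), SmoothFieldAt (extendVec (chartD p₀ x u)) q :=
    fun u => eventually_smooth_extendVec _ (chartD p₀ x u)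
  have hc := fun u => (smoothFieldAt_iff hx.1).1 (hs u)
  have h := (hg.isFlatMetric p₀).commutator_eq_flatCurv hx (hc u) (hc v) (hc w)
  rw [he, he, he] at h
  have hn : ∀ a b c, flatNabla (pullMetric p₀ g) x a (fun y => flatNabla (pullMetric p₀ g) y
      (pullField p₀ (extendVec (chartD p₀ x b)) y) (pullField p₀ (extendVec (chartD p₀ x c)))) =
      flatNabla (pullMetric p₀ g) x a
        (pullField p₀ fun q => nabla g q (extendVec (chartD p₀ x b) q)
          (extendVec (chartD p₀ x c))) := by
    intro a b c
    have h1 := hg.pullField_nabla hx (Y := extendVec (chartD p₀ x b)) (hse c)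
    exact (flatNabla_congr h1 a).symm
  rw [curvEndo, hg.nabla_eq hx (hg.smooth_nabla hx (hs v) (hse w)),
    hg.nabla_eq hx (hg.smooth_nabla hx (hs u) (hse w)), ← h, hn, hn, map_sub, map_sub,
    ← pullField_mlieBracket hx.1 (hs u) (hs v), ← hg.nabla_eq hx (hs w), chartD_pullField hx.1]

end IsMetricOn
end Bridge

/-! ### Multilinear algebra of curvature tensors and traces -/

section Algebra

variable {n : ℕ} {V : Type*} [AddCommGroup V] [Module ℝ V]

/-- Bilinearity of a function of two variables. -/
structure IsBilin (B : V → V → ℝ) : Prop where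
  add_left : ∀ x y z, B (x + y) z = B x z + B y z
  smul_left : ∀ (a : ℝ) x z, B (a • x) z = a * B x z
  add_right : ∀ x y z, B x (y + z) = B x y + B x z
  smul_right : ∀ (a : ℝ) x z, B x (a • z) = a * B x z

lemma IsBilin.exists_linear {B : V → V → ℝ} (hB : IsBilin B) :
    ∃ L : V →ₗ[ℝ] V →ₗ[ℝ] ℝ, B = fun x y => L x y :=
  ⟨LinearMap.mk₂ ℝ B hB.add_left hB.smul_left hB.add_right hB.smul_right, rfl⟩

/-- Multilinearity of a function of four variables. -/
def IsMultilin (W : V → V → V → V → ℝ) : Prop :=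
  ∃ L : V →ₗ[ℝ] V →ₗ[ℝ] V →ₗ[ℝ] V →ₗ[ℝ] ℝ, W = fun x y z t => L x y z t

lemma IsMultilin.of_bilin {W : V → V → V → V → ℝ} (h1 : ∀ z t, IsBilin fun x y => W x y z t)
    (h2 : ∀ x y, IsBilin fun z t => W x y z t) : IsMultilin W :=
  ⟨LinearMap.mk₂ ℝ (fun x y => LinearMap.mk₂ ℝ (fun z t => W x y z t) (h2 x y).add_left
      (h2 x y).smul_left (h2 x y).add_right (h2 x y).smul_right)
    (fun x y z => by ext a b; exact (h1 a b).add_left x y z)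
    (fun x y z => by ext a b; exact (h1 a b).smul_left x y z)
    (fun x y z => by ext a b; exact (h1 a b).add_right x y z)
    (fun x y z => by ext a b; exact (h1 a b).smul_right x y z), rfl⟩

lemma IsMultilin.comp {V' : Type*} [AddCommGroup V'] [Module ℝ V'] {W : V → V → V → V → ℝ}
    (hW : IsMultilin W) (f : V' →ₗ[ℝ] V) :
    IsMultilin fun x y z t => W (f x) (f y) (f z) (f t) := by
  obtain ⟨L, rfl⟩ := hW
  refine .of_bilin (fun z t => ?_) (fun x y => ?_) <;> constructor <;> simp

/-- The Kulkarni-Nomizu product. -/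
def kulkarniNomizu (b P : V → V → ℝ) (x y z t : V) : ℝ :=
  b x t * P y z + b y z * P x t - b x z * P y t - b y t * P x z

lemma IsMultilin.kulkarniNomizu {b P : V → V → ℝ} (hb : IsBilin b) (hP : IsBilin P) :
    IsMultilin (kulkarniNomizu b P) := by
  obtain ⟨b, rfl⟩ := hb.exists_linear
  obtain ⟨P, rfl⟩ := hP.exists_linear
  refine .of_bilin (fun z t => ?_) (fun x y => ?_) <;> constructor <;> intros <;>
    simp [ConformalRicci.kulkarniNomizu] <;> ring

lemma IsMultilin.sub {W W' : V → V → V → V → ℝ} (hW : IsMultilin W) (hW' : IsMultilin W') :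
    IsMultilin fun x y z t => W x y z t - W' x y z t := by
  obtain ⟨L, rfl⟩ := hW
  obtain ⟨L', rfl⟩ := hW'
  exact ⟨L - L', rfl⟩

namespace IsFrame

variable {b : V → V → ℝ} {e : Fin n → V} (he : IsFrame b e)
include he

lemma linear_expand (L : V →ₗ[ℝ] ℝ) (v : V) : ∑ i, b (e i) v * L (e i) = L v := by
  conv_rhs => rw [← he.expand v]
  simp

lemma linear_expand' {L : V → ℝ} (ha : ∀ x y, L (x + y) = L x + L y)
    (hs : ∀ (a : ℝ) x, L (a • x) = a * L x) (v : V) : ∑ i, b (e i) v * L (e i) = L v :=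
  he.linear_expand ⟨⟨L, ha⟩, hs⟩ v

/-- Each `e' i` is expanded in `e`, and the coefficients are then read as those of `e j` in `e'`,
which is where `c` enters. The case `c = 1` says that a trace does not depend on the frame. -/
lemma contraction {b' : V → V → ℝ} {e' : Fin n → V} (he' : IsFrame b' e') {c : ℝ} (hc : c ≠ 0)
    (hb : ∀ v w, b' v w = c * b v w) {B : V → V → ℝ} (hB : IsBilin B) :
    ∑ i, B (e' i) (e' i) = c⁻¹ * ∑ i, B (e i) (e i) := by
  obtain ⟨L, rfl⟩ := hB.exists_linear
  have h1 : ∀ i, L (e' i) (e' i) = ∑ j, b (e j) (e' i) * L (e j) (e' i) := fun i =>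
    (he.linear_expand (L.flip (e' i)) (e' i)).symm
  simp only [h1]
  rw [Finset.sum_comm, Finset.mul_sum]
  refine Finset.sum_congr rfl fun j _ => ?_
  rw [← he'.linear_expand (L (e j)) (e j), Finset.mul_sum]
  refine Finset.sum_congr rfl fun i _ => ?_
  rw [hb, he.symm (e' i)]
  field_simp

lemma trace_self : ∑ i, b (e i) (e i) = n := by
  simp [he.orth]

variable (hb : IsBilin b)
include hb

lemma trace_kulkarniNomizu {P : V → V → ℝ} (hP : IsBilin P) (y z : V) :
    ∑ i, kulkarniNomizu b P (e i) y z (e i) = (n - 2) * P y z + (∑ i, P (e i) (e i)) * b y z := by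
  simp only [kulkarniNomizu, Finset.sum_sub_distrib, Finset.sum_add_distrib, ← Finset.sum_mul,
    ← Finset.mul_sum, he.trace_self]
  rw [he.linear_expand' (L := fun x => P y x) (fun _ _ => hP.add_right _ _ _)
    (fun _ _ => hP.smul_right _ _ _)]
  have : ∑ i, b y (e i) * P (e i) z = P y z := by
    simp only [he.symm y]
    exact he.linear_expand' (L := fun x => P x z) (fun _ _ => hP.add_left _ _ _)
      (fun _ _ => hP.smul_left _ _ _) y
  rw [this]
  ring

end IsFrame

/-- The algebraic symmetries of a curvature tensor. -/
structure IsCurvLike (W : V → V → V → V → ℝ) : Prop where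
  multilin : IsMultilin W
  swap_left : ∀ x y z t, W x y z t = - W y x z t
  swap_right : ∀ x y z t, W x y z t = - W x y t z
  bianchi : ∀ x y z t, W x y z t + W y z x t + W z x y t = 0

/-- The classical octahedron argument: the four Bianchi identities for the cyclic permutations of
`x, y, z, t`, combined with the two antisymmetries. -/
lemma IsCurvLike.pair_symm {W : V → V → V → V → ℝ} (hW : IsCurvLike W) (x y z t : V) :
    W x y z t = W z t x y := by
  have h1 := hW.bianchi x y z t
  have h2 := hW.bianchi y z t x
  have h3 := hW.bianchi z t x y
  have h4 := hW.bianchi t x y z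
  have s1 := hW.swap_left
  have s2 := hW.swap_right
  linarith [s1 x y z t, s2 x y z t, s1 y z x t, s2 y z x t, s1 z x y t, s2 z x y t,
    s1 y z t x, s2 y z t x, s1 z t y x, s2 z t y x, s1 t y z x, s2 t y z x,
    s1 z t x y, s2 z t x y, s1 t x z y, s2 t x z y, s1 x z t y, s2 x z t y,
    s1 t x y z, s2 t x y z, s1 x y t z, s2 x y t z, s1 y t x z, s2 y t x z, s1 z x t y,
    s1 y t z x, s1 x t y z, s1 x t z y, s1 z y t x]

lemma IsCurvLike.sub_kulkarniNomizu {R : V → V → V → V → ℝ} (hR : IsCurvLike R)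
    {b P : V → V → ℝ} (hb : IsBilin b) (hP : IsBilin P) (hbs : ∀ x y, b x y = b y x)
    (hPs : ∀ x y, P x y = P y x) :
    IsCurvLike fun x y z t => R x y z t - kulkarniNomizu b P x y z t where
  multilin := hR.multilin.sub (.kulkarniNomizu hb hP)
  swap_left x y z t := by
    rw [hR.swap_left]; simp only [kulkarniNomizu]; ring
  swap_right x y z t := by
    rw [hR.swap_right]; simp only [kulkarniNomizu]; ring
  bianchi x y z t := by
    have := hR.bianchi x y z t
    simp only [kulkarniNomizu]
    rw [hPs z x, hbs z x, hPs y x, hPs z y, hbs y x, hbs z y]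
    linarith

end Algebra

/-! ### Symmetries and traces of the Riemann, Ricci, Schouten and Weyl tensors -/

section PointwiseTensors

variable {n : ℕ} {M : Type*} [TopologicalSpace M] [ChartedSpace (EuclideanSpace ℝ (Fin n)) M]
  [IsManifold (𝓡 n) ∞ M]

lemma exists_chart (p : M) : ∃ (p₀ : M) (x : EuclideanSpace ℝ (Fin n)), x ∈ chartDom p₀ ∧
    chartInv p₀ x = p :=
  ⟨p, extChartAt (𝓡 n) p p, mem_extChartAt_target p, extChartAt_to_inv p⟩

lemma isBilin_metric (g : BilinField n M) (p : M) : IsBilin fun v w => g p v w := by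
  constructor <;> simp

lemma isMultilin_flatRiem {E : Type*} [NormedAddCommGroup E] [NormedSpace ℝ E]
    (G : E → E →L[ℝ] E →L[ℝ] ℝ) (x : E) :
    IsMultilin fun u v w t => G x (flatCurv G x u v w) t := by
  refine .of_bilin (fun z t => ?_) (fun x y => ?_) <;> constructor <;> intros <;>
    simp [flatCurv] <;> ring

namespace IsMetricOn

variable {g : BilinField n M} {U : Set M} (hg : IsMetricOn g U)
include hg

lemma riem_eq {p₀ : M} {x : EuclideanSpace ℝ (Fin n)} (hx : x ∈ chartDom p₀ ∩ chartInv p₀ ⁻¹' U)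
    (u v w t : EuclideanSpace ℝ (Fin n)) :
    riem g (chartInv p₀ x) (chartD p₀ x u) (chartD p₀ x v) (chartD p₀ x w) (chartD p₀ x t) =
      pullMetric p₀ g x (flatCurv (pullMetric p₀ g) x u v w) t := by
  rw [riem, hg.curvEndo_eq hx, pullMetric_apply]

variable {p : M} (hp : p ∈ U)
include hp

lemma isCurvLike_riem : IsCurvLike (riem g p) := by
  obtain ⟨p₀, x, hx, rfl⟩ := exists_chart (n := n) p
  have hx' : x ∈ chartDom p₀ ∩ chartInv p₀ ⁻¹' U := ⟨hx, hp⟩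
  have hG := hg.isFlatMetric p₀
  have key : riem g (chartInv p₀ x) = fun a b c d => pullMetric p₀ g x
      (flatCurv (pullMetric p₀ g) x ((chartD p₀ x).inverse a) ((chartD p₀ x).inverse b)
        ((chartD p₀ x).inverse c)) ((chartD p₀ x).inverse d) := by
    ext a b c d
    rw [← hg.riem_eq hx']
    simp only [chartD_inverse' hx]
  rw [key]
  have hself : ∀ u v w, pullMetric p₀ g x (flatCurv (pullMetric p₀ g) x u v w) w = 0 :=
    fun u v w => hG.flatCurv_self hx' u v w
  refine ⟨(isMultilin_flatRiem (pullMetric p₀ g) x).comp (chartD p₀ x).inverse.toLinearMap,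
    fun a b c d => ?_, fun a b c d => ?_, fun a b c d => ?_⟩
  · rw [IsFlatMetric.flatCurv_swap]; simp
  -- Polarization: the vanishing of `R(a,b,w,w)` is applied to `w = c + d`.
  · have h1 := hself ((chartD p₀ x).inverse a) ((chartD p₀ x).inverse b)
      ((chartD p₀ x).inverse c + (chartD p₀ x).inverse d)
    have h2 : ∀ u v w w', flatCurv (pullMetric p₀ g) x u v (w + w') =
        flatCurv (pullMetric p₀ g) x u v w + flatCurv (pullMetric p₀ g) x u v w' := by
      intros; simp only [flatCurv, map_add]; abel
    rw [h2] at h1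
    simp only [map_add, add_apply, hself] at h1
    linarith
  · rw [← add_apply, ← map_add, ← add_apply, ← map_add, hG.flatCurv_bianchi hx']
    simp

lemma isBilin_ric : IsBilin (ric g p) := by
  obtain ⟨L, hL⟩ := (hg.isCurvLike_riem hp).multilin
  constructor <;> intros <;> simp [ric, hL, Finset.sum_add_distrib, Finset.mul_sum]

lemma ric_symm (y z : TangentSpace (𝓡 n) p) : ric g p y z = ric g p z y := by
  have h := hg.isCurvLike_riem hp
  simp only [ric]
  refine Finset.sum_congr rfl fun i _ => ?_
  rw [h.pair_symm, h.swap_left, h.swap_right, neg_neg]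

lemma isBilin_schouten : IsBilin (schouten g p) := by
  have h := hg.isBilin_ric hp
  constructor <;> intros <;>
    simp [schouten, h.add_left, h.add_right, h.smul_left, h.smul_right] <;> ring

lemma schouten_symm (y z : TangentSpace (𝓡 n) p) : schouten g p y z = schouten g p z y := by
  rw [schouten, schouten, hg.ric_symm hp, hg.symm p hp]

omit hg hp in
lemma weyl_eq_sub : weyl g p = fun x y z t =>
    riem g p x y z t - kulkarniNomizu (fun v w => g p v w) (schouten g p) x y z t := rfl

lemma isCurvLike_weyl : IsCurvLike (weyl g p) := by
  rw [weyl_eq_sub]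
  exact (hg.isCurvLike_riem hp).sub_kulkarniNomizu (isBilin_metric g p) (hg.isBilin_schouten hp)
    (hg.symm p hp) (hg.schouten_symm hp)

lemma trace_schouten (hn : 4 ≤ n) : ∑ i, schouten g p (frame g p i) (frame g p i) =
    1 / (2 * ((n : ℝ) - 1)) * scal g p := by
  have hn' : (4 : ℝ) ≤ n := by exact_mod_cast hn
  have h1 : (n : ℝ) - 2 ≠ 0 := by linarith
  have h2 : (n : ℝ) - 1 ≠ 0 := by linarith
  simp only [schouten, ← Finset.mul_sum, Finset.sum_sub_distrib]
  rw [(hg.isFrame hp).trace_self, ← scal]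
  field_simp
  ring

/-- The coefficients of the Schouten tensor `𝔨` are such that `Ric = (n-2) 𝔨 + (tr 𝔨) g`, which is
the trace of its Kulkarni-Nomizu product with `g`. An arbitrary frame is allowed because dimension
four uses one that starts with a null vector of `W`. -/
lemma trace_weyl (hn : 4 ≤ n) {e : Fin n → TangentSpace (𝓡 n) p}
    (he : IsFrame (fun v w => g p v w) e) (y z : TangentSpace (𝓡 n) p) :
    ∑ i, weyl g p (e i) y z (e i) = 0 := by
  have hn' : (4 : ℝ) ≤ n := by exact_mod_cast hn
  have h1 : (n : ℝ) - 2 ≠ 0 := by linarith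
  have h2 : (n : ℝ) - 1 ≠ 0 := by linarith
  obtain ⟨L, hL⟩ := (hg.isCurvLike_weyl hp).multilin
  have hB : IsBilin fun a b => weyl g p a y z b := by
    rw [hL]; constructor <;> simp
  have h0 := (hg.isFrame hp).contraction he one_ne_zero (fun v w => (one_mul _).symm) hB
  rw [h0, weyl_eq_sub]
  simp only [Finset.sum_sub_distrib]
  rw [(hg.isFrame hp).trace_kulkarniNomizu (isBilin_metric g p) (hg.isBilin_schouten hp),
    hg.trace_schouten hp hn, ← ric, schouten]
  field_simp
  ring

end IsMetricOn

/-! ### Conformal change of the pointwise curvature tensors -/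

section Conformal

variable {g : BilinField n M} {U : Set M} (hg : IsMetricOn g U) {φ : M → ℝ}
  (hφ : ContMDiffOn (𝓡 n) 𝓘(ℝ, ℝ) ∞ φ U)

lemma pullMetric_conformalChange (p₀ : M) (φ : M → ℝ) (g : BilinField n M) :
    pullMetric p₀ (conformalChange φ g) =
      flatConformal (fun y => φ (chartInv p₀ y)) (pullMetric p₀ g) := by
  ext x u v
  rfl

include hg hφ

lemma smooth_pull_function {p₀ : M} {x : EuclideanSpace ℝ (Fin n)}
    (hx : x ∈ chartDom p₀ ∩ chartInv p₀ ⁻¹' U) :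
    ContDiffAt ℝ ∞ (fun y => φ (chartInv p₀ y)) x :=
  (contMDiffAt_iff_contDiffAt hx.1).1 (hφ.contMDiffAt (hg.isOpen.mem_nhds hx.2))

lemma IsMetricOn.conformal : IsMetricOn (conformalChange φ g) U where
  isOpen := hg.isOpen
  symm p hp v w := by simp [conformalChange, hg.symm p hp v w]
  pos p hp v hv := by
    simpa [conformalChange] using mul_pos (Real.exp_pos _) (hg.pos p hp v hv)
  smooth p₀ x hx hxU := by
    rw [pullMetric_conformalChange]
    exact ((hg.isFlatMetric p₀).flatConformal fun y hy =>
      smooth_pull_function hg hφ hy).smooth x ⟨hx, hxU⟩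

variable {p₀ : M} {x : EuclideanSpace ℝ (Fin n)} (hx : x ∈ chartDom p₀ ∩ chartInv p₀ ⁻¹' U)
include hx

/-- The change of the Schouten tensor under a conformal change, on the manifold. -/
def schoutenChange (g : BilinField n M) (φ : M → ℝ) (p₀ : M) (x : EuclideanSpace ℝ (Fin n))
    (v w : TangentSpace (𝓡 n) (chartInv p₀ x)) : ℝ :=
  flatSchoutenChange (pullMetric p₀ g) (fun y => φ (chartInv p₀ y)) x
    ((chartD p₀ x).inverse v) ((chartD p₀ x).inverse w)

omit hg hφ hx in
lemma isBilin_schoutenChange : IsBilin (schoutenChange g φ p₀ x) := by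
  constructor <;> intros <;> simp [schoutenChange, flatSchoutenChange, flatHess] <;> ring

lemma riem_conformal (a b c d : TangentSpace (𝓡 n) (chartInv p₀ x)) :
    riem (conformalChange φ g) (chartInv p₀ x) a b c d =
      Real.exp (-2 * φ (chartInv p₀ x)) * (riem g (chartInv p₀ x) a b c d +
        kulkarniNomizu (fun v w => g (chartInv p₀ x) v w) (schoutenChange g φ p₀ x) a b c d) := by
  obtain ⟨a, rfl⟩ := chartD_surjective hx.1 a
  obtain ⟨b, rfl⟩ := chartD_surjective hx.1 b
  obtain ⟨c, rfl⟩ := chartD_surjective hx.1 c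
  obtain ⟨d, rfl⟩ := chartD_surjective hx.1 d
  rw [(hg.conformal hφ).riem_eq hx, hg.riem_eq hx, pullMetric_conformalChange]
  have := (hg.isFlatMetric p₀).flatCurv_flatConformal hx
    (fun y hy => smooth_pull_function hg hφ hy) a b c d
  simp only [kulkarniNomizu, schoutenChange, chartD_inverse hx.1, ← pullMetric_apply]
  rw [← this]
  rfl

/-- The trace over a frame of the new metric brings a factor `e^{2φ}`, which cancels the conformal
factor of the `(0,4)` curvature tensor. -/
lemma ric_conformal (y z : TangentSpace (𝓡 n) (chartInv p₀ x)) :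
    ric (conformalChange φ g) (chartInv p₀ x) y z = ric g (chartInv p₀ x) y z +
      (((n : ℝ) - 2) * schoutenChange g φ p₀ x y z +
        (∑ i, schoutenChange g φ p₀ x (frame g _ i) (frame g _ i)) * g (chartInv p₀ x) y z) := by
  have hB := isBilin_schoutenChange (g := g) (φ := φ) (p₀ := p₀) (x := x)
  rw [← (hg.isFrame hx.2).trace_kulkarniNomizu (isBilin_metric g _) hB, ric, ric]
  simp only [riem_conformal hg hφ hx]
  have hml : IsBilin fun a d => riem g (chartInv p₀ x) a y z d +
      kulkarniNomizu (fun v w => g (chartInv p₀ x) v w) (schoutenChange g φ p₀ x) a y z d := by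
    obtain ⟨L, hL⟩ := (hg.isCurvLike_riem hx.2).multilin
    obtain ⟨L', hL'⟩ := IsMultilin.kulkarniNomizu (isBilin_metric g (chartInv p₀ x)) hB
    rw [hL, hL']
    constructor <;> intros <;> simp <;> ring
  rw [← Finset.mul_sum, (hg.isFrame hx.2).contraction ((hg.conformal hφ).isFrame hx.2)
    (Real.exp_pos _).ne' (fun _ _ => rfl) hml, Finset.sum_add_distrib]
  have := (Real.exp_pos (-2 * φ (chartInv p₀ x))).ne'
  field_simp

lemma scal_conformal :
    Real.exp (-2 * φ (chartInv p₀ x)) * scal (conformalChange φ g) (chartInv p₀ x) =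
      scal g (chartInv p₀ x) + 2 * ((n : ℝ) - 1) *
        ∑ i, schoutenChange g φ p₀ x (frame g _ i) (frame g _ i) := by
  have hB := isBilin_schoutenChange (g := g) (φ := φ) (p₀ := p₀) (x := x)
  rw [scal, (hg.isFrame hx.2).contraction ((hg.conformal hφ).isFrame hx.2)
    (Real.exp_pos _).ne' (fun _ _ => rfl) ((hg.conformal hφ).isBilin_ric hx.2),
    mul_inv_cancel_left₀ (Real.exp_pos _).ne']
  simp only [ric_conformal hg hφ hx, Finset.sum_add_distrib, ← Finset.mul_sum]
  rw [(hg.isFrame hx.2).trace_self, scal]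
  ring

/-- The multiple of `g` in the change of the Ricci tensor is absorbed by the change of the scalar
curvature term. -/
lemma schouten_conformal (hn : 4 ≤ n) (y z : TangentSpace (𝓡 n) (chartInv p₀ x)) :
    schouten (conformalChange φ g) (chartInv p₀ x) y z = schouten g (chartInv p₀ x) y z +
      schoutenChange g φ p₀ x y z := by
  have hn' : (4 : ℝ) ≤ n := by exact_mod_cast hn
  have h1 : (n : ℝ) - 2 ≠ 0 := by linarith
  have h2 : (n : ℝ) - 1 ≠ 0 := by linarith
  have h3 : conformalChange φ g (chartInv p₀ x) y z =
    Real.exp (-2 * φ (chartInv p₀ x)) * g (chartInv p₀ x) y z := rfl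
  have h4 : 1 / (2 * ((n : ℝ) - 1)) * scal (conformalChange φ g) (chartInv p₀ x) *
      conformalChange φ g (chartInv p₀ x) y z = 1 / (2 * ((n : ℝ) - 1)) *
      (Real.exp (-2 * φ (chartInv p₀ x)) * scal (conformalChange φ g) (chartInv p₀ x)) *
      g (chartInv p₀ x) y z := by rw [h3]; ring
  rw [schouten, schouten, h4, scal_conformal hg hφ hx, ric_conformal hg hφ hx]
  field_simp
  ring

/-- Curvature and Schouten tensor change by the same `schoutenChange`, so the two Kulkarni-Nomizu
products cancel and only the conformal factor is left. -/
lemma weyl_conformal_chart (hn : 4 ≤ n) (a b c d : TangentSpace (𝓡 n) (chartInv p₀ x)) :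
    weyl (conformalChange φ g) (chartInv p₀ x) a b c d =
      Real.exp (-2 * φ (chartInv p₀ x)) * weyl g (chartInv p₀ x) a b c d := by
  have h3 : ∀ y z, conformalChange φ g (chartInv p₀ x) y z =
    Real.exp (-2 * φ (chartInv p₀ x)) * g (chartInv p₀ x) y z := fun _ _ => rfl
  simp only [weyl, riem_conformal hg hφ hx, schouten_conformal hg hφ hx hn, h3, kulkarniNomizu]
  ring

omit hx in
lemma weyl_conformal (hn : 4 ≤ n) {p : M} (hp : p ∈ U) (a b c d : TangentSpace (𝓡 n) p) :
    weyl (conformalChange φ g) p a b c d = Real.exp (-2 * φ p) * weyl g p a b c d := by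
  obtain ⟨p₀, x, hx, rfl⟩ := exists_chart (n := n) p
  exact weyl_conformal_chart hg hφ ⟨hx, hp⟩ hn a b c d

end Conformal
end PointwiseTensors

end ConformalRicci

end

noncomputable section

set_option maxSynthPendingDepth 8
set_option linter.unusedSectionVars false

namespace ConformalRicci

/-! ### Tensors as continuous multilinear maps, and traces without frames -/

section Bundling

variable {n : ℕ}

/-- The `k`-th standard basis vector. -/
abbrev stdVec (k : Fin n) : EuclideanSpace ℝ (Fin n) := EuclideanSpace.single k 1

/-- The `k`-th coordinate. -/
abbrev stdCoord (k : Fin n) : EuclideanSpace ℝ (Fin n) →L[ℝ] ℝ := EuclideanSpace.proj k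

lemma sum_stdVec (u : EuclideanSpace ℝ (Fin n)) : ∑ k, u k • stdVec k = u := by
  have := (EuclideanSpace.basisFun (Fin n) ℝ).sum_repr u
  simpa using this

/-- The continuous multilinear map with the same coefficients as `r`. -/
def bundleTensor (r : EuclideanSpace ℝ (Fin n) → EuclideanSpace ℝ (Fin n) →
      EuclideanSpace ℝ (Fin n) → EuclideanSpace ℝ (Fin n) → ℝ) :
    EuclideanSpace ℝ (Fin n) →L[ℝ] EuclideanSpace ℝ (Fin n) →L[ℝ]
      EuclideanSpace ℝ (Fin n) →L[ℝ] EuclideanSpace ℝ (Fin n) →L[ℝ] ℝ :=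
  ∑ i, ∑ j, ∑ k, ∑ l, r (stdVec i) (stdVec j) (stdVec k) (stdVec l) •
    (stdCoord i).smulRight ((stdCoord j).smulRight ((stdCoord k).smulRight (stdCoord l)))

lemma bundleTensor_apply {r : EuclideanSpace ℝ (Fin n) → EuclideanSpace ℝ (Fin n) →
      EuclideanSpace ℝ (Fin n) → EuclideanSpace ℝ (Fin n) → ℝ} (hr : IsMultilin r)
    (u v w t : EuclideanSpace ℝ (Fin n)) : bundleTensor r u v w t = r u v w t := by
  obtain ⟨L, rfl⟩ := hr
  have h1 : ∀ (K : EuclideanSpace ℝ (Fin n) →ₗ[ℝ] ℝ) u, ∑ i, u i * K (stdVec i) = K u := by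
    intro K u
    conv_rhs => rw [← sum_stdVec u]
    simp
  simp only [bundleTensor, sum_apply, smul_apply, ContinuousLinearMap.smulRight_apply,
    smul_eq_mul, PiLp.proj_apply]
  refine Eq.trans ?_ (h1 (((L.flip v).flip w).flip t) u)
  refine Finset.sum_congr rfl fun i _ => ?_
  have h2 := h1 (((L (stdVec i)).flip w).flip t) v
  have h3 := fun j => h1 ((L (stdVec i) (stdVec j)).flip t) w
  have h4 := fun j k => h1 (L (stdVec i) (stdVec j) (stdVec k)) t
  simp only [LinearMap.flip_apply] at h2 h3 h4 ⊢
  simp only [← h2, ← h3, ← h4, Finset.mul_sum]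
  refine Finset.sum_congr rfl fun j _ => Finset.sum_congr rfl fun k _ =>
    Finset.sum_congr rfl fun l _ => ?_
  ring

lemma contDiffAt_bundleTensor {r : EuclideanSpace ℝ (Fin n) → EuclideanSpace ℝ (Fin n) →
      EuclideanSpace ℝ (Fin n) → EuclideanSpace ℝ (Fin n) → EuclideanSpace ℝ (Fin n) → ℝ}
    {x : EuclideanSpace ℝ (Fin n)}
    (hr : ∀ u v w t, ContDiffAt ℝ ∞ (fun y => r y u v w t) x) :
    ContDiffAt ℝ ∞ (fun y => bundleTensor (r y)) x :=
  .sum fun _ _ => .sum fun _ _ => .sum fun _ _ => .sum fun _ _ =>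
    (hr _ _ _ _).smul contDiffAt_const

/-- The chosen frames have no regularity in the base point, so a sum over them does not show that a
trace is smooth. The coordinate vectors paired with the duals of the coordinates give the same trace
and depend smoothly on the point. -/
lemma contraction_eq_sum {G : EuclideanSpace ℝ (Fin n) → EuclideanSpace ℝ (Fin n) →L[ℝ]
      EuclideanSpace ℝ (Fin n) →L[ℝ] ℝ} {O : Set (EuclideanSpace ℝ (Fin n))}
    (hG : IsFlatMetric G O) {x : EuclideanSpace ℝ (Fin n)} (hx : x ∈ O)
    {e : Fin n → EuclideanSpace ℝ (Fin n)} (he : IsFrame (fun v w => G x v w) e)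
    {B : EuclideanSpace ℝ (Fin n) → EuclideanSpace ℝ (Fin n) → ℝ} (hB : IsBilin B) :
    ∑ i, B (e i) (e i) = ∑ k, B (sharp G x (stdCoord k)) (stdVec k) := by
  obtain ⟨L, rfl⟩ := hB.exists_linear
  have h1 : ∀ k, L (sharp G x (stdCoord k)) (stdVec k) =
      ∑ i, (e i) k * L (e i) (stdVec k) := by
    intro k
    have := he.linear_expand (L.flip (stdVec k)) (sharp G x (stdCoord k))
    simpa [hG.apply_sharp' hx] using this.symm
  simp only [h1]
  rw [Finset.sum_comm]
  refine Finset.sum_congr rfl fun i _ => ?_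
  conv_lhs => rw [← sum_stdVec (e i), map_sum]
  simp [sum_stdVec]

end Bundling

/-! ### Smoothness of the Weyl tensor and its covariant derivative in coordinates -/

section WeylSmooth

variable {n : ℕ} {M : Type*} [TopologicalSpace M] [ChartedSpace (EuclideanSpace ℝ (Fin n)) M]
  [IsManifold (𝓡 n) ∞ M]

/-- The Weyl tensor in coordinates. -/
def pullWeyl (p₀ : M) (g : BilinField n M) (x : EuclideanSpace ℝ (Fin n)) :
    EuclideanSpace ℝ (Fin n) →L[ℝ] EuclideanSpace ℝ (Fin n) →L[ℝ]
      EuclideanSpace ℝ (Fin n) →L[ℝ] EuclideanSpace ℝ (Fin n) →L[ℝ] ℝ :=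
  bundleTensor fun u v w t => weyl g (chartInv p₀ x) (chartD p₀ x u) (chartD p₀ x v)
    (chartD p₀ x w) (chartD p₀ x t)

/-- The covariant derivative of the Weyl tensor in coordinates. -/
def pullNablaWeyl (p₀ : M) (g : BilinField n M) (x a u v w t : EuclideanSpace ℝ (Fin n)) : ℝ :=
  fderiv ℝ (pullWeyl p₀ g) x a u v w t
    - pullWeyl p₀ g x (christoffel (pullMetric p₀ g) x a u) v w t
    - pullWeyl p₀ g x u (christoffel (pullMetric p₀ g) x a v) w t
    - pullWeyl p₀ g x u v (christoffel (pullMetric p₀ g) x a w) t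
    - pullWeyl p₀ g x u v w (christoffel (pullMetric p₀ g) x a t)

namespace IsMetricOn

variable {g : BilinField n M} {U : Set M} (hg : IsMetricOn g U)
  {p₀ : M} {x : EuclideanSpace ℝ (Fin n)} (hx : x ∈ chartDom p₀ ∩ chartInv p₀ ⁻¹' U)
include hg hx

lemma isFrame_pull {e : Fin n → TangentSpace (𝓡 n) (chartInv p₀ x)}
    (he : IsFrame (fun v w => g (chartInv p₀ x) v w) e) :
    IsFrame (fun v w => pullMetric p₀ g x v w) fun i => (chartD p₀ x).inverse (e i) where
  symm := (hg.isFlatMetric p₀).symm x hx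
  orth i j := by
    rw [pullMetric_apply, chartD_inverse' hx.1, chartD_inverse' hx.1]
    exact he.orth i j
  expand v := by
    refine chartD_injective hx.1 ?_
    conv_rhs => rw [← he.expand (chartD p₀ x v)]
    simp [pullMetric_apply, chartD_inverse' hx.1]

lemma contraction_chart {e : Fin n → TangentSpace (𝓡 n) (chartInv p₀ x)}
    (he : IsFrame (fun v w => g (chartInv p₀ x) v w) e)
    {B : TangentSpace (𝓡 n) (chartInv p₀ x) → TangentSpace (𝓡 n) (chartInv p₀ x) → ℝ}
    (hB : IsBilin B) :
    ∑ i, B (e i) (e i) = ∑ k, B (chartD p₀ x (sharp (pullMetric p₀ g) x (stdCoord k)))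
      (chartD p₀ x (stdVec k)) := by
  have hB' : IsBilin fun u v => B (chartD p₀ x u) (chartD p₀ x v) := by
    constructor <;> intros <;> simp [hB.add_left, hB.add_right, hB.smul_left, hB.smul_right]
  rw [← contraction_eq_sum (hg.isFlatMetric p₀) hx (hg.isFrame_pull hx he) hB']
  simp only [chartD_inverse' hx.1]

lemma ric_chart (v w : EuclideanSpace ℝ (Fin n)) :
    ric g (chartInv p₀ x) (chartD p₀ x v) (chartD p₀ x w) =
      ∑ k, pullMetric p₀ g x (flatCurv (pullMetric p₀ g) x
        (sharp (pullMetric p₀ g) x (stdCoord k)) v w) (stdVec k) := by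
  obtain ⟨L, hL⟩ := (hg.isCurvLike_riem hx.2).multilin
  have hB : IsBilin fun a b => riem g (chartInv p₀ x) a (chartD p₀ x v) (chartD p₀ x w) b := by
    rw [hL]; constructor <;> simp
  rw [ric, hg.contraction_chart hx (hg.isFrame hx.2) hB]
  simp only [hg.riem_eq hx]

lemma scal_chart : scal g (chartInv p₀ x) =
      ∑ l, ∑ k, pullMetric p₀ g x (flatCurv (pullMetric p₀ g) x
        (sharp (pullMetric p₀ g) x (stdCoord k)) (sharp (pullMetric p₀ g) x (stdCoord l))
        (stdVec l)) (stdVec k) := by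
  rw [scal, hg.contraction_chart hx (hg.isFrame hx.2) (hg.isBilin_ric hx.2)]
  simp only [hg.ric_chart hx]

lemma smooth_sharp : ContDiffAt ℝ ∞ (sharp (pullMetric p₀ g)) x :=
  (hg.isFlatMetric p₀).smooth_sharp hx

omit hx in
lemma eventuallyEq_of_chart {F : Type*} {f h : EuclideanSpace ℝ (Fin n) → F}
    (hx : x ∈ chartDom p₀ ∩ chartInv p₀ ⁻¹' U)
    (H : ∀ y ∈ chartDom p₀ ∩ chartInv p₀ ⁻¹' U, f y = h y) : f =ᶠ[𝓝 x] h :=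
  Filter.eventuallyEq_of_mem ((hg.isFlatMetric p₀).mem_nhds hx) H

lemma smooth_flatRiem {X Y Z T : EuclideanSpace ℝ (Fin n) → EuclideanSpace ℝ (Fin n)}
    (hX : ContDiffAt ℝ ∞ X x) (hY : ContDiffAt ℝ ∞ Y x) (hZ : ContDiffAt ℝ ∞ Z x)
    (hT : ContDiffAt ℝ ∞ T x) :
    ContDiffAt ℝ ∞ (fun y => pullMetric p₀ g y
      (flatCurv (pullMetric p₀ g) y (X y) (Y y) (Z y)) (T y)) x := by
  have h0 := hg.smooth p₀ x hx.1 hx.2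
  have h1 := (hg.isFlatMetric p₀).smooth_christoffel hx
  have h2 : ContDiffAt ℝ ∞ (fderiv ℝ (christoffel (pullMetric p₀ g))) x :=
    h1.fderiv_right (by simp)
  have h3 : ContDiffAt ℝ ∞ (fun y => flatCurv (pullMetric p₀ g) y (X y) (Y y) (Z y)) x :=
    ((((h2.clm_apply hX).clm_apply hY).clm_apply hZ).sub
      (((h2.clm_apply hY).clm_apply hX).clm_apply hZ)).add
      ((h1.clm_apply hX).clm_apply ((h1.clm_apply hY).clm_apply hZ)) |>.sub
      ((h1.clm_apply hY).clm_apply ((h1.clm_apply hX).clm_apply hZ))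
  exact (h0.clm_apply h3).clm_apply hT

lemma smooth_weyl_const (u v w t : EuclideanSpace ℝ (Fin n)) :
    ContDiffAt ℝ ∞ (fun y => weyl g (chartInv p₀ y) (chartD p₀ y u) (chartD p₀ y v)
      (chartD p₀ y w) (chartD p₀ y t)) x := by
  have hc : ∀ a : EuclideanSpace ℝ (Fin n), ContDiffAt ℝ ∞ (fun _ => a) x :=
    fun a => contDiffAt_const
  have hsh : ∀ k, ContDiffAt ℝ ∞ (fun y => sharp (pullMetric p₀ g) y (stdCoord k)) x :=
    fun k => (hg.smooth_sharp hx).clm_apply contDiffAt_const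
  have hm : ∀ a b, ContDiffAt ℝ ∞ (fun y => pullMetric p₀ g y a b) x := fun a b =>
    ((hg.smooth p₀ x hx.1 hx.2).clm_apply (hc a)).clm_apply (hc b)
  have hric : ∀ a b, ContDiffAt ℝ ∞
      (fun y => ric g (chartInv p₀ y) (chartD p₀ y a) (chartD p₀ y b)) x := fun a b =>
    (ContDiffAt.sum fun k _ => hg.smooth_flatRiem hx (hsh k) (hc a) (hc b)
      (hc (stdVec k))).congr_of_eventuallyEq
      (hg.eventuallyEq_of_chart hx fun y hy => hg.ric_chart hy a b)
  have hscal : ContDiffAt ℝ ∞ (fun y => scal g (chartInv p₀ y)) x :=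
    (ContDiffAt.sum fun l _ => .sum fun k _ => hg.smooth_flatRiem hx (hsh k) (hsh l)
      (hc (stdVec l)) (hc (stdVec k))).congr_of_eventuallyEq
      (hg.eventuallyEq_of_chart hx fun y hy => hg.scal_chart hy)
  have hsch : ∀ a b, ContDiffAt ℝ ∞
      (fun y => schouten g (chartInv p₀ y) (chartD p₀ y a) (chartD p₀ y b)) x := fun a b =>
    contDiffAt_const.mul ((hric a b).sub ((contDiffAt_const.mul hscal).mul (hm a b)))
  have hriem : ContDiffAt ℝ ∞ (fun y => riem g (chartInv p₀ y) (chartD p₀ y u) (chartD p₀ y v)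
      (chartD p₀ y w) (chartD p₀ y t)) x :=
    (hg.smooth_flatRiem hx (hc u) (hc v) (hc w) (hc t)).congr_of_eventuallyEq
      (hg.eventuallyEq_of_chart hx fun y hy => hg.riem_eq hy u v w t)
  exact hriem.sub (((((hm u t).mul (hsch v w)).add ((hm v w).mul (hsch u t))).sub
    ((hm u w).mul (hsch v t))).sub ((hm v t).mul (hsch u w)))

lemma smooth_pullWeyl : ContDiffAt ℝ ∞ (pullWeyl p₀ g) x :=
  contDiffAt_bundleTensor (hg.smooth_weyl_const hx)

lemma pullWeyl_apply (u v w t : EuclideanSpace ℝ (Fin n)) :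
    pullWeyl p₀ g x u v w t = weyl g (chartInv p₀ x) (chartD p₀ x u) (chartD p₀ x v)
      (chartD p₀ x w) (chartD p₀ x t) :=
  bundleTensor_apply ((hg.isCurvLike_weyl hx.2).multilin.comp (chartD p₀ x).toLinearMap) u v w t

set_option maxHeartbeats 1000000 in
-- By the Leibniz rule, the derivatives of the four extended fields cancel against those in their
-- covariant derivatives, and only the Christoffel terms remain.
lemma nablaWeyl_eq (a u v w t : EuclideanSpace ℝ (Fin n)) :
    nablaWeyl g (chartInv p₀ x) (chartD p₀ x a) (chartD p₀ x u) (chartD p₀ x v)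
      (chartD p₀ x w) (chartD p₀ x t) = pullNablaWeyl p₀ g x a u v w t := by
  have hs : ∀ u, SmoothFieldAt (extendVec (chartD p₀ x u)) (chartInv p₀ x) := fun u =>
    smoothFieldAt_extendVec _ (chartD p₀ x u)
  have hc := fun u => (smoothFieldAt_iff hx.1).1 (hs u)
  have he : ∀ u, pullField p₀ (extendVec (chartD p₀ x u)) x = u := fun u => by
    rw [pullField, extendVec, FiberBundle.extend_apply_self, chartD_inverse hx.1]
  have hW := hg.smooth_pullWeyl hx
  set F := fun y => pullWeyl p₀ g y (pullField p₀ (extendVec (chartD p₀ x u)) y)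
      (pullField p₀ (extendVec (chartD p₀ x v)) y) (pullField p₀ (extendVec (chartD p₀ x w)) y)
      (pullField p₀ (extendVec (chartD p₀ x t)) y) with hF
  have h1 : (fun y => weyl g (chartInv p₀ y) (extendVec (chartD p₀ x u) (chartInv p₀ y))
      (extendVec (chartD p₀ x v) (chartInv p₀ y)) (extendVec (chartD p₀ x w) (chartInv p₀ y))
      (extendVec (chartD p₀ x t) (chartInv p₀ y))) =ᶠ[𝓝 x] F :=
    hg.eventuallyEq_of_chart hx fun y hy => by
      simp only [hF, hg.pullWeyl_apply hy, chartD_pullField hy.1]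
  have hFs : ContDiffAt ℝ ∞ F x :=
    (((hW.clm_apply (hc u)).clm_apply (hc v)).clm_apply (hc w)).clm_apply (hc t)
  have h2 : HasFDerivAt F _ x := ((((ContDiffAt.hasFDerivAt_top hW).clm_apply
    (ContDiffAt.hasFDerivAt_top (hc u))).clm_apply (ContDiffAt.hasFDerivAt_top (hc v))).clm_apply
    (ContDiffAt.hasFDerivAt_top (hc w))).clm_apply (ContDiffAt.hasFDerivAt_top (hc t))
  rw [nablaWeyl, mvfderiv_chartD hx.1
    ((contMDiffAt_iff_contDiffAt hx.1).2 (hFs.congr_of_eventuallyEq h1)), h1.fderiv_eq, h2.fderiv,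
    hg.nabla_eq hx (hs u), hg.nabla_eq hx (hs v), hg.nabla_eq hx (hs w), hg.nabla_eq hx (hs t)]
  simp only [← hg.pullWeyl_apply hx]
  simp only [pullNablaWeyl, flatNabla, he, map_add, add_apply,
    ContinuousLinearMap.flip_apply, ContinuousLinearMap.comp_apply]
  ring

lemma smooth_pullNablaWeyl {A X Y Z T : EuclideanSpace ℝ (Fin n) → EuclideanSpace ℝ (Fin n)}
    (hA : ContDiffAt ℝ ∞ A x) (hX : ContDiffAt ℝ ∞ X x) (hY : ContDiffAt ℝ ∞ Y x)
    (hZ : ContDiffAt ℝ ∞ Z x) (hT : ContDiffAt ℝ ∞ T x) :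
    ContDiffAt ℝ ∞ (fun y => pullNablaWeyl p₀ g y (A y) (X y) (Y y) (Z y) (T y)) x := by
  have hW := hg.smooth_pullWeyl hx
  have hW' : ContDiffAt ℝ ∞ (fderiv ℝ (pullWeyl p₀ g)) x := hW.fderiv_right (by simp)
  have h1 := ((hg.isFlatMetric p₀).smooth_christoffel hx).clm_apply hA
  exact (((((((hW'.clm_apply hA).clm_apply hX).clm_apply hY).clm_apply hZ).clm_apply hT).sub
    ((((hW.clm_apply (h1.clm_apply hX)).clm_apply hY).clm_apply hZ).clm_apply hT)).sub
    ((((hW.clm_apply hX).clm_apply (h1.clm_apply hY)).clm_apply hZ).clm_apply hT)).sub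
    ((((hW.clm_apply hX).clm_apply hY).clm_apply (h1.clm_apply hZ)).clm_apply hT) |>.sub
    ((((hW.clm_apply hX).clm_apply hY).clm_apply hZ).clm_apply (h1.clm_apply hT))

end IsMetricOn
end WeylSmooth

/-! ### Algebra behind the conformal change of the divergence of the Weyl tensor -/

section DivWeylAlgebra

variable {n : ℕ} {V : Type*} [AddCommGroup V] [Module ℝ V]

/-- The difference tensor of two conformal connections, in terms of the gradient `F` of `φ`. -/
def connDiff (b : V → V → ℝ) (F v w : V) : V := b v w • F - b F v • w - b F w • v

/-- The correction terms in the covariant derivative of the Weyl tensor under a conformal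
change. -/
def weylCorrection (b : V → V → ℝ) (F : V) (W : V → V → V → V → ℝ) (a x y z t : V) : ℝ :=
  -2 * b F a * W x y z t - W (connDiff b F a x) y z t - W x (connDiff b F a y) z t
    - W x y (connDiff b F a z) t - W x y z (connDiff b F a t)

/-- The traces of `W` vanish, and the multiples of `W(x,y,z,F)` add up to `-2 + 1 + 1 + 1 - (n-2) =
-(n-3)`. The three remaining terms, with `F` in one of the other slots, cancel by the Bianchi
identity. -/
lemma IsFrame.sum_weylCorrection {b : V → V → ℝ} {e : Fin n → V} (he : IsFrame b e)
    {W : V → V → V → V → ℝ} (hW : IsCurvLike W)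
    (htr : ∀ y z, ∑ i, W (e i) y z (e i) = 0) (F x y z : V) :
    ∑ j, weylCorrection b F W (e j) x y z (e j) = - ((n : ℝ) - 3) * W x y z F := by
  obtain ⟨L, hL⟩ := hW.multilin
  have hF : ∀ v, W x y z v = ∑ j, b (e j) v * W x y z (e j) := fun v => by
    simp only [hL]; exact (he.linear_expand _ _).symm
  have hF' : ∑ j, b F (e j) * W x y z (e j) = W x y z F := by
    rw [hF F]; simp only [he.symm F]
  have hx : ∀ u y z v, ∑ j, b (e j) v * W u y z (e j) = W u y z v := fun u y z v => by
    simp only [hL]; exact he.linear_expand _ _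
  have h1 : ∑ j, W (connDiff b F (e j) x) y z (e j) = W F y z x - W x y z F := by
    have : ∀ j, W (connDiff b F (e j) x) y z (e j) = b (e j) x * W F y z (e j)
        - b F (e j) * W x y z (e j) - b F x * W (e j) y z (e j) := by simp [hL, connDiff]
    simp only [this, Finset.sum_sub_distrib, ← Finset.mul_sum, htr, hx, hF', mul_zero, sub_zero]
  have h2 : ∑ j, W x (connDiff b F (e j) y) z (e j) = W x F z y - W x y z F := by
    have : ∀ j, W x (connDiff b F (e j) y) z (e j) = b (e j) y * W x F z (e j)
        - b F (e j) * W x y z (e j) - b F y * W x (e j) z (e j) := by simp [hL, connDiff]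
    have h0 : ∑ j, W x (e j) z (e j) = 0 := by
      simp only [hW.swap_left x, Finset.sum_neg_distrib, htr, neg_zero]
    simp only [this, Finset.sum_sub_distrib, ← Finset.mul_sum, h0, hx, hF', mul_zero, sub_zero]
  have h3 : ∑ j, W x y (connDiff b F (e j) z) (e j) = W x y F z - W x y z F := by
    have : ∀ j, W x y (connDiff b F (e j) z) (e j) = b (e j) z * W x y F (e j)
        - b F (e j) * W x y z (e j) - b F z * W x y (e j) (e j) := by simp [hL, connDiff]
    have h0 : ∀ v, W x y v v = 0 := fun v => by linarith [hW.swap_right x y v v]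
    simp only [this, Finset.sum_sub_distrib, h0, hx, hF', mul_zero, sub_zero]
  have h4 : ∑ j, W x y z (connDiff b F (e j) (e j)) = n * W x y z F - 2 * W x y z F := by
    have : ∀ j, W x y z (connDiff b F (e j) (e j)) = b (e j) (e j) * W x y z F
        - 2 * (b F (e j) * W x y z (e j)) := by intro j; simp [hL, connDiff]; ring
    simp only [this, Finset.sum_sub_distrib, ← Finset.mul_sum, ← Finset.sum_mul, he.trace_self, hF']
  have h5 : ∑ j, -2 * b F (e j) * W x y z (e j) = -2 * W x y z F := by
    rw [← hF', Finset.mul_sum]; exact Finset.sum_congr rfl fun _ _ => mul_assoc _ _ _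
  simp only [weylCorrection, Finset.sum_sub_distrib, h1, h2, h3, h4, h5]
  have hb := hW.bianchi y F x z
  linarith [hW.pair_symm F y z x, hW.swap_left z x F y, hW.pair_symm x F z y,
    hW.pair_symm z y x F, hW.swap_left z y x F, hW.swap_right y z x F, hW.pair_symm y F x z,
    hW.pair_symm F x y z, hW.pair_symm x z y F, hW.swap_left z x y F, hW.swap_right z x F y]

end DivWeylAlgebra

/-! ### Conformal change of the covariant derivative and divergence of the Weyl tensor -/

section ConformalDivWeyl

variable {n : ℕ} {M : Type*} [TopologicalSpace M] [ChartedSpace (EuclideanSpace ℝ (Fin n)) M]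
  [IsManifold (𝓡 n) ∞ M]
variable {g : BilinField n M} {U : Set M} (hg : IsMetricOn g U) {φ : M → ℝ}
  (hφ : ContMDiffOn (𝓡 n) 𝓘(ℝ, ℝ) ∞ φ U)

include hg in
lemma IsMetricOn.apply_gradient {p : M} (hp : p ∈ U) (v : TangentSpace (𝓡 n) p) :
    g p (gradient g φ p) v = mvfderiv (𝓡 n) φ p v := by
  refine Eq.trans ?_ ((hg.isFrame hp).linear_expand (mvfderiv (𝓡 n) φ p).toLinearMap v)
  simp only [gradient, map_sum, map_smul, sum_apply, smul_apply, smul_eq_mul]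
  exact Finset.sum_congr rfl fun i _ => mul_comm _ _

include hg hφ

variable {p₀ : M} {x : EuclideanSpace ℝ (Fin n)} (hx : x ∈ chartDom p₀ ∩ chartInv p₀ ⁻¹' U)

include hx

lemma mvfderiv_chart (u : EuclideanSpace ℝ (Fin n)) :
    mvfderiv (𝓡 n) φ (chartInv p₀ x) (chartD p₀ x u) =
      fderiv ℝ (fun y => φ (chartInv p₀ y)) x u :=
  mvfderiv_chartD hx.1 ((contMDiffAt_iff_contDiffAt hx.1).2 (smooth_pull_function hg hφ hx)) u

lemma gradient_chart : gradient g φ (chartInv p₀ x) =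
    chartD p₀ x (sharp (pullMetric p₀ g) x (fderiv ℝ (fun y => φ (chartInv p₀ y)) x)) := by
  obtain ⟨u, hu⟩ := chartD_surjective hx.1 (gradient g φ (chartInv p₀ x))
  rw [← hu]
  congr 1
  refine (hg.isFlatMetric p₀).ext_inner hx fun t => ?_
  rw [(hg.isFlatMetric p₀).apply_sharp hx, pullMetric_apply, hu, hg.apply_gradient hx.2,
    mvfderiv_chart hg hφ hx]

lemma chartD_flatDiff (u v : EuclideanSpace ℝ (Fin n)) :
    chartD p₀ x (flatDiff (pullMetric p₀ g) (fun y => φ (chartInv p₀ y)) x u v) =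
      connDiff (fun v w => g (chartInv p₀ x) v w) (gradient g φ (chartInv p₀ x))
        (chartD p₀ x u) (chartD p₀ x v) := by
  simp only [connDiff, flatDiff, map_sub, map_smul, hg.apply_gradient hx.2,
    mvfderiv_chart hg hφ hx, pullMetric_apply]
  rw [gradient_chart hg hφ hx]

set_option maxHeartbeats 1000000 in
lemma nablaWeyl_conformal_chart (hn : 4 ≤ n) (a u v w t : EuclideanSpace ℝ (Fin n)) :
    pullNablaWeyl p₀ (conformalChange φ g) x a u v w t =
      Real.exp (-2 * φ (chartInv p₀ x)) * (pullNablaWeyl p₀ g x a u v w t +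
        (-2 * fderiv ℝ (fun y => φ (chartInv p₀ y)) x a * pullWeyl p₀ g x u v w t
          - pullWeyl p₀ g x (flatDiff (pullMetric p₀ g) (fun y => φ (chartInv p₀ y)) x a u) v w t
          - pullWeyl p₀ g x u (flatDiff (pullMetric p₀ g) (fun y => φ (chartInv p₀ y)) x a v) w t
          - pullWeyl p₀ g x u v (flatDiff (pullMetric p₀ g) (fun y => φ (chartInv p₀ y)) x a w) t
          - pullWeyl p₀ g x u v w
            (flatDiff (pullMetric p₀ g) (fun y => φ (chartInv p₀ y)) x a t))) := by
  have hg' := hg.conformal hφ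
  have hW : ∀ y ∈ chartDom p₀ ∩ chartInv p₀ ⁻¹' U, pullWeyl p₀ (conformalChange φ g) y =
      Real.exp (-2 * φ (chartInv p₀ y)) • pullWeyl p₀ g y := by
    intro y hy
    ext a b c d
    simp only [smul_apply, hg'.pullWeyl_apply hy, hg.pullWeyl_apply hy,
      weyl_conformal hg hφ hn hy.2, smul_eq_mul]
  have hc := (((ContDiffAt.hasFDerivAt_top (smooth_pull_function hg hφ hx)).const_mul
    (-2)).exp).smul (ContDiffAt.hasFDerivAt_top (hg.smooth_pullWeyl hx))
  have hd := hc.congr_of_eventuallyEq (hg.eventuallyEq_of_chart hx hW)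
  rw [pullNablaWeyl, pullNablaWeyl, hd.fderiv, hW x hx, pullMetric_conformalChange]
  simp only [(hg.isFlatMetric p₀).christoffel_flatConformal hx fun y hy =>
    smooth_pull_function hg hφ hy]
  simp only [map_add, add_apply, smul_apply, ContinuousLinearMap.smulRight_apply, smul_eq_mul]
  ring

lemma nablaWeyl_conformal (hn : 4 ≤ n) (a u v w t : TangentSpace (𝓡 n) (chartInv p₀ x)) :
    nablaWeyl (conformalChange φ g) (chartInv p₀ x) a u v w t =
      Real.exp (-2 * φ (chartInv p₀ x)) * (nablaWeyl g (chartInv p₀ x) a u v w t +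
        weylCorrection (fun v w => g (chartInv p₀ x) v w) (gradient g φ (chartInv p₀ x))
          (weyl g (chartInv p₀ x)) a u v w t) := by
  obtain ⟨a, rfl⟩ := chartD_surjective hx.1 a
  obtain ⟨u, rfl⟩ := chartD_surjective hx.1 u
  obtain ⟨v, rfl⟩ := chartD_surjective hx.1 v
  obtain ⟨w, rfl⟩ := chartD_surjective hx.1 w
  obtain ⟨t, rfl⟩ := chartD_surjective hx.1 t
  rw [(hg.conformal hφ).nablaWeyl_eq hx, nablaWeyl_conformal_chart hg hφ hx hn, weylCorrection,
    hg.nablaWeyl_eq hx]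
  simp only [← chartD_flatDiff hg hφ hx, hg.apply_gradient hx.2, mvfderiv_chart hg hφ hx,
    hg.pullWeyl_apply hx]

omit hφ in
lemma isMultilin_nablaWeyl_chart (a : TangentSpace (𝓡 n) (chartInv p₀ x)) :
    IsMultilin (nablaWeyl g (chartInv p₀ x) a) := by
  have key : nablaWeyl g (chartInv p₀ x) a = fun u v w t => pullNablaWeyl p₀ g x
      ((chartD p₀ x).inverse a) ((chartD p₀ x).inverse u) ((chartD p₀ x).inverse v)
      ((chartD p₀ x).inverse w) ((chartD p₀ x).inverse t) := by
    ext u v w t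
    rw [← hg.nablaWeyl_eq hx]
    simp only [chartD_inverse' hx.1]
  rw [key]
  refine .of_bilin (fun z t => ?_) (fun x y => ?_) <;> constructor <;> intros <;>
    simp [pullNablaWeyl] <;> ring

omit hφ in
lemma isBilin_nablaWeyl_chart (u v w : TangentSpace (𝓡 n) (chartInv p₀ x)) :
    IsBilin fun a t => nablaWeyl g (chartInv p₀ x) a u v w t := by
  have key : (fun a t => nablaWeyl g (chartInv p₀ x) a u v w t) = fun a t => pullNablaWeyl p₀ g x
      ((chartD p₀ x).inverse a) ((chartD p₀ x).inverse u) ((chartD p₀ x).inverse v)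
      ((chartD p₀ x).inverse w) ((chartD p₀ x).inverse t) := by
    ext a t
    rw [← hg.nablaWeyl_eq hx]
    simp only [chartD_inverse' hx.1]
  rw [key]
  constructor <;> intros <;> simp [pullNablaWeyl] <;> ring

omit hx in
-- The trace contributes `e^{2φ}` against the factor `e^{-2φ}` of the covariant derivative, so no
-- conformal weight remains; the correction is `sum_weylCorrection`.
lemma divWeyl_conformal (hn : 4 ≤ n) {p : M} (hp : p ∈ U) (u v w : TangentSpace (𝓡 n) p) :
    divWeyl (conformalChange φ g) p u v w =
      divWeyl g p u v w - ((n : ℝ) - 3) * weyl g p u v w (gradient g φ p) := by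
  obtain ⟨p₀, x, hx, rfl⟩ := exists_chart (n := n) p
  have hx' : x ∈ chartDom p₀ ∩ chartInv p₀ ⁻¹' U := ⟨hx, hp⟩
  have h1 := (hg.isFrame hp).contraction ((hg.conformal hφ).isFrame hp)
    (Real.exp_pos _).ne' (fun _ _ => rfl)
    (isBilin_nablaWeyl_chart (hg.conformal hφ) hx' u v w)
  rw [divWeyl, h1]
  simp only [nablaWeyl_conformal hg hφ hx' hn]
  rw [← Finset.mul_sum, inv_mul_cancel_left₀ (Real.exp_pos _).ne', Finset.sum_add_distrib,
    (hg.isFrame hp).sum_weylCorrection (hg.isCurvLike_weyl hp)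
      (hg.trace_weyl hp hn (hg.isFrame hp)), divWeyl]
  ring

end ConformalDivWeyl

/-! ### Quadratic contractions of a curvature tensor -/

section TripleContraction

variable {n : ℕ} {V : Type*} [AddCommGroup V] [Module ℝ V]

lemma IsBilin.sum {ι : Type*} {s : Finset ι} {B : ι → V → V → ℝ} (hB : ∀ i ∈ s, IsBilin (B i)) :
    IsBilin fun x y => ∑ i ∈ s, B i x y where
  add_left x y z := by
    rw [← Finset.sum_add_distrib]; exact Finset.sum_congr rfl fun i hi => (hB i hi).add_left _ _ _
  smul_left a x z := by
    rw [Finset.mul_sum]; exact Finset.sum_congr rfl fun i hi => (hB i hi).smul_left _ _ _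
  add_right x y z := by
    rw [← Finset.sum_add_distrib]; exact Finset.sum_congr rfl fun i hi => (hB i hi).add_right _ _ _
  smul_right a x z := by
    rw [Finset.mul_sum]; exact Finset.sum_congr rfl fun i hi => (hB i hi).smul_right _ _ _

/-- A function of six variables that is bilinear in each of the three consecutive pairs. -/
structure IsTriBilin (Q : V → V → V → V → V → V → ℝ) : Prop where
  fst : ∀ b b' c c', IsBilin fun a a' => Q a a' b b' c c'
  snd : ∀ a a' c c', IsBilin fun b b' => Q a a' b b' c c'
  trd : ∀ a a' b b', IsBilin fun c c' => Q a a' b b' c c'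

lemma IsTriBilin.mul {R T : V → V → V → ℝ}
    (hR : ∃ L : V →ₗ[ℝ] V →ₗ[ℝ] V →ₗ[ℝ] ℝ, R = fun a b c => L a b c)
    (hT : ∃ L : V →ₗ[ℝ] V →ₗ[ℝ] V →ₗ[ℝ] ℝ, T = fun a b c => L a b c) :
    IsTriBilin fun a a' b b' c c' => R a b c * T a' b' c' := by
  obtain ⟨R, rfl⟩ := hR
  obtain ⟨T, rfl⟩ := hT
  constructor <;> intros <;> constructor <;> intros <;> simp <;> ring

lemma triple_contraction {b b' : V → V → ℝ} {e e' : Fin n → V} (he : IsFrame b e)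
    (he' : IsFrame b' e') {c : ℝ} (hc : c ≠ 0) (hb : ∀ v w, b' v w = c * b v w)
    {Q : V → V → V → V → V → V → ℝ} (hQ : IsTriBilin Q) :
    ∑ i, ∑ j, ∑ k, Q (e' i) (e' i) (e' j) (e' j) (e' k) (e' k) =
      c⁻¹ ^ 3 * ∑ i, ∑ j, ∑ k, Q (e i) (e i) (e j) (e j) (e k) (e k) := by
  have h1 : ∀ i j, ∑ k, Q (e' i) (e' i) (e' j) (e' j) (e' k) (e' k) =
      c⁻¹ * ∑ k, Q (e' i) (e' i) (e' j) (e' j) (e k) (e k) := fun i j =>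
    he.contraction he' hc hb (hQ.trd _ _ _ _)
  have h2 : ∀ i, ∑ j, ∑ k, Q (e' i) (e' i) (e' j) (e' j) (e k) (e k) =
      c⁻¹ * ∑ j, ∑ k, Q (e' i) (e' i) (e j) (e j) (e k) (e k) := fun i =>
    he.contraction he' hc hb (B := fun v w => ∑ k, Q (e' i) (e' i) v w (e k) (e k))
      (.sum fun k _ => hQ.snd _ _ _ _)
  have h3 : ∑ i, ∑ j, ∑ k, Q (e' i) (e' i) (e j) (e j) (e k) (e k) =
      c⁻¹ * ∑ i, ∑ j, ∑ k, Q (e i) (e i) (e j) (e j) (e k) (e k) :=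
    he.contraction he' hc hb (B := fun v w => ∑ j, ∑ k, Q v w (e j) (e j) (e k) (e k))
      (.sum fun j _ => .sum fun k _ => hQ.fst _ _ _ _)
  simp only [h1, h2, ← Finset.mul_sum, h3]
  ring

lemma IsCurvLike.sub_eq {W : V → V → V → V → ℝ} (hW : IsCurvLike W) (u z t v : V) :
    W u z t v - W v z t u = W z t v u := by
  have := hW.bianchi u z t v
  linarith [hW.pair_symm v z t u, hW.swap_right t u v z, hW.swap_right z t u v]

/-- Exchanging the two summation indices turns the antisymmetry of `C` into a difference of two
values of `W`, which the Bianchi identity collapses to one (`sub_eq`). -/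
lemma IsCurvLike.contract_antisymm {W : V → V → V → V → ℝ} (hW : IsCurvLike W) {e : Fin n → V}
    {C : V → V → ℝ} (hC : ∀ x y, C x y = - C y x) (z t : V) :
    ∑ i, ∑ j, C (e i) (e j) * W (e j) z t (e i) =
      1 / 2 * ∑ i, ∑ j, C (e i) (e j) * W (e i) (e j) z t := by
  have h1 : ∑ i, ∑ j, C (e i) (e j) * W (e j) z t (e i) =
      - ∑ i, ∑ j, C (e i) (e j) * W (e i) z t (e j) := by
    rw [Finset.sum_comm, ← Finset.sum_neg_distrib]
    refine Finset.sum_congr rfl fun i _ => ?_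
    rw [← Finset.sum_neg_distrib]
    refine Finset.sum_congr rfl fun j _ => ?_
    rw [hC]; ring
  have h2 : ∑ i, ∑ j, C (e i) (e j) * W (e i) (e j) z t =
      ∑ i, ∑ j, C (e i) (e j) * W (e j) z t (e i) -
        ∑ i, ∑ j, C (e i) (e j) * W (e i) z t (e j) := by
    simp only [← Finset.sum_sub_distrib, ← mul_sub]
    refine Finset.sum_congr rfl fun i _ => Finset.sum_congr rfl fun j _ => ?_
    rw [hW.sub_eq, hW.pair_symm]
  linarith

/-- This and the next two lemmas supply the trilinear factors for `IsTriBilin.mul`, each in the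
order of slots in which it gets contracted. -/
lemma IsMultilin.fix_fourth {W : V → V → V → V → ℝ} (hW : IsMultilin W) (u : V) :
    ∃ L : V →ₗ[ℝ] V →ₗ[ℝ] V →ₗ[ℝ] ℝ, (fun a b c => W a b c u) = fun a b c => L a b c := by
  obtain ⟨L, rfl⟩ := hW
  refine ⟨LinearMap.mk₂ ℝ (fun a b => (L a b).flip u) ?_ ?_ ?_ ?_, rfl⟩ <;> intros <;> ext <;> simp

lemma IsMultilin.fix_third_perm {W : V → V → V → V → ℝ} (hW : IsMultilin W) (v : V) :
    ∃ L : V →ₗ[ℝ] V →ₗ[ℝ] V →ₗ[ℝ] ℝ, (fun i a b => W b i v a) = fun a b c => L a b c := by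
  obtain ⟨L, rfl⟩ := hW
  refine ⟨LinearMap.mk₂ ℝ (fun i a => ((L.flip i).flip v).flip a) ?_ ?_ ?_ ?_, rfl⟩ <;> intros <;>
    ext <;> simp

lemma IsMultilin.contract_perm {D : Fin n → V → V → V → V → ℝ} (hD : ∀ j, IsMultilin (D j))
    (e : Fin n → V) : ∃ L : V →ₗ[ℝ] V →ₗ[ℝ] V →ₗ[ℝ] ℝ,
      (fun i a b => ∑ j, D j a b i (e j)) = fun a b c => L a b c := by
  choose L hL using hD
  refine ⟨LinearMap.mk₂ ℝ (fun i a => ∑ j, (((L j a).flip i).flip (e j))) ?_ ?_ ?_ ?_, ?_⟩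
  · intros; ext; simp [Finset.sum_add_distrib]
  · intros; ext; simp [Finset.mul_sum]
  · intros; ext; simp [Finset.sum_add_distrib]
  · intros; ext; simp [Finset.mul_sum]
  · ext i a b
    simp [hL]

/-- The contraction `∑ W(a,b,c,u) W(a,b,c,v)`. -/
def tensorSquare (e : Fin n → V) (W : V → V → V → V → ℝ) (u v : V) : ℝ :=
  ∑ i, ∑ j, ∑ k, W (e i) (e j) (e k) u * W (e i) (e j) (e k) v

lemma tensorSquare_symm (e : Fin n → V) (W : V → V → V → V → ℝ) (u v : V) :
    tensorSquare e W u v = tensorSquare e W v u := by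
  simp only [tensorSquare, mul_comm]

/-- For a fixed third index `W(·,·,e_i,u)` is antisymmetric, so `contract_antisymm` applies. The
right-hand side has the shape that arises both from `frakW` and from the correction term in
`weylSource`. -/
lemma IsCurvLike.half_tensorSquare {W : V → V → V → V → ℝ} (hW : IsCurvLike W) (e : Fin n → V)
    (u v : V) : 1 / 2 * tensorSquare e W u v =
      ∑ i, ∑ a, ∑ b, W (e a) (e b) (e i) u * W (e b) (e i) v (e a) := by
  have h1 : ∀ i, ∑ a, ∑ b, W (e a) (e b) (e i) u * W (e b) (e i) v (e a) =
      1 / 2 * ∑ a, ∑ b, W (e a) (e b) (e i) u * W (e a) (e b) (e i) v := fun i =>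
    hW.contract_antisymm (C := fun x y => W x y (e i) u) (fun x y => hW.swap_left x y _ _) (e i) v
  simp only [h1, ← Finset.mul_sum]
  congr 1
  symm
  rw [Finset.sum_comm, tensorSquare]
  exact Finset.sum_congr rfl fun a _ => Finset.sum_comm

/-- On the diagonal `tensorSquare` is a sum of squares, so all components with `u` in the last slot
vanish; the symmetries of `W` move `u` to the first slot. -/
lemma IsFrame.eq_zero_of_tensorSquare {b : V → V → ℝ} {e : Fin n → V} (he : IsFrame b e)
    {W : V → V → V → V → ℝ} (hW : IsCurvLike W) {u : V} (h : tensorSquare e W u u = 0)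
    (x y z : V) : W u x y z = 0 := by
  have h1 : ∀ i j k, W (e i) (e j) (e k) u = 0 := by
    intro i j k
    have h2 := (Finset.sum_eq_zero_iff_of_nonneg (fun i _ => Finset.sum_nonneg fun j _ =>
      Finset.sum_nonneg fun k _ => mul_self_nonneg _)).1 h i (Finset.mem_univ _)
    have h3 := (Finset.sum_eq_zero_iff_of_nonneg (fun j _ =>
      Finset.sum_nonneg fun k _ => mul_self_nonneg _)).1 h2 j (Finset.mem_univ _)
    have h4 := (Finset.sum_eq_zero_iff_of_nonneg (fun k _ => mul_self_nonneg _)).1 h3 k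
      (Finset.mem_univ _)
    exact mul_self_eq_zero.1 h4
  obtain ⟨L, hL⟩ := hW.multilin.fix_fourth u
  have h2 : ∀ x y z, W x y z u = L x y z := fun x y z => congrFun (congrFun (congrFun hL x) y) z
  have h3 : W y z x u = 0 := by
    rw [h2, ← he.expand y, ← he.expand z, ← he.expand x]
    simp [← h2, h1]
  rw [hW.pair_symm, hW.swap_right, h3, neg_zero]

end TripleContraction

/-! ### The operator `𝔴`, its kernel, and conformal weights -/

section WeylOperator

variable {n : ℕ} {M : Type*} [TopologicalSpace M] [ChartedSpace (EuclideanSpace ℝ (Fin n)) M]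
  [IsManifold (𝓡 n) ∞ M]

/-- The vector dual to a covector. -/
def covSharp (g : BilinField n M) (p : M) (θ : Cotangent n p) : TangentSpace (𝓡 n) p :=
  ∑ i, θ (frame g p i) • frame g p i

/-- The covector `∑ᵢ eᵢ ⌟ 𝒲(δW_{eᵢ})`. -/
def weylSource (g : BilinField n M) (p : M) : Cotangent n p :=
  contract g p fun i => weylOp g p fun x y => divWeyl g p x y (frame g p i)

namespace IsMetricOn

variable {g : BilinField n M} {U : Set M} (hg : IsMetricOn g U) {p : M} (hp : p ∈ U)
include hg hp

lemma apply_covSharp (θ : Cotangent n p) (v : TangentSpace (𝓡 n) p) :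
    g p (covSharp g p θ) v = θ v := by
  refine Eq.trans ?_ ((hg.isFrame hp).linear_expand θ.toLinearMap v)
  simp only [covSharp, map_sum, map_smul, sum_apply, smul_apply, smul_eq_mul]
  exact Finset.sum_congr rfl fun i _ => mul_comm _ _

lemma weylOp_linear (b : TangentSpace (𝓡 n) p → TangentSpace (𝓡 n) p → ℝ)
    (z : TangentSpace (𝓡 n) p) :
    ∃ L : TangentSpace (𝓡 n) p →ₗ[ℝ] ℝ, ∀ t, weylOp g p b z t = L t := by
  obtain ⟨L, hL⟩ := (hg.isCurvLike_weyl hp).multilin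
  refine ⟨⟨⟨weylOp g p b z, ?_⟩, ?_⟩, fun t => rfl⟩ <;> intros <;>
    simp [weylOp, hL, mul_add, Finset.sum_add_distrib, Finset.mul_sum, mul_left_comm]

lemma contract_weylOp (b : Fin n → TangentSpace (𝓡 n) p → TangentSpace (𝓡 n) p → ℝ)
    (v : TangentSpace (𝓡 n) p) :
    contract g p (fun i => weylOp g p (b i)) v = ∑ i, weylOp g p (b i) (frame g p i) v := by
  have h : contract g p (fun i => weylOp g p (b i)) v =
      ∑ j, (∑ i, weylOp g p (b i) (frame g p i) (frame g p j)) * g p (frame g p j) v := by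
    simp [contract]
  rw [h]
  simp only [Finset.sum_mul]
  rw [Finset.sum_comm]
  refine Finset.sum_congr rfl fun i _ => ?_
  obtain ⟨L, hL⟩ := hg.weylOp_linear hp (b i) (frame g p i)
  simp only [hL]
  rw [← (hg.isFrame hp).linear_expand L v]
  exact Finset.sum_congr rfl fun _ _ => mul_comm _ _

/-- The two terms of the wedge give a difference of two values of `W`, again collapsed by the
Bianchi identity. -/
lemma weylOp_wedge (i : Fin n) (θ : Cotangent n p) (z t : TangentSpace (𝓡 n) p) :
    weylOp g p (wedge (g p (frame g p i)) θ) z t =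
      weyl g p z t (frame g p i) (covSharp g p θ) := by
  obtain ⟨L, hL⟩ := (hg.isCurvLike_weyl hp).multilin
  rw [← (hg.isCurvLike_weyl hp).sub_eq]
  have h1 : weyl g p (covSharp g p θ) z t (frame g p i) =
      ∑ j, θ (frame g p j) * weyl g p (frame g p j) z t (frame g p i) := by
    simp [hL, covSharp]
  have h2 : weyl g p (frame g p i) z t (covSharp g p θ) =
      ∑ j, θ (frame g p j) * weyl g p (frame g p i) z t (frame g p j) := by
    simp [hL, covSharp]
  have ho : ∀ j, g p (frame g p i) (frame g p j) = if i = j then 1 else 0 :=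
    (hg.isFrame hp).orth i
  rw [h1, h2]
  simp [weylOp, wedge, ho, sub_mul, Finset.sum_sub_distrib, ite_mul]

/-- The inner Weyl operator is evaluated by `weylOp_wedge` and the outer one contracts the result
with `W`, as in `half_tensorSquare`. This exhibits `𝔴` as a Gram operator: self-adjoint and positive
semidefinite. -/
lemma frakW_apply (θ : Cotangent n p) (v : TangentSpace (𝓡 n) p) :
    frakW g p θ v = 1 / 2 * tensorSquare (frame g p) (weyl g p) (covSharp g p θ) v := by
  have hW := hg.isCurvLike_weyl hp
  have h : frakW g p θ = contract g p fun i => weylOp g p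
      (weylOp g p (wedge (g p (frame g p i)) θ)) := rfl
  rw [h, hg.contract_weylOp hp, hW.half_tensorSquare]
  refine Finset.sum_congr rfl fun i _ => ?_
  simp only [weylOp, LinearMap.coe_mk, AddHom.coe_mk]
  refine Finset.sum_congr rfl fun a _ => Finset.sum_congr rfl fun b _ => ?_
  rw [← hg.weylOp_wedge hp]
  rfl

lemma weylSource_apply (v : TangentSpace (𝓡 n) p) :
    weylSource g p v = ∑ i, ∑ a, ∑ b, divWeyl g p (frame g p a) (frame g p b) (frame g p i) *
      weyl g p (frame g p b) (frame g p i) v (frame g p a) := by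
  rw [weylSource, hg.contract_weylOp hp]
  rfl

lemma isMultilin_divWeyl : ∃ L : TangentSpace (𝓡 n) p →ₗ[ℝ] TangentSpace (𝓡 n) p →ₗ[ℝ]
    TangentSpace (𝓡 n) p →ₗ[ℝ] ℝ,
    (fun i a b => divWeyl g p a b i) = fun a b c => L a b c := by
  have h : ∀ j, IsMultilin (nablaWeyl g p (frame g p j)) := by
    obtain ⟨p₀, x, hx, rfl⟩ := exists_chart (n := n) p
    exact fun j => isMultilin_nablaWeyl_chart hg ⟨hx, hp⟩ _
  obtain ⟨L, hL⟩ := IsMultilin.contract_perm h (frame g p)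
  exact ⟨L, hL⟩

lemma coInner_eq (α β : Cotangent n p) : coInner g p α β = α (covSharp g p β) := by
  simp [coInner, covSharp, mul_comm]

lemma weylNull_iff (v : TangentSpace (𝓡 n) p) :
    v ∈ weylNull g p ↔ ∀ y z t, weyl g p v y z t = 0 := by
  obtain ⟨L, hL⟩ := (hg.isCurvLike_weyl hp).multilin
  refine ⟨fun hv => ?_, fun hv => Submodule.subset_span hv⟩
  refine Submodule.span_induction (p := fun v _ => ∀ y z t, weyl g p v y z t = 0)
    (fun _ h => h) ?_ ?_ ?_ hv
  · simp [hL]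
  · intro a b _ _ ha hb y z t
    simp only [hL] at ha hb ⊢
    simp [ha, hb]
  · intro a b _ hb y z t
    simp only [hL] at hb ⊢
    simp [hb]

/-- If `𝔴(θ) = 0`, its value on the dual vector of `θ` is a vanishing sum of squares. -/
lemma frakW_eq_zero_iff (θ : Cotangent n p) :
    frakW g p θ = 0 ↔ covSharp g p θ ∈ weylNull g p := by
  have hW := hg.isCurvLike_weyl hp
  rw [hg.weylNull_iff hp]
  constructor
  · intro h
    have h1 := hg.frakW_apply hp θ (covSharp g p θ)
    rw [h, zero_apply] at h1
    exact (hg.isFrame hp).eq_zero_of_tensorSquare hW (by linarith)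
  · intro h
    ext v
    have h1 : ∀ x y z, weyl g p x y z (covSharp g p θ) = 0 := fun x y z => by
      rw [hW.pair_symm, hW.swap_left, h, neg_zero]
    rw [hg.frakW_apply hp]
    simp [tensorSquare, h1]

lemma coInner_frakW (α β : Cotangent n p) :
    coInner g p (frakW g p α) β =
      1 / 2 * tensorSquare (frame g p) (weyl g p) (covSharp g p α) (covSharp g p β) := by
  rw [hg.coInner_eq hp, hg.frakW_apply hp]

end IsMetricOn

section Conformal

variable {g : BilinField n M} {U : Set M} (hg : IsMetricOn g U) {φ : M → ℝ}
  (hφ : ContMDiffOn (𝓡 n) 𝓘(ℝ, ℝ) ∞ φ U) {p : M} (hp : p ∈ U)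
include hg hφ hp

lemma covSharp_conformal (θ : Cotangent n p) :
    covSharp (conformalChange φ g) p θ = (Real.exp (-2 * φ p))⁻¹ • covSharp g p θ := by
  have hF := hg.isFrame hp
  have hc := (Real.exp_pos (-2 * φ p)).ne'
  have h : ∀ t, g p (Real.exp (-2 * φ p) • covSharp (conformalChange φ g) p θ) t =
      g p (covSharp g p θ) t := by
    intro t
    rw [hg.apply_covSharp hp, map_smul]
    exact (hg.conformal hφ).apply_covSharp hp θ t
  have h2 : Real.exp (-2 * φ p) • covSharp (conformalChange φ g) p θ = covSharp g p θ := by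
    rw [← hF.expand (Real.exp (-2 * φ p) • covSharp (conformalChange φ g) p θ),
      ← hF.expand (covSharp g p θ)]
    refine Finset.sum_congr rfl fun i _ => ?_
    rw [hg.symm p hp, h, hg.symm p hp]
  rw [← h2, smul_smul, inv_mul_cancel₀ hc, one_smul]

lemma coInner_conformal (α β : Cotangent n p) :
    coInner (conformalChange φ g) p α β = (Real.exp (-2 * φ p))⁻¹ * coInner g p α β := by
  rw [(hg.conformal hφ).coInner_eq hp, hg.coInner_eq hp, covSharp_conformal hg hφ hp, map_smul,
    smul_eq_mul]

/-- With `c = e^{-2φ}`: the three traces give `c⁻³`, the two Weyl tensors `c²`, and raising the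
index of the covector `c⁻¹`. -/
lemma frakW_conformal (hn : 4 ≤ n) :
    frakW (conformalChange φ g) p = ((Real.exp (-2 * φ p))⁻¹ ^ 2) • frakW g p := by
  have hc := (Real.exp_pos (-2 * φ p)).ne'
  ext θ v
  have hW := hg.isCurvLike_weyl hp
  rw [(hg.conformal hφ).frakW_apply hp, LinearMap.smul_apply, smul_apply, hg.frakW_apply hp,
    tensorSquare, triple_contraction (hg.isFrame hp) ((hg.conformal hφ).isFrame hp) hc
      (fun _ _ => rfl) (.mul (((hg.conformal hφ).isCurvLike_weyl hp).multilin.fix_fourth _)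
      (((hg.conformal hφ).isCurvLike_weyl hp).multilin.fix_fourth v))]
  simp only [weyl_conformal hg hφ hn hp, covSharp_conformal hg hφ hp]
  obtain ⟨L, hL⟩ := hW.multilin
  have h1 : ∀ a b c u (r : ℝ), weyl g p a b c (r • u) = r * weyl g p a b c u := by
    intros; simp [hL]
  simp only [h1, tensorSquare, smul_eq_mul, Finset.mul_sum]
  refine Finset.sum_congr rfl fun i _ => Finset.sum_congr rfl fun j _ =>
    Finset.sum_congr rfl fun k _ => ?_
  field_simp

/-- The three traces give `c⁻³` and the single Weyl tensor `c`, where `c = e^{-2φ}`. The correction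
`-(n-3) W(·,·,·,∇φ)` of `δW`, contracted with `W`, is `-(n-3) 𝔴(dφ)` by `half_tensorSquare`. -/
lemma weylSource_conformal (hn : 4 ≤ n) {α : Cotangent n p} (hα : α = mvfderiv (𝓡 n) φ p) :
    weylSource (conformalChange φ g) p = ((Real.exp (-2 * φ p))⁻¹ ^ 2) •
      (weylSource g p - ((n : ℝ) - 3) • frakW g p α) := by
  have hc := (Real.exp_pos (-2 * φ p)).ne'
  have hW := hg.isCurvLike_weyl hp
  have hs : covSharp g p α = gradient g φ p := by rw [hα]; rfl
  ext v
  rw [(hg.conformal hφ).weylSource_apply hp,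
    triple_contraction (hg.isFrame hp) ((hg.conformal hφ).isFrame hp) hc
      (fun _ _ => rfl) (.mul ((hg.conformal hφ).isMultilin_divWeyl hp)
      (((hg.conformal hφ).isCurvLike_weyl hp).multilin.fix_third_perm v))]
  simp only [weyl_conformal hg hφ hn hp, divWeyl_conformal hg hφ hn hp]
  rw [smul_apply, sub_apply, smul_apply, hg.frakW_apply hp, hg.weylSource_apply hp, hs]
  rw [hW.half_tensorSquare]
  simp only [smul_eq_mul, Finset.mul_sum, ← Finset.sum_sub_distrib]
  refine Finset.sum_congr rfl fun i _ => Finset.sum_congr rfl fun j _ =>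
    Finset.sum_congr rfl fun k _ => ?_
  field_simp

end Conformal
end WeylOperator

/-! ### Moore-Penrose inverses of self-adjoint maps -/

section MoorePenrose

variable {V : Type*} [AddCommGroup V] [Module ℝ V]

/-- A function of two variables that is an inner product. -/
structure IsInnerForm (h : V → V → ℝ) : Prop extends IsBilin h where
  symm : ∀ v w, h v w = h w v
  eq_zero : ∀ v, h v v = 0 → v = 0

namespace IsInnerForm

variable {h : V → V → ℝ} (hh : IsInnerForm h) {A B C : V →ₗ[ℝ] V}
include hh

lemma sub_left (u v w : V) : h (u - v) w = h u w - h v w := by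
  have h1 := hh.add_left (u - v) v w
  rw [sub_add_cancel] at h1
  linarith

lemma ext {u v : V} (huv : ∀ w, h u w = h v w) : u = v := by
  refine sub_eq_zero.1 (hh.eq_zero _ ?_)
  rw [hh.sub_left, huv, sub_self]

lemma zero_right (v : V) : h v 0 = 0 := by
  simpa using hh.smul_right 0 v 0

/-- `A B` and `A C` are self-adjoint projections onto the range of `A`, so they agree; `B A` and `C
A` are self-adjoint projections with the kernel of `A`, so they agree too. -/
lemma moorePenrose_unique (hB : IsMoorePenrose h A B) (hC : IsMoorePenrose h A C) : B = C := by
  have aba : ∀ v, A (B (A v)) = A v := fun v => LinearMap.congr_fun hB.aba v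
  have aca : ∀ v, A (C (A v)) = A v := fun v => LinearMap.congr_fun hC.aba v
  have bab : ∀ v, B (A (B v)) = B v := fun v => LinearMap.congr_fun hB.bab v
  have cac : ∀ v, C (A (C v)) = C v := fun v => LinearMap.congr_fun hC.bab v
  have h1 : ∀ v, A (B v) = A (C v) := fun v => hh.ext fun w => by
    rw [← aca (B v), hC.symm_ab, hB.symm_ab, aba, hC.symm_ab]
  have h2 : ∀ v, B (A v) = C (A v) := fun v => hh.ext fun w => by
    rw [← aca v, hB.symm_ba, hC.symm_ba, aba, ← hC.symm_ba, aca]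
  ext v
  rw [← bab, h2, h1, cac]

variable (hA : ∀ v w, h (A v) w = h v (A w))
include hA

lemma apply_eq_zero {v : V} (hv : A (A v) = 0) : A v = 0 := by
  refine hh.eq_zero _ ?_
  rw [hA, hv, hh.zero_right]

/-- A self-adjoint `A` is injective on its range, and its range is orthogonal to its kernel. The
four Penrose conditions follow by comparing images under `A`. -/
lemma isMoorePenrose_of (hB : ∀ v, B v ∈ LinearMap.range A) (hAB : ∀ v, A (A (B v)) = A v) :
    IsMoorePenrose h A B := by
  have h0 : ∀ v w, v ∈ LinearMap.range A → w ∈ LinearMap.range A → A v = A w → v = w := by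
    rintro _ _ ⟨v, rfl⟩ ⟨w, rfl⟩ hvw
    refine sub_eq_zero.1 ?_
    rw [← map_sub]
    refine hh.apply_eq_zero hA ?_
    rw [map_sub, map_sub, hvw, sub_self]
  have hperp : ∀ v w, v ∈ LinearMap.range A → A w = 0 → h v w = 0 := by
    rintro _ w ⟨v, rfl⟩ hw
    rw [hA, hw, hh.zero_right]
  have hdec : ∀ v w w', v ∈ LinearMap.range A → A w = A w' → h v w = h v w' := by
    intro v w w' hv hw
    have := hperp v (w - w') hv (by rw [map_sub, hw, sub_self])
    rw [hh.symm, hh.sub_left, hh.symm w, hh.symm w'] at this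
    linarith
  have aba : ∀ v, A (B (A v)) = A v := fun v =>
    h0 _ _ (LinearMap.mem_range_self _ _) (LinearMap.mem_range_self _ _) (hAB _)
  refine ⟨LinearMap.ext aba, LinearMap.ext fun v => h0 _ _ (hB _) (hB _) ?_, fun v w => ?_,
    fun v w => ?_⟩
  · exact h0 _ _ (LinearMap.mem_range_self _ _) (LinearMap.mem_range_self _ _) (hAB _)
  · rw [hdec _ w (A (B w)) (LinearMap.mem_range_self _ _) (hAB w).symm, hh.symm v,
      hdec _ v (A (B v)) (LinearMap.mem_range_self _ _) (hAB v).symm, hh.symm]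
  · rw [hdec _ w (B (A w)) (hB _) (aba w).symm, hh.symm v,
      hdec _ v (B (A v)) (hB _) (aba v).symm, hh.symm]

variable [FiniteDimensional ℝ V]

/-- On the range of `A` the map `A²` is injective, hence invertible; `B` is `A` followed by the
inverse of this restriction. -/
lemma exists_moorePenrose : ∃ B : V →ₗ[ℝ] V, (∀ v, B v ∈ LinearMap.range A) ∧
    ∀ v, A (A (B v)) = A v := by
  let S : LinearMap.range A →ₗ[ℝ] LinearMap.range A :=
    A.rangeRestrict ∘ₗ A ∘ₗ (LinearMap.range A).subtype
  have hS : Function.Injective S := by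
    rw [← LinearMap.ker_eq_bot, LinearMap.ker_eq_bot']
    rintro ⟨_, v, rfl⟩ hv
    have h1 : A (A (A v)) = 0 := congrArg Subtype.val hv
    exact Subtype.ext (hh.apply_eq_zero hA (hh.apply_eq_zero hA h1))
  let e := LinearEquiv.ofInjectiveEndo S hS
  refine ⟨(LinearMap.range A).subtype ∘ₗ e.symm.toLinearMap ∘ₗ A.rangeRestrict,
    fun v => Subtype.coe_prop _, fun v => ?_⟩
  exact congrArg Subtype.val (e.apply_symm_apply (A.rangeRestrict v))

lemma moorePenrose_eq {B : V →ₗ[ℝ] V} (hB : ∀ v, B v ∈ LinearMap.range A)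
    (hAB : ∀ v, A (A (B v)) = A v) : moorePenrose h A = B :=
  hh.moorePenrose_unique (Classical.epsilon_spec (p := fun B => IsMoorePenrose h A B)
    ⟨B, hh.isMoorePenrose_of hA hB hAB⟩) (hh.isMoorePenrose_of hA hB hAB)

/-- With the next two lemmas, this replaces the Moore-Penrose inverse by a linear problem: its value
at `y` is the only `z` in the range of `A` with `A A z = A y`. -/
lemma moorePenrose_apply_eq {y z : V} (hz : z ∈ LinearMap.range A) (hy : A (A z) = A y) :
    moorePenrose h A y = z := by
  obtain ⟨B, hB, hAB⟩ := hh.exists_moorePenrose hA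
  rw [hh.moorePenrose_eq hA hB hAB]
  obtain ⟨w, hw⟩ := hB y
  obtain ⟨v, rfl⟩ := hz
  rw [← hw]
  refine sub_eq_zero.1 ?_
  rw [← map_sub]
  refine hh.apply_eq_zero hA (hh.apply_eq_zero hA ?_)
  rw [map_sub, map_sub, map_sub, hw, hAB, hy, sub_self]

lemma moorePenrose_apply_mem (y : V) : moorePenrose h A y ∈ LinearMap.range A := by
  obtain ⟨B, hB, hAB⟩ := hh.exists_moorePenrose hA
  rw [hh.moorePenrose_eq hA hB hAB]
  exact hB y

lemma apply_apply_moorePenrose (y : V) : A (A (moorePenrose h A y)) = A y := by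
  obtain ⟨B, hB, hAB⟩ := hh.exists_moorePenrose hA
  rw [hh.moorePenrose_eq hA hB hAB]
  exact hAB y

lemma mem_range_of_perp {v : V} (hv : ∀ w, A w = 0 → h v w = 0) : v ∈ LinearMap.range A := by
  obtain ⟨B, hB, hAB⟩ := hh.exists_moorePenrose hA
  refine ⟨B v, (sub_eq_zero.1 (hh.eq_zero _ ?_)).symm⟩
  have h1 : A (v - A (B v)) = 0 := by rw [map_sub, hAB, sub_self]
  rw [hh.sub_left, hv _ h1, hA, h1, hh.zero_right, sub_zero]

lemma moorePenrose_apply_self {v : V} (hv : ∀ w, A w = 0 → h v w = 0) :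
    moorePenrose h A (A v) = v :=
  hh.moorePenrose_apply_eq hA (hh.mem_range_of_perp hA hv) rfl

lemma moorePenrose_smul {h' : V → V → ℝ} (hh' : IsInnerForm h') {c a : ℝ} (ha : a ≠ 0)
    (hc : ∀ v w, h' v w = c * h v w) (y : V) :
    moorePenrose h' (a • A) y = a⁻¹ • moorePenrose h A y := by
  obtain ⟨w, hw⟩ := hh.moorePenrose_apply_mem hA y
  refine hh'.moorePenrose_apply_eq (fun v w => ?_) ⟨(a⁻¹ * a⁻¹) • w, ?_⟩ ?_
  · rw [LinearMap.smul_apply, LinearMap.smul_apply, hh'.smul_left, hh'.smul_right, hc, hc, hA]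
  · rw [LinearMap.smul_apply, map_smul, hw, smul_smul, mul_inv_cancel_left₀ ha]
  · simp only [LinearMap.smul_apply, map_smul, smul_smul]
    rw [hh.apply_apply_moorePenrose hA]
    congr 1
    field_simp

end IsInnerForm
end MoorePenrose

/-! ### Conformal transformation law of `𝕋` -/

section FieldT

variable {n : ℕ} {M : Type*} [TopologicalSpace M] [ChartedSpace (EuclideanSpace ℝ (Fin n)) M]
  [IsManifold (𝓡 n) ∞ M]

namespace IsMetricOn

variable {g : BilinField n M} {U : Set M} (hg : IsMetricOn g U) {p : M} (hp : p ∈ U)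
include hg hp

lemma isInnerForm_coInner : IsInnerForm (coInner g p) where
  add_left _ _ _ := by simp [coInner, add_mul, Finset.sum_add_distrib]
  smul_left _ _ _ := by simp [coInner, Finset.mul_sum, mul_assoc]
  add_right _ _ _ := by simp [coInner, mul_add, Finset.sum_add_distrib]
  smul_right _ _ _ := by simp [coInner, Finset.mul_sum, mul_left_comm]
  symm _ _ := by simp [coInner, mul_comm]
  eq_zero θ hθ := by
    have h1 : ∀ i, θ (frame g p i) = 0 := fun i => mul_self_eq_zero.1 <|
      (Finset.sum_eq_zero_iff_of_nonneg fun i _ => mul_self_nonneg _).1 hθ i (Finset.mem_univ _)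
    ext v
    rw [← hg.apply_covSharp hp, covSharp]
    simp [h1]

lemma frakW_selfAdjoint (α β : Cotangent n p) :
    coInner g p (frakW g p α) β = coInner g p α (frakW g p β) := by
  rw [(hg.isInnerForm_coInner hp).symm α, hg.coInner_frakW hp, hg.coInner_frakW hp,
    tensorSquare_symm]

lemma apply_fieldT (v : TangentSpace (𝓡 n) p) : g p (fieldT g p) v = fieldTDual g p v :=
  hg.apply_covSharp hp (fieldTDual g p) v

lemma fieldTDual_eq : fieldTDual g p = (1 / ((n : ℝ) - 3)) •
    moorePenrose (coInner g p) (frakW g p) (weylSource g p) := rfl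

/-- The weights of the source and of `𝔴` cancel, and so do `n-3` and its inverse, which leaves `-𝔴^#
𝔴(dφ)`. This is `-dφ` because `dφ` is orthogonal to the kernel of `𝔴`. -/
lemma fieldTDual_conformal (hn : 4 ≤ n) {φ : M → ℝ} (hφ : ContMDiffOn (𝓡 n) 𝓘(ℝ, ℝ) ∞ φ U)
    (hF : ∀ v ∈ weylNull g p, g p (gradient g φ p) v = 0) :
    fieldTDual (conformalChange φ g) p = fieldTDual g p - mvfderiv (𝓡 n) φ p := by
  have hc := (Real.exp_pos (-2 * φ p)).ne'
  have hn3 : (n : ℝ) - 3 ≠ 0 := by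
    have : (4 : ℝ) ≤ n := by exact_mod_cast hn
    linarith
  set α : Cotangent n p := mvfderiv (𝓡 n) φ p with hα
  have h1 : moorePenrose (coInner g p) (frakW g p) (frakW g p α) = α := by
    refine (hg.isInnerForm_coInner hp).moorePenrose_apply_self (hg.frakW_selfAdjoint hp) ?_
    intro w hw
    rw [hg.coInner_eq hp, hα, ← hg.apply_gradient hp]
    exact hF _ ((hg.frakW_eq_zero_iff hp w).1 hw)
  rw [(hg.conformal hφ).fieldTDual_eq hp, hg.fieldTDual_eq hp,
    weylSource_conformal hg hφ hp hn hα, frakW_conformal hg hφ hp hn,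
    (hg.isInnerForm_coInner hp).moorePenrose_smul (hg.frakW_selfAdjoint hp)
      ((hg.conformal hφ).isInnerForm_coInner hp) (pow_ne_zero 2 (inv_ne_zero hc))
      (coInner_conformal hg hφ hp), map_smul, map_sub, map_smul, h1,
    inv_smul_smul₀ (pow_ne_zero 2 (inv_ne_zero hc)), smul_sub, smul_smul, one_div,
    inv_mul_cancel₀ hn3, one_smul]

end IsMetricOn
end FieldT

/-! ### Smooth dependence of the solution of `A A z = A Y` under constant rank -/

section ConstantRank

variable {E : Type*} [NormedAddCommGroup E] [NormedSpace ℝ E] [FiniteDimensional ℝ E]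

lemma finrank_continuousDual : Module.finrank ℝ (E →L[ℝ] ℝ) = Module.finrank ℝ E := by
  rw [← (LinearMap.toContinuousLinearMap (𝕜 := ℝ) (E := E) (F' := ℝ)).finrank_eq]
  exact Subspace.dual_finrank_eq

lemma isInvertible_of_injective {F : Type*} [NormedAddCommGroup F] [NormedSpace ℝ F]
    [FiniteDimensional ℝ F] {T : E →L[ℝ] F} (hT : Function.Injective T)
    (hd : Module.finrank ℝ E = Module.finrank ℝ F) : T.IsInvertible :=
  ⟨(LinearEquiv.ofInjectiveOfFinrankEq T.toLinearMap hT hd).toContinuousLinearEquiv, by ext; rfl⟩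

lemma contDiffAt_inverse_apply {F X : Type*} [NormedAddCommGroup F] [NormedSpace ℝ F]
    [NormedAddCommGroup X] [NormedSpace ℝ X] {T : X → E →L[ℝ] F} {y : X → F} {x : X}
    (hT : ContDiffAt ℝ ∞ T x) (hy : ContDiffAt ℝ ∞ y x) (hinv : (T x).IsInvertible) :
    ContDiffAt ℝ ∞ (fun x => (T x).inverse (y x)) x := by
  obtain ⟨e, he⟩ := hinv
  have := FiniteDimensional.complete ℝ E
  have h1 : ContDiffAt ℝ ∞ (ContinuousLinearMap.inverse (M := E) (M₂ := F) (R := ℝ)) (T x) :=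
    he ▸ contDiffAt_map_inverse e
  exact (h1.comp x hT).clm_apply hy

lemma eventually_isInvertible {F X : Type*} [NormedAddCommGroup F] [NormedSpace ℝ F]
    [TopologicalSpace X] {T : X → E →L[ℝ] F} {x : X}
    (hT : ContinuousAt T x) (hinv : (T x).IsInvertible) : ∀ᶠ y in 𝓝 x, (T y).IsInvertible := by
  obtain ⟨e, he⟩ := hinv
  have := FiniteDimensional.complete ℝ E
  exact hT.eventually (he ▸ e.nhds)

lemma IsFlatMetric.isInnerForm {G : E → E →L[ℝ] E →L[ℝ] ℝ} {O : Set E} (hG : IsFlatMetric G O)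
    {x : E} (hx : x ∈ O) : IsInnerForm fun v w => G x v w where
  add_left _ _ _ := by simp
  smul_left _ _ _ := by simp
  add_right _ _ _ := by simp
  smul_right _ _ _ := by simp
  symm := hG.symm x hx
  eq_zero v hv := by
    by_contra hne
    exact (hG.pos x hx v hne).ne' hv

/-- The solutions in the range of `A` of `A A z = A Y` depend smoothly on the base point where `A`
is self-adjoint of constant rank. -/
lemma IsFlatMetric.contDiffAt_of_const_rank {G : E → E →L[ℝ] E →L[ℝ] ℝ} {O : Set E}
    (hG : IsFlatMetric G O) {x : E} (hx : x ∈ O) {A : E → E →L[ℝ] E} {Y z : E → E}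
    (hA : ContDiffAt ℝ ∞ A x) (hY : ContDiffAt ℝ ∞ Y x)
    (hsymm : ∀ y ∈ O, ∀ v w, G y (A y v) w = G y v (A y w))
    (hrank : ∀ᶠ y in 𝓝 x, Module.finrank ℝ (LinearMap.ker (A y).toLinearMap) =
      Module.finrank ℝ (LinearMap.ker (A x).toLinearMap))
    (hz : ∀ y ∈ O, z y ∈ LinearMap.range (A y).toLinearMap)
    (hzY : ∀ y ∈ O, A y (A y (z y)) = A y (Y y)) : ContDiffAt ℝ ∞ z x := by
  -- Constant rank makes a fixed complement `F` of the kernel at `x` serve for all nearby points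
  -- `y`: `A y` stays injective on `F`, and `F` has the same image as the whole space. The solution
  -- is `A y c` for a `c` in `F` found by inverting a smooth family of maps.
  obtain ⟨F, hF⟩ := (LinearMap.ker (A x).toLinearMap).exists_isCompl
  set B : E → F →L[ℝ] E := fun y => (A y).comp F.subtypeL with hB
  have hBs : ContDiffAt ℝ ∞ B x := hA.clm_comp contDiffAt_const
  set T : E → (E →L[ℝ] ℝ) →L[ℝ] (F →L[ℝ] ℝ) := fun y =>
    (ContinuousLinearMap.compL ℝ F E ℝ).flip (B y) with hTdef
  have hTs : ContDiffAt ℝ ∞ T x := (ContinuousLinearMap.contDiff _).contDiffAt.comp x hBs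
  -- As `N c d = G(A A c, A d)`, the equation `N c = ℓ` below is `A A A c = A Y` in weak form,
  -- tested on `F` only.
  set N : E → F →L[ℝ] (F →L[ℝ] ℝ) := fun y => (T y).comp ((G y).comp ((A y).comp (B y))) with hN
  have hNs : ContDiffAt ℝ ∞ N x := hTs.clm_comp ((hG.smooth x hx).clm_comp (hA.clm_comp hBs))
  have hNapp : ∀ y c d, N y c d = G y (A y (A y c)) (A y d) := fun y c d => rfl
  have hBinj : Function.Injective (B x) := by
    rw [injective_iff_map_eq_zero]
    intro c hc
    have h1 : (c : E) ∈ LinearMap.ker (A x).toLinearMap ⊓ F := ⟨hc, c.2⟩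
    rw [hF.inf_eq_bot, Submodule.mem_bot] at h1
    exact Subtype.ext h1
  have hrange : ∀ y, Module.finrank ℝ (LinearMap.ker (A y).toLinearMap) =
      Module.finrank ℝ (LinearMap.ker (A x).toLinearMap) → Function.Injective (B y) →
      ∀ w, ∃ c : F, A y c = A y w := by
    intro y hy hi w
    have h1 := (A y).toLinearMap.finrank_range_add_finrank_ker
    have h2 := Submodule.finrank_add_eq_of_isCompl hF
    have h3 : Module.finrank ℝ (LinearMap.range (B y).toLinearMap) = Module.finrank ℝ F :=
      LinearMap.finrank_range_of_inj hi
    have h4 : LinearMap.range (B y).toLinearMap ≤ LinearMap.range (A y).toLinearMap := by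
      rintro _ ⟨c, rfl⟩
      exact ⟨c, rfl⟩
    have h5 := Submodule.eq_of_le_of_finrank_eq h4 (by omega)
    have h6 : A y w ∈ LinearMap.range (B y).toLinearMap := by
      rw [h5]
      exact ⟨w, rfl⟩
    obtain ⟨c, hc⟩ := h6
    exact ⟨c, hc⟩
  have hNinj : Function.Injective (N x) := by
    rw [injective_iff_map_eq_zero]
    intro c hc
    have hI := hG.isInnerForm hx
    obtain ⟨d, hd⟩ := hrange x rfl hBinj (A x c)
    have h1 : N x c d = 0 := by rw [hc, zero_apply]
    rw [hNapp, hd] at h1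
    have h2 := hI.apply_eq_zero (A := (A x).toLinearMap) (hsymm x hx) (hI.eq_zero _ h1)
    -- The choice of `d` with `A d = A A c` has turned `N c = 0` into `G(A A c, A A c) = 0`, and
    -- self-adjointness gives `A c = 0`.
    exact hBinj (h2.trans (map_zero (B x)).symm)
  have hNinv : (N x).IsInvertible := isInvertible_of_injective hNinj finrank_continuousDual.symm
  set ℓ : E → F →L[ℝ] ℝ := fun y => T y (G y (Y y)) with hℓ
  have hℓs : ContDiffAt ℝ ∞ ℓ x := hTs.clm_apply ((hG.smooth x hx).clm_apply hY)
  have hc := contDiffAt_inverse_apply hNs hℓs hNinv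
  refine (hBs.clm_apply hc).congr_of_eventuallyEq ?_
  filter_upwards [hrank, eventually_isInvertible hNs.continuousAt hNinv, hG.mem_nhds hx] with
    y hy hinv hyO
  have hI := hG.isInnerForm hyO
  have hsy := hsymm y hyO
  obtain ⟨w, hw⟩ := hz y hyO
  set c := (N y).inverse (ℓ y) with hcdef
  have hNc : N y c = ℓ y := congrArg (fun L => L (ℓ y)) hinv.self_comp_inverse
  have hBy : Function.Injective (B y) := by
    rw [injective_iff_map_eq_zero]
    intro d hd
    have h1 : N y d = 0 := by
      ext d'
      have h2 : A y d = 0 := hd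
      rw [hNapp, h2, map_zero, map_zero]
      rfl
    obtain ⟨e, he⟩ := hinv
    rw [← he] at h1
    exact (map_eq_zero_iff e e.injective).1 h1
  have h1 : A y (A y (A y c)) = A y (Y y) := by
    refine hI.ext fun v => ?_
    obtain ⟨d, hd⟩ := hrange y hy hBy v
    rw [hsy _ v, hsy (Y y) v, ← hd, ← hNapp, hNc]
    rfl
  have h2 : A y w = z y := hw
  -- Here `z = A w`. Self-adjointness strips two factors of `A`, so that `A w = A c`.
  have h3 : A y (A y (A y (w - c))) = 0 := by
    rw [map_sub, map_sub, map_sub, h1, h2, hzY y hyO, sub_self]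
  have h4 := hI.apply_eq_zero (A := (A y).toLinearMap) hsy (v := w - c)
    (hI.apply_eq_zero (A := (A y).toLinearMap) hsy h3)
  have h5 : A y (w - c) = 0 := h4
  rw [map_sub, sub_eq_zero] at h5
  rw [← h2, h5]
  rfl

end ConstantRank

/-! ### Smoothness of `𝕋` on the regular set -/

section FieldSmooth

variable {n : ℕ} {M : Type*} [TopologicalSpace M] [ChartedSpace (EuclideanSpace ℝ (Fin n)) M]
  [IsManifold (𝓡 n) ∞ M]

/-- The vector `g`-dual to the `k`-th coordinate, in coordinates. -/
abbrev dualVec (p₀ : M) (g : BilinField n M) (x : EuclideanSpace ℝ (Fin n)) (k : Fin n) :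
    EuclideanSpace ℝ (Fin n) := sharp (pullMetric p₀ g) x (stdCoord k)

/-- The bilinear form `𝔴` in coordinates. -/
def pullFrakW (p₀ : M) (g : BilinField n M) (x : EuclideanSpace ℝ (Fin n)) :
    EuclideanSpace ℝ (Fin n) →L[ℝ] EuclideanSpace ℝ (Fin n) →L[ℝ] ℝ :=
  (1 / 2 : ℝ) • ∑ i, ∑ j, ∑ k,
    (pullWeyl p₀ g x (dualVec p₀ g x i) (dualVec p₀ g x j) (dualVec p₀ g x k)).smulRight
      (pullWeyl p₀ g x (stdVec i) (stdVec j) (stdVec k))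

/-- The endomorphism `𝔴` of the tangent spaces in coordinates. -/
def pullFrakEndo (p₀ : M) (g : BilinField n M) (x : EuclideanSpace ℝ (Fin n)) :
    EuclideanSpace ℝ (Fin n) →L[ℝ] EuclideanSpace ℝ (Fin n) :=
  (sharp (pullMetric p₀ g) x).comp (pullFrakW p₀ g x)

/-- The vector dual to a covector at a point of the chart domain, in coordinates. -/
def pullVec (p₀ : M) (g : BilinField n M) (x : EuclideanSpace ℝ (Fin n))
    (θ : Cotangent n (chartInv p₀ x)) : EuclideanSpace ℝ (Fin n) :=
  (chartD p₀ x).inverse (covSharp g (chartInv p₀ x) θ)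

/-- The source term of `𝕋` in coordinates. -/
def pullSource (p₀ : M) (g : BilinField n M) (x : EuclideanSpace ℝ (Fin n)) :
    EuclideanSpace ℝ (Fin n) →L[ℝ] ℝ :=
  ∑ l, (∑ i, ∑ j, ∑ k, (∑ m, pullNablaWeyl p₀ g x (dualVec p₀ g x m) (dualVec p₀ g x j)
    (dualVec p₀ g x k) (dualVec p₀ g x i) (stdVec m)) *
      pullWeyl p₀ g x (stdVec k) (stdVec i) (stdVec l) (stdVec j)) • stdCoord l

namespace IsMetricOn

variable {g : BilinField n M} {U : Set M} (hg : IsMetricOn g U)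
  {p₀ : M} {x : EuclideanSpace ℝ (Fin n)} (hx : x ∈ chartDom p₀ ∩ chartInv p₀ ⁻¹' U)
include hg hx

lemma triple_contraction_chart {e : Fin n → TangentSpace (𝓡 n) (chartInv p₀ x)}
    (he : IsFrame (fun v w => g (chartInv p₀ x) v w) e)
    {Q : TangentSpace (𝓡 n) (chartInv p₀ x) → TangentSpace (𝓡 n) (chartInv p₀ x) →
      TangentSpace (𝓡 n) (chartInv p₀ x) → TangentSpace (𝓡 n) (chartInv p₀ x) →
      TangentSpace (𝓡 n) (chartInv p₀ x) → TangentSpace (𝓡 n) (chartInv p₀ x) → ℝ}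
    (hQ : IsTriBilin Q) :
    ∑ i, ∑ j, ∑ k, Q (e i) (e i) (e j) (e j) (e k) (e k) =
      ∑ i, ∑ j, ∑ k, Q (chartD p₀ x (dualVec p₀ g x i)) (chartD p₀ x (stdVec i))
        (chartD p₀ x (dualVec p₀ g x j)) (chartD p₀ x (stdVec j))
        (chartD p₀ x (dualVec p₀ g x k)) (chartD p₀ x (stdVec k)) := by
  have h1 : ∀ a a' b b', ∑ k, Q a a' b b' (e k) (e k) = ∑ k, Q a a' b b'
      (chartD p₀ x (dualVec p₀ g x k)) (chartD p₀ x (stdVec k)) := fun a a' b b' =>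
    hg.contraction_chart hx he (hQ.trd _ _ _ _)
  have h2 : ∀ a a' c c', ∑ k, Q a a' (e k) (e k) c c' = ∑ k, Q a a'
      (chartD p₀ x (dualVec p₀ g x k)) (chartD p₀ x (stdVec k)) c c' := fun a a' b b' =>
    hg.contraction_chart hx he (hQ.snd _ _ _ _)
  have h3 : ∀ b b' c c', ∑ k, Q (e k) (e k) b b' c c' = ∑ k, Q
      (chartD p₀ x (dualVec p₀ g x k)) (chartD p₀ x (stdVec k)) b b' c c' := fun a a' b b' =>
    hg.contraction_chart hx he (hQ.fst _ _ _ _)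
  have h4 : ∀ a a', ∑ j, ∑ k, Q a a' (e j) (e j) (e k) (e k) = ∑ j, ∑ k, Q a a'
      (chartD p₀ x (dualVec p₀ g x j)) (chartD p₀ x (stdVec j))
      (chartD p₀ x (dualVec p₀ g x k)) (chartD p₀ x (stdVec k)) := by
    intro a a'
    simp only [h1]
    rw [Finset.sum_comm]
    simp only [h2]
    exact Finset.sum_comm
  simp only [h4]
  rw [Finset.sum_comm]
  conv_rhs => rw [Finset.sum_comm]
  refine Finset.sum_congr rfl fun j _ => ?_
  rw [Finset.sum_comm]
  conv_rhs => rw [Finset.sum_comm]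
  exact Finset.sum_congr rfl fun k _ => h3 _ _ _ _

lemma pullFrakW_apply (u v : EuclideanSpace ℝ (Fin n)) :
    pullFrakW p₀ g x u v = 1 / 2 * tensorSquare (frame g (chartInv p₀ x))
      (weyl g (chartInv p₀ x)) (chartD p₀ x u) (chartD p₀ x v) := by
  have hW := (hg.isCurvLike_weyl hx.2).multilin
  rw [tensorSquare, hg.triple_contraction_chart hx (hg.isFrame hx.2)
    (.mul (hW.fix_fourth (chartD p₀ x u)) (hW.fix_fourth (chartD p₀ x v)))]
  simp only [pullFrakW, smul_apply, sum_apply, ContinuousLinearMap.smulRight_apply, smul_eq_mul,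
    hg.pullWeyl_apply hx]

lemma apply_pullFrakEndo (u v : EuclideanSpace ℝ (Fin n)) :
    pullMetric p₀ g x (pullFrakEndo p₀ g x u) v = pullFrakW p₀ g x u v :=
  congrArg (fun L => L v) ((hg.isFlatMetric p₀).apply_sharp hx (pullFrakW p₀ g x u))

lemma pullFrakEndo_symm (u v : EuclideanSpace ℝ (Fin n)) :
    pullMetric p₀ g x (pullFrakEndo p₀ g x u) v = pullMetric p₀ g x u (pullFrakEndo p₀ g x v) := by
  rw [(hg.isFlatMetric p₀).symm x hx u, hg.apply_pullFrakEndo hx, hg.apply_pullFrakEndo hx,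
    hg.pullFrakW_apply hx, hg.pullFrakW_apply hx, tensorSquare_symm]

lemma apply_pullVec (θ : Cotangent n (chartInv p₀ x)) (u : EuclideanSpace ℝ (Fin n)) :
    pullMetric p₀ g x (pullVec p₀ g x θ) u = θ (chartD p₀ x u) := by
  rw [pullMetric_apply, pullVec, chartD_inverse' hx.1, hg.apply_covSharp hx.2]

lemma chartD_pullVec (θ : Cotangent n (chartInv p₀ x)) :
    chartD p₀ x (pullVec p₀ g x θ) = covSharp g (chartInv p₀ x) θ := by
  rw [pullVec, chartD_inverse' hx.1]

lemma pullFrakEndo_pullVec (θ : Cotangent n (chartInv p₀ x)) :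
    pullFrakEndo p₀ g x (pullVec p₀ g x θ) =
      pullVec p₀ g x (frakW g (chartInv p₀ x) θ) := by
  refine ((hg.isFlatMetric p₀).isInnerForm hx).ext fun u => ?_
  rw [hg.apply_pullFrakEndo hx, hg.apply_pullVec hx, hg.frakW_apply hx.2, hg.pullFrakW_apply hx,
    hg.chartD_pullVec hx]

lemma pullVec_fieldTDual : pullField p₀ (fieldT g) x = (1 / ((n : ℝ) - 3)) • pullVec p₀ g x
    (moorePenrose (coInner g (chartInv p₀ x)) (frakW g (chartInv p₀ x))
      (weylSource g (chartInv p₀ x))) := by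
  refine ((hg.isFlatMetric p₀).isInnerForm hx).ext fun u => ?_
  rw [map_smul, smul_apply, hg.apply_pullVec hx, pullMetric_apply, chartD_pullField hx.1,
    hg.apply_fieldT hx.2, hg.fieldTDual_eq hx.2, smul_apply]

lemma pullSource_apply (u : EuclideanSpace ℝ (Fin n)) :
    pullSource p₀ g x u = weylSource g (chartInv p₀ x) (chartD p₀ x u) := by
  have h0 : ∀ u v w, divWeyl g (chartInv p₀ x) (chartD p₀ x u) (chartD p₀ x v) (chartD p₀ x w) =
      ∑ m, pullNablaWeyl p₀ g x (dualVec p₀ g x m) u v w (stdVec m) := by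
    intro u v w
    rw [divWeyl, hg.contraction_chart hx (hg.isFrame hx.2) (isBilin_nablaWeyl_chart hg hx _ _ _)]
    simp only [hg.nablaWeyl_eq hx]
  have h1 : ∀ l, weylSource g (chartInv p₀ x) (chartD p₀ x (stdVec l)) =
      ∑ i, ∑ j, ∑ k, (∑ m, pullNablaWeyl p₀ g x (dualVec p₀ g x m) (dualVec p₀ g x j)
    (dualVec p₀ g x k) (dualVec p₀ g x i) (stdVec m)) *
      pullWeyl p₀ g x (stdVec k) (stdVec i) (stdVec l) (stdVec j) := by
    intro l
    rw [hg.weylSource_apply hx.2, hg.triple_contraction_chart hx (hg.isFrame hx.2)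
      (.mul (hg.isMultilin_divWeyl hx.2) ((hg.isCurvLike_weyl hx.2).multilin.fix_third_perm
        (chartD p₀ x (stdVec l))))]
    simp only [h0, hg.pullWeyl_apply hx]
  conv_rhs => rw [← sum_stdVec u, map_sum, map_sum]
  simp only [map_smul, h1, pullSource, sum_apply, smul_apply, smul_eq_mul, PiLp.proj_apply]
  exact Finset.sum_congr rfl fun _ _ => mul_comm _ _

lemma pullVec_weylSource : pullVec p₀ g x (weylSource g (chartInv p₀ x)) =
    sharp (pullMetric p₀ g) x (pullSource p₀ g x) := by
  refine ((hg.isFlatMetric p₀).isInnerForm hx).ext fun u => ?_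
  rw [hg.apply_pullVec hx, (hg.isFlatMetric p₀).apply_sharp hx, hg.pullSource_apply hx]

lemma smooth_dualVec (k : Fin n) : ContDiffAt ℝ ∞ (fun y => dualVec p₀ g y k) x :=
  (hg.smooth_sharp hx).clm_apply contDiffAt_const

lemma smooth_pullSource : ContDiffAt ℝ ∞ (pullSource p₀ g) x := by
  have hW := hg.smooth_pullWeyl hx
  have hd := hg.smooth_dualVec hx
  have hc : ∀ a : EuclideanSpace ℝ (Fin n), ContDiffAt ℝ ∞ (fun _ => a) x :=
    fun a => contDiffAt_const
  refine ContDiffAt.sum fun l _ => ContDiffAt.fun_smul ?_ contDiffAt_const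
  refine .sum fun i _ => .sum fun j _ => .sum fun k _ => ContDiffAt.mul (.sum fun m _ => ?_) ?_
  · exact hg.smooth_pullNablaWeyl hx (hd m) (hd j) (hd k) (hd i) (hc _)
  · exact (((hW.clm_apply (hc _)).clm_apply (hc _)).clm_apply (hc _)).clm_apply (hc _)

lemma smooth_pullFrakEndo : ContDiffAt ℝ ∞ (pullFrakEndo p₀ g) x := by
  have hW := hg.smooth_pullWeyl hx
  have hd := hg.smooth_dualVec hx
  have hc : ∀ a : EuclideanSpace ℝ (Fin n), ContDiffAt ℝ ∞ (fun _ => a) x :=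
    fun a => contDiffAt_const
  refine (hg.smooth_sharp hx).clm_comp (ContDiffAt.const_smul _ (.sum fun i _ => .sum fun j _ =>
    .sum fun k _ => ContDiffAt.smulRight ?_ ?_))
  · exact (((hW.clm_apply (hd _)).clm_apply (hd _)).clm_apply (hd _))
  · exact (((hW.clm_apply (hc _)).clm_apply (hc _)).clm_apply (hc _))

/-- The kernel of the coordinate endomorphism corresponds to `𝓔` under the chart, so local constancy
of `rankE` is the constant-rank hypothesis of `contDiffAt_of_const_rank`. -/
lemma finrank_ker_pullFrakEndo :
    Module.finrank ℝ (LinearMap.ker (pullFrakEndo p₀ g x).toLinearMap) =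
      rankE g (chartInv p₀ x) := by
  have hW := hg.isCurvLike_weyl hx.2
  have h0 : ∀ u, pullFrakEndo p₀ g x u = 0 ↔ chartD p₀ x u ∈ weylNull g (chartInv p₀ x) := by
    intro u
    rw [hg.weylNull_iff hx.2]
    constructor
    · intro h
      have h1 := hg.apply_pullFrakEndo hx u u
      rw [h, map_zero, zero_apply, hg.pullFrakW_apply hx] at h1
      exact (hg.isFrame hx.2).eq_zero_of_tensorSquare hW (by linarith)
    · intro h
      have h1 : ∀ a b c, weyl g (chartInv p₀ x) a b c (chartD p₀ x u) = 0 := fun a b c => by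
        rw [hW.pair_symm, hW.swap_left, h, neg_zero]
      refine ((hg.isFlatMetric p₀).isInnerForm hx).ext fun v => ?_
      rw [hg.apply_pullFrakEndo hx, hg.pullFrakW_apply hx, map_zero, zero_apply]
      simp [tensorSquare, h1]
  let e : EuclideanSpace ℝ (Fin n) ≃ₗ[ℝ] TangentSpace (𝓡 n) (chartInv p₀ x) :=
    LinearEquiv.ofBijective (chartD p₀ x).toLinearMap
      ⟨fun _ _ h => chartD_injective hx.1 h, chartD_surjective hx.1⟩
  have h1 : weylNull g (chartInv p₀ x) =
      (LinearMap.ker (pullFrakEndo p₀ g x).toLinearMap).map e.toLinearMap := by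
    ext v
    obtain ⟨u, rfl⟩ := chartD_surjective hx.1 v
    rw [← h0]
    constructor
    · exact fun h => ⟨u, h, rfl⟩
    · rintro ⟨w, hw, hwu⟩
      have : w = u := chartD_injective hx.1 hwu
      exact this ▸ hw
  rw [rankE, h1]
  exact (LinearEquiv.finrank_map_eq e _).symm

lemma smoothFieldAt_fieldT (hp : chartInv p₀ x ∈ regularSet g) :
    SmoothFieldAt (fieldT g) (chartInv p₀ x) := by
  rw [smoothFieldAt_iff hx.1]
  refine (ContDiffAt.const_smul (1 / ((n : ℝ) - 3)) ?_).congr_of_eventuallyEq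
    (hg.eventuallyEq_of_chart hx fun y hy => hg.pullVec_fieldTDual hy)
  refine (hg.isFlatMetric p₀).contDiffAt_of_const_rank hx (hg.smooth_pullFrakEndo hx)
    (Y := fun y => sharp (pullMetric p₀ g) y (pullSource p₀ g y))
    ((hg.smooth_sharp hx).clm_apply (hg.smooth_pullSource hx))
    (fun y hy => hg.pullFrakEndo_symm hy) ?_ ?_ ?_
  · filter_upwards [eventually_pull hx.1 hp, hg.eventually_mem hx] with y hy hyU
    rw [hg.finrank_ker_pullFrakEndo hyU, hg.finrank_ker_pullFrakEndo hx, hy]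
  · intro y hy
    obtain ⟨w, hw⟩ := (hg.isInnerForm_coInner hy.2).moorePenrose_apply_mem
      (hg.frakW_selfAdjoint hy.2) (weylSource g (chartInv p₀ y))
    refine ⟨pullVec p₀ g y w, ?_⟩
    rw [← hw]
    exact hg.pullFrakEndo_pullVec hy w
  · intro y hy
    rw [← hg.pullVec_weylSource hy, hg.pullFrakEndo_pullVec hy, hg.pullFrakEndo_pullVec hy,
      hg.pullFrakEndo_pullVec hy, (hg.isInnerForm_coInner hy.2).apply_apply_moorePenrose
        (hg.frakW_selfAdjoint hy.2)]

end IsMetricOn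
end FieldSmooth

/-! ### Covariant derivative of the shifted one-form `t* - dφ` -/

section FlatCovector

variable {E : Type*} [NormedAddCommGroup E] [NormedSpace ℝ E] [FiniteDimensional ℝ E]
  {G : E → E →L[ℝ] E →L[ℝ] ℝ} {O : Set E} (hG : IsFlatMetric G O) {x : E} (hx : x ∈ O)
include hG hx

lemma IsFlatMetric.apply_flatNabla {t : E → E} (ht : ContDiffAt ℝ ∞ t x) (u w : E) :
    G x (flatNabla G x u t) w =
      fderiv ℝ (fun y => G y (t y)) x u w - G x (t x) (christoffel G x u w) := by
  have h := (hG.hasFDerivAt hx).clm_apply (ContDiffAt.hasFDerivAt_top ht)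
  rw [h.fderiv]
  simp only [add_apply, ContinuousLinearMap.flip_apply, ContinuousLinearMap.comp_apply,
    hG.fderiv_apply hx, flatNabla, map_add]
  ring

/-- The Hessian from differentiating `-dφ`, the change of connection, and the cross terms of the
square assemble to `-flatSchoutenChange` and a multiple of `G`. The law for `t'` has to hold near
`x` because it is differentiated. -/
lemma IsFlatMetric.apply_flatNabla_flatConformal {φ : E → ℝ}
    (hφ : ∀ x ∈ O, ContDiffAt ℝ ∞ φ x) {t t' : E → E} (ht : ContDiffAt ℝ ∞ t x)
    (ht' : ContDiffAt ℝ ∞ t' x)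
    (h : (fun y => ConformalRicci.flatConformal φ G y (t' y)) =ᶠ[𝓝 x]
      fun y => G y (t y) - fderiv ℝ φ y) (u w : E) :
    ConformalRicci.flatConformal φ G x
        (flatNabla (ConformalRicci.flatConformal φ G) x u t') w +
      ConformalRicci.flatConformal φ G x (t' x) u * ConformalRicci.flatConformal φ G x (t' x) w =
    G x (flatNabla G x u t) w + G x (t x) u * G x (t x) w - flatSchoutenChange G φ x u w +
      (1 / 2 * fderiv ℝ φ x (sharp G x (fderiv ℝ φ x)) -
        G x (t x) (sharp G x (fderiv ℝ φ x))) * G x u w := by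
  have hG' := hG.flatConformal hφ
  have h0 := h.eq_of_nhds
  have h1 := h.fderiv_eq (𝕜 := ℝ)
  have h2 : HasFDerivAt (fun y => G y (t y)) _ x :=
    (hG.hasFDerivAt hx).clm_apply (ContDiffAt.hasFDerivAt_top ht)
  have h3 : HasFDerivAt (fun y => G y (t y) - fderiv ℝ φ y) _ x :=
    HasFDerivAt.fun_sub h2 (hasFDerivAt_fderiv (hφ x hx))
  have h4 : fderiv ℝ (fun y => G y (t y) - fderiv ℝ φ y) x u w =
      fderiv ℝ (fun y => G y (t y)) x u w - fderiv ℝ (fderiv ℝ φ) x u w := by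
    rw [h3.fderiv, h2.fderiv]
    rfl
  rw [hG'.apply_flatNabla hx ht', hG.apply_flatNabla hx ht, h1, h0,
    hG.christoffel_flatConformal hx hφ, h4]
  simp only [flatDiff, flatSchoutenChange, flatHess, sub_apply, map_add, map_sub, map_smul,
    smul_eq_mul]
  ring

end FlatCovector

/-! ### Invariance of the conformal Ricci tensor under the shift by `-dφ` -/

section ConfRicci

variable {n : ℕ} {M : Type*} [TopologicalSpace M] [ChartedSpace (EuclideanSpace ℝ (Fin n)) M]
  [IsManifold (𝓡 n) ∞ M]

/-- The tensor whose trace-free part is the conformal Ricci tensor. -/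
def preConfRicci (g : BilinField n M) (V : VField n M) (p : M) (x y : TangentSpace (𝓡 n) p) : ℝ :=
  ric g p x y + ((n : ℝ) - 2) * (g p (nabla g p x V) y + g p (V p) x * g p (V p) y)

namespace IsMetricOn

variable {g : BilinField n M} {U : Set M} (hg : IsMetricOn g U)
include hg

lemma isBilin_preConfRicci {p : M} (hp : p ∈ U) {V : VField n M} (hV : SmoothFieldAt V p) :
    IsBilin (preConfRicci g V p) := by
  have h := hg.isBilin_ric hp
  have h1 : ∃ N : TangentSpace (𝓡 n) p →ₗ[ℝ] TangentSpace (𝓡 n) p, ∀ u, nabla g p u V = N u := by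
    obtain ⟨p₀, x, hx, rfl⟩ := exists_chart (n := n) p
    have h2 : ∀ u, nabla g (chartInv p₀ x) u V = chartD p₀ x (flatNabla (pullMetric p₀ g) x
        ((chartD p₀ x).inverse u) (pullField p₀ V)) := fun u => by
      rw [← hg.nabla_eq ⟨hx, hp⟩ hV, chartD_inverse' hx]
    refine ⟨⟨⟨fun u => nabla g _ u V, fun u v => ?_⟩, fun a u => ?_⟩, fun u => rfl⟩
    · simp only [h2, flatNabla, map_add, add_apply]
      abel
    · simp only [h2, flatNabla, map_smul, map_add, smul_apply, RingHom.id_apply, smul_add]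
  obtain ⟨N, hN⟩ := h1
  constructor <;> intros <;>
    simp only [preConfRicci, h.add_left, h.add_right, h.smul_left, h.smul_right, hN, map_add,
      map_smul, add_apply, smul_apply, smul_eq_mul] <;> ring

lemma confRicci_eq {p : M} (hp : p ∈ U) (V : VField n M) (x y : TangentSpace (𝓡 n) p) :
    confRicci g V p x y = preConfRicci g V p x y -
      1 / (n : ℝ) * (∑ i, preConfRicci g V p (frame g p i) (frame g p i)) * g p x y := by
  have h1 : ∑ i, g p (V p) (frame g p i) * g p (V p) (frame g p i) = g p (V p) (V p) := by
    have := (hg.isFrame hp).linear_expand (g p (V p)).toLinearMap (V p)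
    simp only [hg.symm p hp (frame g p _) (V p)] at this
    exact this
  simp only [preConfRicci, Finset.sum_add_distrib, ← Finset.mul_sum, h1]
  rw [← scal, ← divergence, confRicci]
  ring

lemma confRicci_conformal (hn : 4 ≤ n) {φ : M → ℝ} (hφ : ContMDiffOn (𝓡 n) 𝓘(ℝ, ℝ) ∞ φ U)
    {p : M} (hp : p ∈ U) {V V' : VField n M} (hV : SmoothFieldAt V p) (hV' : SmoothFieldAt V' p)
    (h : ∀ᶠ q in 𝓝 p, ∀ w, conformalChange φ g q (V' q) w =
      g q (V q) w - mvfderiv (𝓡 n) φ q w) (u w : TangentSpace (𝓡 n) p) :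
    confRicci (conformalChange φ g) V' p u w = confRicci g V p u w := by
  have hc := (Real.exp_pos (-2 * φ p)).ne'
  have hn0 : (n : ℝ) ≠ 0 := by
    have : n ≠ 0 := by omega
    exact_mod_cast this
  -- The Ricci tensor gains `(n-2) P + (tr P) g` and the second summand gains `n-2` times `-P` plus
  -- a multiple of `g`, where `P` is the change of the Schouten tensor; only a multiple of `g`
  -- survives.
  have hQ : ∃ κ : ℝ, ∀ u w, preConfRicci (conformalChange φ g) V' p u w =
      preConfRicci g V p u w + κ * g p u w := by
    obtain ⟨p₀, x, hx0, rfl⟩ := exists_chart (n := n) p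
    have hx : x ∈ chartDom p₀ ∩ chartInv p₀ ⁻¹' U := ⟨hx0, hp⟩
    have h1 : (fun y => flatConformal (fun y => φ (chartInv p₀ y)) (pullMetric p₀ g) y
        (pullField p₀ V' y)) =ᶠ[𝓝 x] fun y => pullMetric p₀ g y (pullField p₀ V y) -
          fderiv ℝ (fun y => φ (chartInv p₀ y)) y := by
      filter_upwards [eventually_pull hx0 h, hg.eventually_mem hx] with y hy hyU
      ext w
      have := hy (chartD p₀ y w)
      rw [mvfderiv_chart hg hφ hyU] at this
      rw [← pullMetric_conformalChange, sub_apply, pullMetric_apply, pullMetric_apply,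
        chartD_pullField hyU.1, chartD_pullField hyU.1, this]
    have h2 := (hg.isFlatMetric p₀).apply_flatNabla_flatConformal hx
      (fun y hy => smooth_pull_function hg hφ hy) ((smoothFieldAt_iff hx0).1 hV)
      ((smoothFieldAt_iff hx0).1 hV') h1
    rw [← pullMetric_conformalChange] at h2
    refine ⟨∑ i, schoutenChange g φ p₀ x (frame g _ i) (frame g _ i) + ((n : ℝ) - 2) *
      (1 / 2 * fderiv ℝ (fun y => φ (chartInv p₀ y)) x (sharp (pullMetric p₀ g) x
        (fderiv ℝ (fun y => φ (chartInv p₀ y)) x)) - pullMetric p₀ g x (pullField p₀ V x)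
          (sharp (pullMetric p₀ g) x (fderiv ℝ (fun y => φ (chartInv p₀ y)) x))), fun u w => ?_⟩
    obtain ⟨u, rfl⟩ := chartD_surjective hx0 u
    obtain ⟨w, rfl⟩ := chartD_surjective hx0 w
    have h3 := h2 u w
    simp only [pullMetric_apply, chartD_pullField hx0, ← hg.nabla_eq hx hV,
      ← (hg.conformal hφ).nabla_eq hx hV'] at h3
    rw [preConfRicci, preConfRicci, ric_conformal hg hφ hx, h3, schoutenChange,
      chartD_inverse hx0, chartD_inverse hx0]
    simp only [pullMetric_apply, chartD_pullField hx0]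
    ring
  obtain ⟨κ, hκ⟩ := hQ
  -- Taking trace-free parts removes `κ g`; the weights of the new trace and of the new metric are
  -- inverse to each other.
  rw [(hg.conformal hφ).confRicci_eq hp, hg.confRicci_eq hp,
    (hg.isFrame hp).contraction ((hg.conformal hφ).isFrame hp) hc (fun _ _ => rfl)
      ((hg.conformal hφ).isBilin_preConfRicci hp hV')]
  have h5 : conformalChange φ g p u w = Real.exp (-2 * φ p) * g p u w := rfl
  simp only [hκ, Finset.sum_add_distrib, ← Finset.mul_sum]
  rw [(hg.isFrame hp).trace_self, h5]
  field_simp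
  ring

end IsMetricOn
end ConfRicci

/-! ### Coordinate smoothness of a bundled Riemannian metric -/

section MetricSmooth

variable {n : ℕ} {M : Type*} [TopologicalSpace M] [ChartedSpace (EuclideanSpace ℝ (Fin n)) M]
  [IsManifold (𝓡 n) ∞ M]

/-- The vector field with constant coordinates `u` in the preferred chart at `p₀`. -/
def coordField (p₀ : M) (u : EuclideanSpace ℝ (Fin n)) : VField n M := fun q =>
  (mfderiv (𝓡 n) 𝓘(ℝ, EuclideanSpace ℝ (Fin n)) (extChartAt (𝓡 n) p₀) q).inverse u

lemma coordField_chartInv {p₀ : M} {x : EuclideanSpace ℝ (Fin n)} (hx : x ∈ chartDom p₀)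
    (u : EuclideanSpace ℝ (Fin n)) : coordField p₀ u (chartInv p₀ x) = chartD p₀ x u := by
  have h4 := mfderiv_extChartAt_comp_mfderivWithin_extChartAt_symm (I := 𝓡 n) (x := p₀) hx
  rw [ModelWithCorners.range_eq_univ, mfderivWithin_univ] at h4
  have h6 : (mfderiv (𝓡 n) 𝓘(ℝ, EuclideanSpace ℝ (Fin n)) (extChartAt (𝓡 n) p₀)
    (chartInv p₀ x)) (chartD p₀ x u) = u := congrArg (fun L => L u) h4
  have h7 : (mfderiv (𝓡 n) 𝓘(ℝ, EuclideanSpace ℝ (Fin n)) (extChartAt (𝓡 n) p₀)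
    (chartInv p₀ x)).IsInvertible := isInvertible_mfderiv_extChartAt (chartInv_mem_source hx)
  have h8 : (mfderiv (𝓡 n) 𝓘(ℝ, EuclideanSpace ℝ (Fin n)) (extChartAt (𝓡 n) p₀)
    (chartInv p₀ x)).inverse ((mfderiv (𝓡 n) 𝓘(ℝ, EuclideanSpace ℝ (Fin n)) (extChartAt (𝓡 n) p₀)
    (chartInv p₀ x)) (chartD p₀ x u)) = chartD p₀ x u :=
    congrArg (fun L => L (chartD p₀ x u)) h7.inverse_comp_self
  rw [h6] at h8
  exact h8

lemma smoothFieldAt_coordField {p₀ : M} {x : EuclideanSpace ℝ (Fin n)} (hx : x ∈ chartDom p₀)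
    (u : EuclideanSpace ℝ (Fin n)) : SmoothFieldAt (coordField p₀ u) (chartInv p₀ x) := by
  rw [smoothFieldAt_iff hx]
  refine (contDiffAt_const (c := u)).congr_of_eventuallyEq ?_
  filter_upwards [(isOpen_chartDom p₀).mem_nhds hx] with y hy
  rw [pullField, coordField_chartInv hy, chartD_inverse hy]

lemma bilin_eq_sum (B : EuclideanSpace ℝ (Fin n) →L[ℝ] EuclideanSpace ℝ (Fin n) →L[ℝ] ℝ) :
    B = ∑ i, ∑ j, B (stdVec i) (stdVec j) •
      (stdCoord i).smulRight (stdCoord j) := by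
  ext u v
  conv_lhs => rw [← sum_stdVec u, ← sum_stdVec v]
  simp only [map_sum, map_smul, sum_apply, smul_apply, ContinuousLinearMap.smulRight_apply,
    smul_eq_mul, PiLp.proj_apply, Finset.mul_sum]
  rw [Finset.sum_comm]
  refine Finset.sum_congr rfl fun i _ => Finset.sum_congr rfl fun j _ => ?_
  ring

/-- The section is paired with coordinate vector fields, and these pairings are the matrix entries
of `pullMetric`. -/
lemma isMetricOn_of_contMDiff
    (G : Bundle.ContMDiffRiemannianMetric (𝓡 n) ∞ (EuclideanSpace ℝ (Fin n))
      (TangentSpace (𝓡 n) : M → Type _)) {U : Set M} (hU : IsOpen U) :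
    IsMetricOn (fun p => G.inner p : BilinField n M) U where
  isOpen := hU
  symm p _ := G.symm p
  pos p _ := G.pos p
  smooth p₀ x hx _ := by
    have h1 : ∀ u v, ContDiffAt ℝ ∞ (fun y => pullMetric p₀ (fun p => G.inner p) y u v) x := by
      intro u v
      have h2 : ContMDiffAt (𝓡 n) ((𝓡 n).prod 𝓘(ℝ, ℝ)) ∞ (fun q => (Bundle.TotalSpace.mk' ℝ
          (E := Bundle.Trivial M ℝ) q (G.inner q (coordField p₀ u q) (coordField p₀ v q))))
          (chartInv p₀ x) := by
        apply ContMDiffAt.clm_bundle_apply₂ (F₁ := EuclideanSpace ℝ (Fin n))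
          (F₂ := EuclideanSpace ℝ (Fin n))
        · exact G.contMDiff.contMDiffAt
        · exact smoothFieldAt_coordField hx u
        · exact smoothFieldAt_coordField hx v
      rw [Bundle.contMDiffAt_section] at h2
      refine ((contMDiffAt_iff_contDiffAt hx).1 h2).congr_of_eventuallyEq ?_
      filter_upwards [(isOpen_chartDom p₀).mem_nhds hx] with y hy
      have h3 := coordField_chartInv hy u
      have h4 := coordField_chartInv hy v
      change _ = G.inner (chartInv p₀ y) (coordField p₀ u (chartInv p₀ y))
        (coordField p₀ v (chartInv p₀ y))
      rw [h3, h4]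
      rfl
    have h5 : pullMetric p₀ (fun p => G.inner p) = fun y => ∑ i, ∑ j,
        pullMetric p₀ (fun p => G.inner p) y (stdVec i) (stdVec j) •
          (stdCoord i).smulRight (stdCoord j) := funext fun y => bilin_eq_sum _
    rw [h5]
    exact .sum fun i _ => .sum fun j _ => ContDiffAt.fun_smul (h1 _ _) contDiffAt_const

end MetricSmooth

/-! ### Dimension four: a trace-free curvature tensor with a null vector vanishes -/

section DimensionFour

variable {V : Type*} [AddCommGroup V] [Module ℝ V] {b : V → V → ℝ} {e : Fin 4 → V}

lemma IsFrame.antisymm_eq_zero (he : IsFrame b e) {C : V → V → ℝ} (hC : IsBilin C)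
    (hs : ∀ x y, C x y = - C y x) (h0 : ∀ y, C (e 0) y = 0) (h1 : C (e 1) (e 2) = 0)
    (h2 : C (e 1) (e 3) = 0) (h3 : C (e 2) (e 3) = 0) (x y : V) : C x y = 0 := by
  obtain ⟨L, rfl⟩ := hC.exists_linear
  beta_reduce at hs h0 h1 h2 h3 ⊢
  have h0' : ∀ y, L y (e 0) = 0 := fun y => by rw [hs, h0, neg_zero]
  have hd : ∀ y, L y y = 0 := fun y => by linarith [hs y y]
  have h1' := hs (e 2) (e 1)
  have h2' := hs (e 3) (e 1)
  have h3' := hs (e 3) (e 2)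
  rw [← he.expand x, ← he.expand y]
  simp [Fin.sum_univ_four, h0, h0', hd, h1, h2, h3, h1', h2', h3']

/-- All components live on the span of `e 1, e 2, e 3`, and in dimension three a curvature tensor is
determined by its Ricci trace, which is zero here. -/
lemma IsCurvLike.eq_zero_of_null {W : V → V → V → V → ℝ} (hW : IsCurvLike W) (he : IsFrame b e)
    (htr : ∀ y z, ∑ i, W (e i) y z (e i) = 0) (h0 : ∀ y z t, W (e 0) y z t = 0) (x y z t : V) :
    W x y z t = 0 := by
  have h0' : ∀ x y t, W x y (e 0) t = 0 := fun x y t => by rw [hW.pair_symm, h0]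
  have hbil : ∀ z t, IsBilin fun x y => W x y z t := by
    obtain ⟨L, hL⟩ := hW.multilin
    intro z t
    rw [hL]; constructor <;> simp
  have hbil' : ∀ x y, IsBilin fun z t => W x y z t := by
    obtain ⟨L, hL⟩ := hW.multilin
    intro z t
    rw [hL]; constructor <;> simp
  have hd : ∀ x z t, W x x z t = 0 := fun x z t => by linarith [hW.swap_left x x z t]
  have hd' : ∀ x z t, W z t x x = 0 := fun x z t => by rw [hW.pair_symm, hd]
  have htr' : ∀ y z, W (e 1) y z (e 1) + W (e 2) y z (e 2) + W (e 3) y z (e 3) = 0 := fun y z => by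
    simpa [Fin.sum_univ_four, h0] using htr y z
  have hsw : ∀ a b c d, W b a d c = W a b c d := fun a b c d => by
    rw [hW.swap_left, hW.swap_right, neg_neg]
  have k1 := htr' (e 1) (e 1)
  have k2 := htr' (e 2) (e 2)
  have k3 := htr' (e 3) (e 3)
  have k12 := htr' (e 1) (e 2)
  have k13 := htr' (e 1) (e 3)
  have k23 := htr' (e 2) (e 3)
  simp only [hd, hd', zero_add, add_zero] at k1 k2 k3 k12 k13 k23
  -- The diagonal traces say that any two of the three sectional components add up to zero, so each
  -- is zero.
  have a12 : W (e 1) (e 2) (e 1) (e 2) = 0 := by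
    linarith [hsw (e 1) (e 2) (e 2) (e 1), hsw (e 1) (e 3) (e 3) (e 1),
      hsw (e 2) (e 3) (e 3) (e 2), hW.swap_right (e 1) (e 2) (e 1) (e 2)]
  have a13 : W (e 1) (e 3) (e 1) (e 3) = 0 := by
    linarith [hsw (e 1) (e 2) (e 2) (e 1), hsw (e 1) (e 3) (e 3) (e 1),
      hsw (e 2) (e 3) (e 3) (e 2), hW.swap_right (e 1) (e 3) (e 1) (e 3)]
  have a23 : W (e 2) (e 3) (e 2) (e 3) = 0 := by
    linarith [hsw (e 1) (e 2) (e 2) (e 1), hsw (e 1) (e 3) (e 3) (e 1),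
      hsw (e 2) (e 3) (e 3) (e 2), hW.swap_right (e 2) (e 3) (e 2) (e 3)]
  -- Each off-diagonal trace has a single surviving component.
  have b1 : W (e 1) (e 2) (e 1) (e 3) = 0 := by
    linarith [hsw (e 1) (e 2) (e 3) (e 1), hW.swap_right (e 1) (e 2) (e 1) (e 3),
      hW.pair_symm (e 1) (e 2) (e 3) (e 1), hW.swap_right (e 1) (e 3) (e 2) (e 1),
      hW.pair_symm (e 1) (e 2) (e 1) (e 3)]
  have b2 : W (e 1) (e 2) (e 2) (e 3) = 0 := by
    linarith [hsw (e 1) (e 2) (e 3) (e 2), hW.swap_right (e 1) (e 2) (e 2) (e 3),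
      hW.swap_left (e 1) (e 2) (e 3) (e 2)]
  have b3 : W (e 1) (e 3) (e 2) (e 3) = 0 := by
    linarith [hW.swap_left (e 3) (e 1) (e 2) (e 3)]
  have c : ∀ x y : V, W (e 1) (e 2) x y = 0 ∧ W (e 1) (e 3) x y = 0 ∧ W (e 2) (e 3) x y = 0 := by
    intro x y
    refine ⟨he.antisymm_eq_zero (hbil' _ _) (hW.swap_right _ _) (h0' _ _) a12 b1 b2 x y,
      he.antisymm_eq_zero (hbil' _ _) (hW.swap_right _ _) (h0' _ _) ?_ a13 b3 x y,
      he.antisymm_eq_zero (hbil' _ _) (hW.swap_right _ _) (h0' _ _) ?_ ?_ a23 x y⟩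
    · rw [hW.pair_symm, b1]
    · rw [hW.pair_symm, b2]
    · rw [hW.pair_symm, b3]
  exact he.antisymm_eq_zero (hbil z t) (fun x y => hW.swap_left x y z t) (fun y => h0 y z t)
    (c z t).1 (c z t).2.1 (c z t).2.2 x y

/-- The normalized `v` is put in front of an orthonormal basis of the hyperplane `ker (B v)`. -/
lemma exists_orthonormal_cons {n : ℕ} (B : V →ₗ[ℝ] V →ₗ[ℝ] ℝ) (hn : Module.finrank ℝ V = n + 1)
    [FiniteDimensional ℝ V] (hs : ∀ v w, B v w = B w v) (hpos : ∀ v, v ≠ 0 → 0 < B v v) {v : V}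
    (hv : v ≠ 0) : ∃ (e : Fin (n + 1) → V) (c : ℝ), e 0 = c • v ∧
      ∀ i j, B (e i) (e j) = if i = j then 1 else 0 := by
  have hv' := hpos v hv
  have hne : B v ≠ 0 := fun h => by simp [h] at hv'
  have hd := Module.Dual.finrank_ker_add_one_of_ne_zero hne
  set K := LinearMap.ker (B v) with hK
  obtain ⟨e', he'⟩ := exists_orthonormal (n := n) (V := K)
    (B.compl₁₂ K.subtype K.subtype) (by omega) (fun v w => hs v w)
    (fun v hv => hpos v fun h => hv (Subtype.ext h))
  have he'' : ∀ i j, B (e' i) (e' j) = if i = j then 1 else 0 := he'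
  have hp : ∀ i, B v (e' i) = 0 := fun i => (e' i).2
  refine ⟨Fin.cons ((Real.sqrt (B v v))⁻¹ • v) fun i => (e' i : V), _, rfl, fun i j => ?_⟩
  induction i using Fin.cases with
  | zero =>
    induction j using Fin.cases with
    | zero =>
      simp only [Fin.cons_zero, map_smul, LinearMap.smul_apply, smul_eq_mul, if_true]
      rw [← mul_assoc, ← mul_inv, Real.mul_self_sqrt hv'.le, inv_mul_cancel₀ hv'.ne']
    | succ j => simp [hp, (Fin.succ_ne_zero j).symm]
  | succ i =>
    induction j using Fin.cases with
    | zero => simp [hs (e' i) v, hp]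
    | succ j => simp [he'']

end DimensionFour

section FourManifold

variable {M : Type*} [TopologicalSpace M] [ChartedSpace (EuclideanSpace ℝ (Fin 4)) M]
  [IsManifold (𝓡 4) ∞ M]

lemma IsMetricOn.weylNull_eq_bot {g : BilinField 4 M} {U : Set M} (hg : IsMetricOn g U) {p : M}
    (hp : p ∈ U) (h : ∃ x y z t, weyl g p x y z t ≠ 0) : weylNull g p = ⊥ := by
  rw [Submodule.eq_bot_iff]
  intro v hv
  by_contra hne
  obtain ⟨x, y, z, t, hxyzt⟩ := h
  obtain ⟨e, c, he0, he⟩ := exists_orthonormal_cons (n := 3) (bilinAt g p)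
    (finrank_tangentSpace p) (hg.symm p hp) (hg.pos p hp) hne
  have heF := IsFrame.of_orth_metric hg hp he
  have he0' : e 0 ∈ weylNull g p := he0 ▸ Submodule.smul_mem _ _ hv
  exact hxyzt ((hg.isCurvLike_weyl hp).eq_zero_of_null heF (hg.trace_weyl hp le_rfl heF)
    ((hg.weylNull_iff hp _).1 he0') x y z t)

end FourManifold

/-! ### The regular set and the invariance of `E_𝕋` -/

section Regular

variable {n : ℕ} {M : Type*} [TopologicalSpace M] [ChartedSpace (EuclideanSpace ℝ (Fin n)) M]
  [IsManifold (𝓡 n) ∞ M]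

lemma isOpen_regularSet (g : BilinField n M) : IsOpen (regularSet g) := by
  rw [isOpen_iff_mem_nhds]
  intro p hp
  have hp' : ∀ᶠ q in 𝓝 p, rankE g q = rankE g p := hp
  filter_upwards [eventually_eventually_nhds.2 hp'] with q hq
  filter_upwards [hq] with r hr
  rw [hr, hq.self_of_nhds]

namespace IsMetricOn

variable {g : BilinField n M} {U : Set M} (hg : IsMetricOn g U)
include hg

lemma smoothFieldAt_fieldT_of_mem {p : M} (hp : p ∈ U) (hpr : p ∈ regularSet g) :
    SmoothFieldAt (fieldT g) p := by
  obtain ⟨p₀, x, hx, rfl⟩ := exists_chart (n := n) p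
  exact hg.smoothFieldAt_fieldT ⟨hx, hp⟩ hpr

lemma weylNull_eq_bot_of_rankE {p : M} (h : rankE g p = 0) : weylNull g p = ⊥ :=
  Submodule.finrank_eq_zero.1 h

lemma eventually_weyl_ne_zero {p : M} (hp : p ∈ U) (h : ∃ x y z t, weyl g p x y z t ≠ 0) :
    ∀ᶠ q in 𝓝 p, ∃ x y z t, weyl g q x y z t ≠ 0 := by
  obtain ⟨p₀, x, hx, rfl⟩ := exists_chart (n := n) p
  obtain ⟨u, v, w, t, h⟩ := h
  obtain ⟨u, rfl⟩ := chartD_surjective hx u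
  obtain ⟨v, rfl⟩ := chartD_surjective hx v
  obtain ⟨w, rfl⟩ := chartD_surjective hx w
  obtain ⟨t, rfl⟩ := chartD_surjective hx t
  rw [eventually_chart_iff hx]
  filter_upwards [(hg.smooth_weyl_const ⟨hx, hp⟩ u v w t).continuousAt.eventually_ne h] with y hy
  exact ⟨_, _, _, _, hy⟩

variable (hn : 4 ≤ n) {φ : M → ℝ} (hφ : ContMDiffOn (𝓡 n) 𝓘(ℝ, ℝ) ∞ φ U)
include hn hφ

lemma weylNull_conformal {p : M} (hp : p ∈ U) :
    weylNull (conformalChange φ g) p = weylNull g p := by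
  ext v
  rw [(hg.conformal hφ).weylNull_iff hp, hg.weylNull_iff hp]
  simp only [weyl_conformal hg hφ hn hp, mul_eq_zero, (Real.exp_pos _).ne', false_or]

lemma rankE_conformal {p : M} (hp : p ∈ U) : rankE (conformalChange φ g) p = rankE g p := by
  rw [rankE, rankE, hg.weylNull_conformal hn hφ hp]

lemma mem_regularSet_conformal {p : M} (hp : p ∈ U) :
    p ∈ regularSet (conformalChange φ g) ↔ p ∈ regularSet g := by
  refine Filter.eventually_congr ?_
  filter_upwards [hg.isOpen.mem_nhds hp] with q hq
  rw [hg.rankE_conformal hn hφ hq, hg.rankE_conformal hn hφ hp]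

/-- The orthogonality is required near `p` because `E_𝕋` contains first derivatives of `𝕋`, so the
transformation law must hold in a neighbourhood. -/
lemma confRicci_fieldT_conformal {p : M} (hp : p ∈ U) (hpr : p ∈ regularSet g)
    (hF : ∀ᶠ q in 𝓝 p, ∀ v ∈ weylNull g q, g q (gradient g φ q) v = 0)
    (x y : TangentSpace (𝓡 n) p) :
    confRicci (conformalChange φ g) (fieldT (conformalChange φ g)) p x y =
      confRicci g (fieldT g) p x y := by
  refine hg.confRicci_conformal hn hφ hp (hg.smoothFieldAt_fieldT_of_mem hp hpr)
    ((hg.conformal hφ).smoothFieldAt_fieldT_of_mem hp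
      ((hg.mem_regularSet_conformal hn hφ hp).2 hpr)) ?_ x y
  filter_upwards [hF, hg.isOpen.mem_nhds hp] with q hq hqU w
  rw [(hg.conformal hφ).apply_fieldT hqU, hg.apply_fieldT hqU,
    hg.fieldTDual_conformal hqU hn hφ hq, sub_apply]

/-- Regularity spreads rank zero to a neighbourhood, where `𝓔` is trivial and the gradient condition
is empty. -/
lemma confRicci_fieldT_conformal_of_rankE {p : M} (hp : p ∈ U) (hpr : p ∈ regularSet g)
    (h0 : rankE g p = 0) (x y : TangentSpace (𝓡 n) p) :
    confRicci (conformalChange φ g) (fieldT (conformalChange φ g)) p x y =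
      confRicci g (fieldT g) p x y := by
  refine hg.confRicci_fieldT_conformal hn hφ hp hpr ?_ x y
  have hpr' : ∀ᶠ q in 𝓝 p, rankE g q = rankE g p := hpr
  filter_upwards [hpr'] with q hq v hv
  rw [hg.weylNull_eq_bot_of_rankE (hq.trans h0), Submodule.mem_bot] at hv
  rw [hv, map_zero]

omit hn hφ in
-- Non-vanishing of `W` is an open condition and forces `𝓔 = 0` in dimension four, so the rank is
-- zero throughout a neighbourhood.
lemma mem_regularSet_of_weyl_ne_zero (hn : n = 4) {p : M} (hp : p ∈ U)
    (h : ∃ x y z t, weyl g p x y z t ≠ 0) : p ∈ regularSet g ∧ rankE g p = 0 := by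
  subst hn
  have h1 : ∀ q ∈ U, (∃ x y z t, weyl g q x y z t ≠ 0) → rankE g q = 0 := fun q hq hW => by
    rw [rankE, hg.weylNull_eq_bot hq hW, finrank_bot]
  refine ⟨?_, h1 p hp h⟩
  filter_upwards [hg.eventually_weyl_ne_zero hp h, hg.isOpen.mem_nhds hp] with q hW hq
  rw [h1 q hq hW, h1 p hp h]

end IsMetricOn
end Regular

end ConformalRicci

end

/-! ### The main theorem -/

theorem mainTheorem5 {n : ℕ} (hn : 4 ≤ n)
    {M : Type*} [TopologicalSpace M] [T2Space M] [SecondCountableTopology M]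
    [ChartedSpace (EuclideanSpace ℝ (Fin n)) M] [IsManifold (𝓡 n) ∞ M]
    (G : Bundle.ContMDiffRiemannianMetric (𝓡 n) ∞ (EuclideanSpace ℝ (Fin n))
      (TangentSpace (𝓡 n) : M → Type _))
    (g : ConformalRicci.BilinField n M) (hg : g = G.inner)
    (U : Set M) (hU : IsOpen U)
    (φ : M → ℝ) (hφ : ContMDiffOn (𝓡 n) 𝓘(ℝ, ℝ) ∞ φ U)
    (g' : ConformalRicci.BilinField n M) (hg' : g' = ConformalRicci.conformalChange φ g) :
    -- `M_𝓔` is open and the same for both metrics, and both vector fields `𝕋` are smooth on it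
    (IsOpen (ConformalRicci.regularSet g) ∧
      U ∩ ConformalRicci.regularSet g' = U ∩ ConformalRicci.regularSet g ∧
      ConformalRicci.SmoothFieldOn (ConformalRicci.fieldT g) (ConformalRicci.regularSet g) ∧
      ConformalRicci.SmoothFieldOn (ConformalRicci.fieldT g')
        (U ∩ ConformalRicci.regularSet g)) ∧
    -- if `∇φ ∈ 𝓔^⊥` on `M_𝓔`, the conformal Ricci tensors agree on `M_𝓔`
    ((∀ p ∈ U ∩ ConformalRicci.regularSet g, ∀ v ∈ ConformalRicci.weylNull g p,
        g p (ConformalRicci.gradient g φ p) v = 0) →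
      ∀ p ∈ U ∩ ConformalRicci.regularSet g, ∀ x y : TangentSpace (𝓡 n) p,
        ConformalRicci.confRicci g' (ConformalRicci.fieldT g') p x y =
          ConformalRicci.confRicci g (ConformalRicci.fieldT g) p x y) ∧
    -- they agree, for every `φ`, at the points of `M_𝓔` at which `𝓔` has rank zero
    (∀ p ∈ U ∩ ConformalRicci.regularSet g, ConformalRicci.rankE g p = 0 →
      ∀ x y : TangentSpace (𝓡 n) p,
        ConformalRicci.confRicci g' (ConformalRicci.fieldT g') p x y =
          ConformalRicci.confRicci g (ConformalRicci.fieldT g) p x y) ∧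
    -- in dimension four, this applies at every point at which the Weyl tensor is non-zero
    (n = 4 → ∀ p ∈ U, (∃ x y z t, ConformalRicci.weyl g p x y z t ≠ 0) →
      p ∈ ConformalRicci.regularSet g ∧ ConformalRicci.rankE g p = 0 ∧
      ∀ x y : TangentSpace (𝓡 n) p,
        ConformalRicci.confRicci g' (ConformalRicci.fieldT g') p x y =
          ConformalRicci.confRicci g (ConformalRicci.fieldT g) p x y) := by
  subst hg hg'
  -- Smoothness of `𝕋` is claimed on all of `M_𝓔`, so the metric is used on the whole manifold
  -- there; the conformal factor is smooth only on `U`.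
  have hu := ConformalRicci.isMetricOn_of_contMDiff G isOpen_univ
  have hgU := ConformalRicci.isMetricOn_of_contMDiff G hU
  refine ⟨⟨ConformalRicci.isOpen_regularSet _, ?_, fun p hp => ?_, fun p hp => ?_⟩, ?_, ?_, ?_⟩
  · ext p
    exact and_congr_right fun hp => hgU.mem_regularSet_conformal hn hφ hp
  · exact (hu.smoothFieldAt_fieldT_of_mem (Set.mem_univ p) hp).contMDiffWithinAt
  · exact ((hgU.conformal hφ).smoothFieldAt_fieldT_of_mem hp.1
      ((hgU.mem_regularSet_conformal hn hφ hp.1).2 hp.2)).contMDiffWithinAt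
  · intro hF p hp
    refine hgU.confRicci_fieldT_conformal hn hφ hp.1 hp.2 ?_
    filter_upwards [(hU.inter (ConformalRicci.isOpen_regularSet _)).mem_nhds hp] with q hq
    exact hF q hq
  · intro p hp h0
    exact hgU.confRicci_fieldT_conformal_of_rankE hn hφ hp.1 hp.2 h0
  · intro h4 p hp hW
    obtain ⟨h1, h2⟩ := hgU.mem_regularSet_of_weyl_ne_zero h4 hp hW
    exact ⟨h1, h2, hgU.confRicci_fieldT_conformal_of_rankE hn hφ hp h1 h2⟩
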